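/- For non-negative integers $m,n$ with $m+n>0$, let $\mathbf B_{m|n}=\{\overline m<\dots<\overline 1<1<\dots<n\}$, where $|b|=0$ for barred and $|b|=1$ for unbarred letters, and let $I_{m|n}=\{\overline{m-1},\dots,\overline1,0,1,\dots,n-1\}$ (without the index $0$ if $m=0$ or $n=0$). Let $P_{m|n}=\bigoplus_b\mathbb Z\epsilon_b$ with the form $(\epsilon_b,\epsilon_{b'})=(-1)^{|b|}\delta_{bb'}$. Put $\alpha_{\overline k}=\epsilon_{\overline{k+1}}-\epsilon_{\overline k}$, $\alpha_0=\epsilon_{\overline 1}-\epsilon_1$, $\alpha_l=\epsilon_l-\epsilon_{l+1}$, and $\langle h_i,\cdot\rangle=(\alpha_i,\cdot)$ for $i=\overline{m-1},\dots,\overline1,0$, $\langle h_i,\cdot\rangle=-(\alpha_i,\cdot)$ for $i=1,\dots,n-1$. A $\mathfrak{gl}_{m|n}$-crystal is a set $B$ with maps $\mathrm{wt}:B\to P_{m|n}$, $\varepsilon_i,\varphi_i:B\to\mathbb Z_{\ge0}$, $e_i,f_i:B\to B\cup\{0\}$ ($i\in I_{m|n}$) such that: $\varphi_i(b)-\varepsilon_i(b)=\langle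 h_i,\mathrm{wt}(b)\rangle$ for $i\ne0$; $\langle h_0,\mathrm{wt}(b)\rangle\ge0$, and $\varphi_0(b)+\varepsilon_0(b)$ is $0$ or $1$ according as $\langle h_0,\mathrm{wt}(b)\rangle$ is zero or positive; $e_i$ (where it is non-zero) changes $(\varepsilon_i,\varphi_i,\mathrm{wt})$ by $(-1,+1,+\alpha_i)$ and $f_i$ by $(+1,-1,-\alpha_i)$; and $f_ib=b'$ if and only if $e_ib'=b$. A $(\mathfrak{gl}_{m|n},\mathfrak{gl}_{u|v})$-bicrystal is a set with a $\mathfrak{gl}_{m|n}$-crystal structure ($e_i,f_i$) and a $\mathfrak{gl}_{u|v}$-crystal structure ($e_j^*,f_j^*$) such that each of $e_i,f_i$ commutes with each of $e_j^*,f_j^*$ as maps on $B\cup\{0\}$ fixing $0$. It is a coloured oriented graph with arrows $b\to f_ib$ and $b\to f_j^*b$. An isomorphism of bicrystals is an isomorphism of these coloured graphs that preserves both weights and all $\varepsilon,\varphi$ functions. The set $\mathbf B_{m|n}$ is the crystal $\overline m\xrightarrow{\overline{m-1}}\cdots\xrightarrow{\overline1}\overline1\xrightarrow{0}1\xrightarrow{1}\cdots\xrightarrow{n-1}n$,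 with $\mathrm{wt}(b)=\epsilon_b$ and with $\varepsilon_i(b)$, $\varphi_i(b)$ the number of $i$-arrows into, out of, $b$. Words $w_1\cdots w_r$ form a crystal as $w_1\otimes\cdots\otimes w_r$ (the empty word having weight $0$, $\varepsilon_i=\varphi_i=0$ and $e_i=f_i=0$) under the following rule, where $h_k=\langle h_i,\mathrm{wt}(b_k)\rangle$ and $\mathrm{wt}(b_1\otimes b_2)=\mathrm{wt}(b_1)+\mathrm{wt}(b_2)$. For $i=\overline{m-1},\dots,\overline1$: $\varepsilon_i(b_1\otimes b_2)=\max(\varepsilon_i(b_1),\varepsilon_i(b_2)-h_1)$, $\varphi_i(b_1\otimes b_2)=\max(\varphi_i(b_1)+h_2,\varphi_i(b_2))$; $e_i$ acts on $b_1$ if $\varphi_i(b_1)\ge\varepsilon_i(b_2)$ and on $b_2$ otherwise; $f_i$ acts on $b_1$ if $\varphi_i(b_1)>\varepsilon_i(b_2)$ and on $b_2$ otherwise. For $i=1,\dots,n-1$: $\varepsilon_i(b_1\otimes b_2)=\max(\varepsilon_i(b_1)-h_2,\varepsilon_i(b_2))$, $\varphi_i(b_1\otimes b_2)=\max(\varphi_i(b_1),\varphi_i(b_2)+h_1)$;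 $e_i$ acts on $b_1$ if $\varphi_i(b_2)<\varepsilon_i(b_1)$ and on $b_2$ otherwise; $f_i$ acts on $b_1$ if $\varphi_i(b_2)\le\varepsilon_i(b_1)$ and on $b_2$ otherwise. For $i=0$: $\varepsilon_0,\varphi_0,e_0,f_0$ are taken on $b_1$ if $h_1>0$ and on $b_2$ if $h_1=0$. A partition $\lambda$ is an $(m,n)$-hook partition if $\lambda_{m+1}\le n$; write $\mathcal P_{m|n}$ for the set of these. For $\lambda\in\mathcal P_{m|n}$, $\mathbf B_{m|n}(\lambda)$ is the set of fillings of $\lambda$ by letters of $\mathbf B_{m|n}$ that increase weakly along rows and columns, whose barred entries increase strictly in each column and whose unbarred entries increase strictly in each row. It carries the crystal structure of words through the column reading (columns from right to left, each from top to bottom). For a word $w=w_1\cdots w_r$, $P(w)=(\cdots(w_1\leftarrow w_2)\leftarrow\cdots)\leftarrow w_r$ is its column insertion tableau: $T\leftarrow b$ replaces by $b$ the smallest entry $b'$ of the first column with $b'\ge b$ if $b$ is barred, $b'>b$ if $b$ is unbarred (the highest such entry in case of ties), and continues with $b'$ in the next column; if there is no such entry, $b$ is put at the bottom of the column and the procedure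 stops. Let $m,n,u,v\ge0$ with $m+n>0$, $u+v>0$, and let $\mathbf M$ be the set of matrices $A=(a_{bb'})_{b\in\mathbf B_{m|n},\,b'\in\mathbf B_{u|v}}$ with entries in $\mathbb Z_{\ge0}$ and $a_{bb'}\le1$ whenever $|b|\ne|b'|$. List the pairs $(b,b')$ with multiplicities $a_{bb'}$, ordered first by increasing $b'$ and then by decreasing $b$ if $b'$ is barred, increasing $b$ if $b'$ is unbarred; this gives words $(\mathbf i,\mathbf j)$. List the same pairs, ordered first by increasing $b$ and then by decreasing $b'$ if $b$ is barred, increasing $b'$ if $b$ is unbarred; this gives words $(\mathbf k,\mathbf l)$. For $x=e,f$, let $x_iA$ be the matrix of pair multiplicities of $(x_i\mathbf i,\mathbf j)$ and $x_j^*A$ that of $(\mathbf k,x_j\mathbf l)$ (or $0$ if $x_i\mathbf i=0$, resp. $x_j\mathbf l=0$), with $\mathrm{wt},\varepsilon_i,\varphi_i$ taken from $\mathbf i$ and $\mathrm{wt}^*,\varepsilon_j^*,\varphi_j^*$ from $\mathbf l$; this makes $\mathbf M$ a $(\mathfrak{gl}_{m|n},\mathfrak{gl}_{u|v})$-bicrystal.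 Put $\pi(A)=(P(\mathbf i),P(\mathbf l))$. **Proposition.** For each connected component $\mathbf C$ of $\mathbf M$, as a $(\mathfrak{gl}_{m|n},\mathfrak{gl}_{u|v})$-bicrystal, there are $\lambda\in\mathcal P_{m|n}$ and $\mu\in\mathcal P_{u|v}$ such that $\pi$ restricts to an isomorphism of $(\mathfrak{gl}_{m|n},\mathfrak{gl}_{u|v})$-bicrystals $$\pi:\mathbf C\longrightarrow\mathbf B_{m|n}(\lambda)\times\mathbf B_{u|v}(\mu),$$ where the product carries $x_i(b_1,b_2)=(x_ib_1,b_2)$ and $x_j^*(b_1,b_2)=(b_1,x_jb_2)$, with $\mathrm{wt},\varepsilon_i,\varphi_i$ taken from $b_1$ and $\mathrm{wt}^*,\varepsilon_j^*,\varphi_j^*$ from $b_2$. -/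

import Mathlib

namespace HookCrystal

/-! ### Letters, weights, roots -/

/-- The alphabet `B_{m|n} = {m̄ < ⋯ < 1̄ < 1 < ⋯ < n}`, in increasing order: the element `k` of
`Fin (m + n)` is the letter `\overline{m - k}` if `k < m`, and the letter `k - m + 1` if `m ≤ k`. -/
abbrev Letter (m n : ℕ) := Fin (m + n)

/-- The degree `|b|`: `0` on the barred letters and `1` on the unbarred letters. -/
def degree (m n : ℕ) (b : Letter m n) : ℕ := if b.1 < m then 0 else 1

/-- The index set `I_{m|n}` of simple roots. The element `i` is the colour of the arrow from the
`i`-th to the `(i+1)`-st letter. It is a barred index if `i + 1 < m`, the index `0` if `i + 1 = m`,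
and the index `i + 1 - m ≥ 1` if `m < i + 1`. -/
abbrev Idx (m n : ℕ) := Fin (m + n - 1)

/-- The letter at which the `i`-coloured arrow starts. -/
def src {m n : ℕ} (i : Idx m n) : Letter m n := ⟨i.1, by have := i.2; omega⟩

/-- The letter at which the `i`-coloured arrow ends. -/
def tgt {m n : ℕ} (i : Idx m n) : Letter m n := ⟨i.1 + 1, by have := i.2; omega⟩

/-- The weight lattice `P_{m|n}`, the free abelian group on the letters. -/
abbrev Weight (m n : ℕ) := Letter m n → ℤ

/-- The bilinear form with `(ε_b, ε_b') = (-1)^{|b|} δ_{b b'}`. -/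
def form (m n : ℕ) (x y : Weight m n) : ℤ := ∑ b, (-1) ^ degree m n b * x b * y b

/-- The simple root `α_i`. -/
def root (m n : ℕ) (i : Idx m n) : Weight m n := Pi.single (src i) 1 - Pi.single (tgt i) 1

/-- The value `⟨h_i, x⟩` of the simple coroot `h_i`. -/
def coroot (m n : ℕ) (i : Idx m n) (x : Weight m n) : ℤ :=
  if i.1 + 1 ≤ m then form m n (root m n i) x else - form m n (root m n i) x

/-! ### Crystals and bicrystals -/

/-- The maps that make up a crystal graph for `gl_{m|n}`, on an ambient type `X`;
`none` is the formal symbol `0`. -/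
structure CrystalData (m n : ℕ) (X : Type*) where
  wt : X → Weight m n
  eps : Idx m n → X → ℕ
  phi : Idx m n → X → ℕ
  e : Idx m n → X → Option X
  f : Idx m n → X → Option X

/-- The subset `S` of `X`, with the given maps, is a crystal graph for `gl_{m|n}`. -/
structure IsCrystal {m n : ℕ} {X : Type*} (D : CrystalData m n X) (S : Set X) : Prop where
  e_mem : ∀ i, ∀ b ∈ S, ∀ b', D.e i b = some b' → b' ∈ S
  f_mem : ∀ i, ∀ b ∈ S, ∀ b', D.f i b = some b' → b' ∈ S
  phi_sub_eps : ∀ i : Idx m n, i.1 + 1 ≠ m → ∀ b ∈ S,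
    (D.phi i b : ℤ) - D.eps i b = coroot m n i (D.wt b)
  coroot_zero_nonneg : ∀ i : Idx m n, i.1 + 1 = m → ∀ b ∈ S, 0 ≤ coroot m n i (D.wt b)
  phi_add_eps : ∀ i : Idx m n, i.1 + 1 = m → ∀ b ∈ S,
    D.phi i b + D.eps i b = if coroot m n i (D.wt b) = 0 then 0 else 1
  e_spec : ∀ i, ∀ b ∈ S, ∀ b', D.e i b = some b' →
    (D.eps i b' : ℤ) = D.eps i b - 1 ∧ D.phi i b' = D.phi i b + 1 ∧
      D.wt b' = D.wt b + root m n i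
  f_spec : ∀ i, ∀ b ∈ S, ∀ b', D.f i b = some b' →
    D.eps i b' = D.eps i b + 1 ∧ (D.phi i b' : ℤ) = D.phi i b - 1 ∧
      D.wt b' = D.wt b - root m n i
  f_iff_e : ∀ i, ∀ b ∈ S, ∀ b' ∈ S, D.f i b = some b' ↔ D.e i b' = some b

/-- A pair of crystal structures, for `gl_{m|n}` and for `gl_{u|v}`, on the same ambient type. -/
structure BicrystalData (m n u v : ℕ) (X : Type*) where
  left : CrystalData m n X
  right : CrystalData u v X

/-- Two partial maps commute at `b`, as maps from `X ∪ {0}` to itself that send `0` to `0`. -/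
def CommuteAt {X : Type*} (x y : X → Option X) (b : X) : Prop :=
  (y b).bind x = (x b).bind y

/-- The subset `S` of `X`, with the given maps, is a `(gl_{m|n}, gl_{u|v})`-bicrystal. -/
structure IsBicrystal {m n u v : ℕ} {X : Type*} (D : BicrystalData m n u v X) (S : Set X) :
    Prop where
  left : IsCrystal D.left S
  right : IsCrystal D.right S
  e_e : ∀ i j, ∀ b ∈ S, CommuteAt (D.left.e i) (D.right.e j) b
  e_f : ∀ i j, ∀ b ∈ S, CommuteAt (D.left.e i) (D.right.f j) b
  f_e : ∀ i j, ∀ b ∈ S, CommuteAt (D.left.f i) (D.right.e j) b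
  f_f : ∀ i j, ∀ b ∈ S, CommuteAt (D.left.f i) (D.right.f j) b

/-- There is an arrow, of a colour in `I_{m|n} ⊔ I_{u|v}^*`, from `x` to `y` inside `S`. -/
def Arrow {m n u v : ℕ} {X : Type*} (D : BicrystalData m n u v X) (S : Set X) (x y : X) : Prop :=
  x ∈ S ∧ y ∈ S ∧ ((∃ i, D.left.f i x = some y) ∨ ∃ j, D.right.f j x = some y)

/-- `C` is a connected component of the coloured oriented graph on `S`. -/
def IsComponent {m n u v : ℕ} {X : Type*} (D : BicrystalData m n u v X) (S C : Set X) : Prop :=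
  ∃ x ∈ S, C = {y | y ∈ S ∧ Relation.EqvGen (Arrow D S) x y}

/-- `ψ` restricts to a bijection from `S` onto `T` that preserves the coloured arrows in both
directions, the weights, and the functions `ε_i` and `φ_i`. -/
structure PreservesCrystal {m n : ℕ} {X Y : Type*} (D : CrystalData m n X) (S : Set X)
    (E : CrystalData m n Y) (T : Set Y) (ψ : X → Y) : Prop where
  bijOn : Set.BijOn ψ S T
  arrow : ∀ i, ∀ x ∈ S, ∀ y ∈ S, D.f i x = some y ↔ E.f i (ψ x) = some (ψ y)
  wt : ∀ x ∈ S, E.wt (ψ x) = D.wt x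
  eps : ∀ i, ∀ x ∈ S, E.eps i (ψ x) = D.eps i x
  phi : ∀ i, ∀ x ∈ S, E.phi i (ψ x) = D.phi i x

/-- `ψ` restricts to an isomorphism of `(gl_{m|n}, gl_{u|v})`-bicrystals from `S` onto `T`. -/
structure IsBicrystalIso {m n u v : ℕ} {X Y : Type*} (D : BicrystalData m n u v X) (S : Set X)
    (E : BicrystalData m n u v Y) (T : Set Y) (ψ : X → Y) : Prop where
  source : IsBicrystal D S
  target : IsBicrystal E T
  left : PreservesCrystal D.left S E.left T ψ
  right : PreservesCrystal D.right S E.right T ψ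

/-! ### Tensor products and words -/

/-- The value `ε_i(b₁ ⊗ b₂)`, from `ε_k = ε_i(b_k)` and `h_k = ⟨h_i, wt(b_k)⟩`. -/
def tensorEps {m n : ℕ} (i : Idx m n) (ε₁ ε₂ : ℕ) (h₁ h₂ : ℤ) : ℕ :=
  if i.1 + 1 < m then (max (ε₁ : ℤ) (ε₂ - h₁)).toNat
  else if i.1 + 1 = m then (if 0 < h₁ then ε₁ else ε₂)
  else (max ((ε₁ : ℤ) - h₂) ε₂).toNat

/-- The value `φ_i(b₁ ⊗ b₂)`, from `φ_k = φ_i(b_k)` and `h_k = ⟨h_i, wt(b_k)⟩`. -/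
def tensorPhi {m n : ℕ} (i : Idx m n) (φ₁ φ₂ : ℕ) (h₁ h₂ : ℤ) : ℕ :=
  if i.1 + 1 < m then (max ((φ₁ : ℤ) + h₂) φ₂).toNat
  else if i.1 + 1 = m then (if 0 < h₁ then φ₁ else φ₂)
  else (max (φ₁ : ℤ) (φ₂ + h₁)).toNat

/-- `e_i(b₁ ⊗ b₂) = e_i b₁ ⊗ b₂` (otherwise it is `b₁ ⊗ e_i b₂`). -/
def EActsLeft {m n : ℕ} (i : Idx m n) (ε₁ φ₁ ε₂ φ₂ : ℕ) (h₁ : ℤ) : Prop :=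
  (i.1 + 1 < m ∧ ε₂ ≤ φ₁) ∨ (i.1 + 1 = m ∧ 0 < h₁) ∨ (m < i.1 + 1 ∧ φ₂ < ε₁)

/-- `f_i(b₁ ⊗ b₂) = f_i b₁ ⊗ b₂` (otherwise it is `b₁ ⊗ f_i b₂`). -/
def FActsLeft {m n : ℕ} (i : Idx m n) (ε₁ φ₁ ε₂ φ₂ : ℕ) (h₁ : ℤ) : Prop :=
  (i.1 + 1 < m ∧ ε₂ < φ₁) ∨ (i.1 + 1 = m ∧ 0 < h₁) ∨ (m < i.1 + 1 ∧ φ₂ ≤ ε₁)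

instance {m n : ℕ} (i : Idx m n) (ε₁ φ₁ ε₂ φ₂ : ℕ) (h₁ : ℤ) :
    Decidable (EActsLeft i ε₁ φ₁ ε₂ φ₂ h₁) := by unfold EActsLeft; infer_instance

instance {m n : ℕ} (i : Idx m n) (ε₁ φ₁ ε₂ φ₂ : ℕ) (h₁ : ℤ) :
    Decidable (FActsLeft i ε₁ φ₁ ε₂ φ₂ h₁) := by unfold FActsLeft; infer_instance

/-- The crystal `B_{m|n}` of letters. -/
def letterData (m n : ℕ) : CrystalData m n (Letter m n) where
  wt b := Pi.single b 1
  eps i b := if b = tgt i then 1 else 0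
  phi i b := if b = src i then 1 else 0
  e i b := if b = tgt i then some (src i) else none
  f i b := if b = src i then some (tgt i) else none

/-- The weight of a word. -/
def wordWt (m n : ℕ) : List (Letter m n) → Weight m n
  | [] => 0
  | b :: w => (letterData m n).wt b + wordWt m n w

/-- `ε_i` of a word; `b :: w` is the tensor product of the letter `b` and the word `w`. -/
def wordEps (m n : ℕ) (i : Idx m n) : List (Letter m n) → ℕ
  | [] => 0
  | b :: w => tensorEps i ((letterData m n).eps i b) (wordEps m n i w)
      (coroot m n i ((letterData m n).wt b)) (coroot m n i (wordWt m n w))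

/-- `φ_i` of a word. -/
def wordPhi (m n : ℕ) (i : Idx m n) : List (Letter m n) → ℕ
  | [] => 0
  | b :: w => tensorPhi i ((letterData m n).phi i b) (wordPhi m n i w)
      (coroot m n i ((letterData m n).wt b)) (coroot m n i (wordWt m n w))

/-- The Kashiwara operator `e_i` on words. -/
def wordE (m n : ℕ) (i : Idx m n) : List (Letter m n) → Option (List (Letter m n))
  | [] => none
  | b :: w =>
    if EActsLeft i ((letterData m n).eps i b) ((letterData m n).phi i b)
        (wordEps m n i w) (wordPhi m n i w) (coroot m n i ((letterData m n).wt b))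
    then ((letterData m n).e i b).map (fun b' => b' :: w)
    else (wordE m n i w).map (fun w' => b :: w')

/-- The Kashiwara operator `f_i` on words. -/
def wordF (m n : ℕ) (i : Idx m n) : List (Letter m n) → Option (List (Letter m n))
  | [] => none
  | b :: w =>
    if FActsLeft i ((letterData m n).eps i b) ((letterData m n).phi i b)
        (wordEps m n i w) (wordPhi m n i w) (coroot m n i ((letterData m n).wt b))
    then ((letterData m n).f i b).map (fun b' => b' :: w)
    else (wordF m n i w).map (fun w' => b :: w')

/-- The crystal of all finite words in the letters `B_{m|n}`, a word of length `r` being an element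
of the `r`-th tensor power of `B_{m|n}`. -/
def wordData (m n : ℕ) : CrystalData m n (List (Letter m n)) where
  wt := wordWt m n
  eps := wordEps m n
  phi := wordPhi m n
  e := wordE m n
  f := wordF m n

/-! ### Hook semistandard tableaux -/

/-- A filling of a diagram, as the list of its columns from left to right, each of them read from
top to bottom. -/
abbrev Filling (m n : ℕ) := List (List (Letter m n))

/-- The entry in row `r` and column `c` (both counted from `0`), if there is one. -/
def Filling.entry {m n : ℕ} (T : Filling m n) (r c : ℕ) : Option (Letter m n) :=
  T[c]?.bind fun col => col[r]?

/-- The Young diagram `μ` is an `(m,n)`-hook partition: its `(m+1)`-st row has length at most `n`. -/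
def IsHook (m n : ℕ) (μ : YoungDiagram) : Prop := μ.rowLen m ≤ n

/-- The columns of `T` have the lengths of the columns of `μ`. -/
def HasShape {m n : ℕ} (T : Filling m n) (μ : YoungDiagram) : Prop :=
  T.map List.length = (List.range (μ.rowLen 0)).map μ.colLen

/-- Rows and columns increase weakly; unbarred letters increase strictly along rows, and barred
letters increase strictly along columns. -/
structure IsSemistandard {m n : ℕ} (T : Filling m n) : Prop where
  row_weak : ∀ r c c' a b, c < c' → T.entry r c = some a → T.entry r c' = some b → a ≤ b
  col_weak : ∀ r r' c a b, r < r' → T.entry r c = some a → T.entry r' c = some b → a ≤ b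
  row_strict : ∀ r c c' a b, c < c' → T.entry r c = some a → T.entry r c' = some b →
    degree m n a = 1 → degree m n b = 1 → a < b
  col_strict : ∀ r r' c a b, r < r' → T.entry r c = some a → T.entry r' c = some b →
    degree m n a = 0 → degree m n b = 0 → a < b

/-- The set `B_{m|n}(μ)` of `(m,n)`-hook semistandard tableaux of shape `μ`. -/
def tableaux (m n : ℕ) (μ : YoungDiagram) : Set (Filling m n) :=
  {T | HasShape T μ ∧ IsSemistandard T}

/-- The column reading: columns from right to left, each of them from top to bottom. -/
def Filling.reading {m n : ℕ} (T : Filling m n) : List (Letter m n) := T.reverse.flatten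

/-- The filling of the diagram of `T` whose column reading is `w`. -/
def Filling.refill {m n : ℕ} (T : Filling m n) (w : List (Letter m n)) : Filling m n :=
  ((T.reverse.map List.length).splitLengths w).reverse

/-- Refilling the diagram of `T` by a word of the right length gives a filling with the columns of
the same lengths and with that column reading. -/
theorem reading_refill {m n : ℕ} (T : Filling m n) (w : List (Letter m n))
    (h : w.length = T.reading.length) :
    (T.refill w).reading = w ∧ (T.refill w).map List.length = T.map List.length := by
  have h' : (T.reverse.map List.length).sum = w.length := by
    rw [h, Filling.reading, List.length_flatten]
  constructor
  · rw [Filling.reading, Filling.refill, List.reverse_reverse]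
    exact List.flatten_splitLengths _ _ h'.ge
  · rw [Filling.refill, List.map_reverse, List.map_splitLengths_length _ _ h'.le,
      List.map_reverse, List.reverse_reverse]

/-- The crystal maps on fillings, induced by those on words through the column reading. -/
def tableauData (m n : ℕ) : CrystalData m n (Filling m n) where
  wt T := (wordData m n).wt T.reading
  eps i T := (wordData m n).eps i T.reading
  phi i T := (wordData m n).phi i T.reading
  e i T := ((wordData m n).e i T.reading).map T.refill
  f i T := ((wordData m n).f i T.reading).map T.refill

/-- `x_i(b₁, b₂) = (x_i b₁, b₂)` and `x_j^*(b₁, b₂) = (b₁, x_j b₂)` on pairs. -/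
def prodData {m n u v : ℕ} {X Y : Type*} (D : CrystalData m n X) (E : CrystalData u v Y) :
    BicrystalData m n u v (X × Y) where
  left :=
    { wt := fun p => D.wt p.1
      eps := fun i p => D.eps i p.1
      phi := fun i p => D.phi i p.1
      e := fun i p => (D.e i p.1).map fun x => (x, p.2)
      f := fun i p => (D.f i p.1).map fun x => (x, p.2) }
  right :=
    { wt := fun p => E.wt p.2
      eps := fun j p => E.eps j p.2
      phi := fun j p => E.phi j p.2
      e := fun j p => (E.e j p.2).map fun y => (p.1, y)
      f := fun j p => (E.f j p.2).map fun y => (p.1, y) }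

/-! ### Column bumping -/

/-- The letter `b` bumps out the entry `c` of a column: `c ≥ b` if `b` is barred, and `c > b` if `b`
is unbarred. -/
def Bumps (m n : ℕ) (b c : Letter m n) : Prop := if degree m n b = 0 then b ≤ c else b < c

instance (m n : ℕ) (b c : Letter m n) : Decidable (Bumps m n b c) := by
  unfold Bumps; infer_instance

/-- Insert `b` into a column, and return the new column and the letter bumped out of it, if any.
The columns of a tableau increase weakly, so the highest among the smallest entries which `b` bumps
is the first entry which `b` bumps. -/
def bumpColumn (m n : ℕ) (b : Letter m n) : List (Letter m n) → List (Letter m n) × Option (Letter m n)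
  | [] => ([b], none)
  | c :: cs =>
    if Bumps m n b c then (b :: cs, some c)
    else (c :: (bumpColumn m n b cs).1, (bumpColumn m n b cs).2)

/-- The tableau `T ← b`. -/
def insertLetter (m n : ℕ) : Filling m n → Letter m n → Filling m n
  | [], b => [[b]]
  | col :: cols, b =>
    match bumpColumn m n b col with
    | (col', none) => col' :: cols
    | (col', some c) => col' :: insertLetter m n cols c

/-- The tableau `P(w) = (⋯((w₁ ← w₂) ← w₃)⋯) ← w_r`. -/
def insertionTableau (m n : ℕ) (w : List (Letter m n)) : Filling m n :=
  w.foldl (insertLetter m n) []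

/-! ### Biwords and matrices -/

/-- The super lexicographic order on pairs of letters. -/
def SuperLT (m n u v : ℕ) (p q : Letter m n × Letter u v) : Prop :=
  p.2 < q.2 ∨ (p.2 = q.2 ∧ degree u v p.2 = 0 ∧ q.1 < p.1) ∨
    (p.2 = q.2 ∧ degree u v p.2 = 1 ∧ p.1 < q.1)

/-- The set `Ω_{m|n,u|v}` of biwords `(i₁,j₁) ≤ ⋯ ≤ (i_r,j_r)` in which a pair of letters of
different degrees is not repeated. -/
def Omega (m n u v : ℕ) : Set (List (Letter m n × Letter u v)) :=
  {w | w.IsChain (fun p q => p = q ∨ SuperLT m n u v p q) ∧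
    w.IsChain (fun p q => degree m n p.1 ≠ degree u v p.2 → p ≠ q)}

/-- The set `M_{m|n,u|v}` of matrices of non-negative integers. -/
def matrices (m n u v : ℕ) : Set (Matrix (Letter m n) (Letter u v) ℕ) :=
  {A | ∀ b b', degree m n b ≠ degree u v b' → A b b' ≤ 1}

/-- The matrix of a biword: the entry at `(b, b')` is the multiplicity of that pair. -/
def toMatrix {m n u v : ℕ} (w : List (Letter m n × Letter u v)) :
    Matrix (Letter m n) (Letter u v) ℕ := Matrix.of fun b b' => w.count (b, b')

/-- The biword `(i, j)` in `Ω` with matrix `A`. -/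
def biword {m n u v : ℕ} (A : Matrix (Letter m n) (Letter u v) ℕ) :
    List (Letter m n × Letter u v) :=
  (List.finRange (u + v)).flatMap fun b' =>
    (if degree u v b' = 0 then (List.finRange (m + n)).reverse else List.finRange (m + n)).flatMap
      fun b => List.replicate (A b b') (b, b')

/-- The weak super lexicographic order is transitive. -/
theorem superLE_trans {m n u v : ℕ} {p q r : Letter m n × Letter u v}
    (h : p = q ∨ SuperLT m n u v p q) (h' : q = r ∨ SuperLT m n u v q r) :
    p = r ∨ SuperLT m n u v p r := by
  rcases h with rfl | h
  · exact h'
  rcases h' with rfl | h'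
  · exact Or.inr h
  right
  rcases h with h | ⟨h, hd, hl⟩ | ⟨h, hd, hl⟩ <;> rcases h' with k | ⟨k, kd, kl⟩ | ⟨k, kd, kl⟩
  · exact Or.inl (h.trans k)
  · exact Or.inl (k ▸ h)
  · exact Or.inl (k ▸ h)
  · exact Or.inl (h ▸ k)
  · exact Or.inr (Or.inl ⟨h.trans k, hd, kl.trans hl⟩)
  · rw [h] at hd; omega
  · exact Or.inl (h ▸ k)
  · rw [h] at hd; omega
  · exact Or.inr (Or.inr ⟨h.trans k, hd, hl.trans kl⟩)

/-- `biword A` has matrix `A`. -/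
theorem toMatrix_biword {m n u v : ℕ} (A : Matrix (Letter m n) (Letter u v) ℕ) :
    toMatrix (biword A) = A := by
  ext b b'
  have key : ∀ (c' : Letter u v) (l : List (Letter m n)), l.Perm (List.finRange (m + n)) →
      (l.flatMap fun c => List.replicate (A c c') (c, c')).count (b, b') =
        if c' = b' then A b c' else 0 := by
    intro c' l hl
    rw [List.count_flatMap, (hl.map _).sum_eq, ← List.ofFn_eq_map, List.sum_ofFn]
    simp only [Function.comp_apply, List.count_replicate, beq_iff_eq, Prod.mk.injEq]
    split_ifs with h
    · simp [h]
    · simp [h]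
  simp only [toMatrix, Matrix.of_apply, biword, List.count_flatMap]
  rw [← List.ofFn_eq_map, List.sum_ofFn,
    Finset.sum_congr rfl (g := fun c' => if c' = b' then A b c' else 0)]
  · simp
  · intro c' _
    apply key
    split_ifs
    · exact List.reverse_perm _
    · exact List.Perm.refl _

/-- For `A` in `M`, the biword of `A` is in `Ω`. -/
theorem biword_mem_Omega {m n u v : ℕ} {A : Matrix (Letter m n) (Letter u v) ℕ}
    (hA : A ∈ matrices m n u v) : biword A ∈ Omega m n u v := by
  have hs : (biword A).Pairwise (fun p q => p = q ∨ SuperLT m n u v p q) := by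
    unfold biword
    rw [List.pairwise_flatMap]
    refine ⟨fun b' _ => ?_, ?_⟩
    · rw [List.pairwise_flatMap]
      refine ⟨fun b _ => List.pairwise_replicate.2 (Or.inr (Or.inl rfl)), ?_⟩
      split_ifs with h
      · rw [List.pairwise_reverse]
        refine (List.pairwise_lt_finRange _).imp ?_
        intro a c hac x hx y hy
        rw [List.eq_of_mem_replicate hx, List.eq_of_mem_replicate hy]
        exact Or.inr (Or.inr (Or.inl ⟨rfl, h, hac⟩))
      · refine (List.pairwise_lt_finRange _).imp ?_
        intro a c hac x hx y hy
        rw [List.eq_of_mem_replicate hx, List.eq_of_mem_replicate hy]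
        refine Or.inr (Or.inr (Or.inr ⟨rfl, ?_, hac⟩))
        simp only [degree] at h ⊢
        split_ifs at h ⊢ <;> simp_all
    · refine (List.pairwise_lt_finRange _).imp ?_
      intro a c hac x hx y hy
      obtain ⟨_, _, hx⟩ := List.mem_flatMap.1 hx
      obtain ⟨_, _, hy⟩ := List.mem_flatMap.1 hy
      rw [List.eq_of_mem_replicate hx, List.eq_of_mem_replicate hy]
      exact Or.inr (Or.inl hac)
  refine ⟨hs.isChain, ?_⟩
  rw [List.isChain_iff_forall_rel_of_append_cons_cons]
  rintro ⟨b, b'⟩ q l₁ l₂ hl hd rfl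
  have h2 : A b b' = (biword A).count (b, b') := (congrFun (congrFun (toMatrix_biword A) b) b').symm
  have h1 := hA b b' hd
  rw [h2, hl] at h1
  simp at h1
  omega

/-- A biword in `Ω` is determined by its matrix. -/
theorem eq_biword {m n u v : ℕ} {A : Matrix (Letter m n) (Letter u v) ℕ}
    {w : List (Letter m n × Letter u v)} (hw : w ∈ Omega m n u v) (h : toMatrix w = A)
    (hA : A ∈ matrices m n u v) : w = biword A := by
  have : IsTrans (Letter m n × Letter u v) (fun p q => p = q ∨ SuperLT m n u v p q) :=
    ⟨fun _ _ _ => superLE_trans⟩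
  refine List.Perm.eq_of_pairwise (le := fun p q => p = q ∨ SuperLT m n u v p q) ?_
    hw.1.pairwise (biword_mem_Omega hA).1.pairwise ?_
  · rintro p q - - (h | h) (h' | h')
    · exact h
    · exact h
    · exact h'.symm
    · rcases h with h | ⟨h, hd, hl⟩ | ⟨h, hd, hl⟩ <;>
        rcases h' with k | ⟨k, kd, kl⟩ | ⟨k, kd, kl⟩ <;> grind
  · rw [List.perm_iff_count]
    rintro ⟨b, b'⟩
    exact congrFun (congrFun (h.trans (toMatrix_biword A).symm) b) b'

/-- The biword `(k, l)` in `Ω^*` with matrix `A`: `(l, k)` is in `Ω_{u|v,m|n}`, with matrix the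
transpose of `A`. -/
def cobiword {m n u v : ℕ} (A : Matrix (Letter m n) (Letter u v) ℕ) :
    List (Letter m n × Letter u v) := (biword A.transpose).map Prod.swap

/-- The upper word `i` of `(i, j) ∈ Ω`. -/
def wordI {m n u v : ℕ} (A : Matrix (Letter m n) (Letter u v) ℕ) : List (Letter m n) :=
  (biword A).map Prod.fst

/-- The lower word `j` of `(i, j) ∈ Ω`. -/
def wordJ {m n u v : ℕ} (A : Matrix (Letter m n) (Letter u v) ℕ) : List (Letter u v) :=
  (biword A).map Prod.snd

/-- The upper word `k` of `(k, l) ∈ Ω^*`. -/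
def wordK {m n u v : ℕ} (A : Matrix (Letter m n) (Letter u v) ℕ) : List (Letter m n) :=
  (cobiword A).map Prod.fst

/-- The lower word `l` of `(k, l) ∈ Ω^*`. -/
def wordL {m n u v : ℕ} (A : Matrix (Letter m n) (Letter u v) ℕ) : List (Letter u v) :=
  (cobiword A).map Prod.snd

/-- The crystal maps on matrices, for `gl_{m|n}` through `x_i(i, j) = (x_i i, j)` on `Ω`, and for
`gl_{u|v}` through `x_j^*(k, l) = (k, x_j l)` on `Ω^*`. -/
def matrixData (m n u v : ℕ) : BicrystalData m n u v (Matrix (Letter m n) (Letter u v) ℕ) where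
  left :=
    { wt := fun A => (wordData m n).wt (wordI A)
      eps := fun i A => (wordData m n).eps i (wordI A)
      phi := fun i A => (wordData m n).phi i (wordI A)
      e := fun i A => ((wordData m n).e i (wordI A)).map fun w => toMatrix (w.zip (wordJ A))
      f := fun i A => ((wordData m n).f i (wordI A)).map fun w => toMatrix (w.zip (wordJ A)) }
  right :=
    { wt := fun A => (wordData u v).wt (wordL A)
      eps := fun j A => (wordData u v).eps j (wordL A)
      phi := fun j A => (wordData u v).phi j (wordL A)
      e := fun j A => ((wordData u v).e j (wordL A)).map fun w => toMatrix ((wordK A).zip w)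
      f := fun j A => ((wordData u v).f j (wordL A)).map fun w => toMatrix ((wordK A).zip w) }

/-- The map `π(A) = (P(i), P(l))`. -/
def piMap (m n u v : ℕ) (A : Matrix (Letter m n) (Letter u v) ℕ) : Filling m n × Filling u v :=
  (insertionTableau m n (wordI A), insertionTableau u v (wordL A))

end HookCrystal

/-! The proof compares words with their insertion tableaux, and then matrices with pairs of
tableaux.

Words. The pairs (ε_i, φ_i) multiply under ⊗ in a monoid, so the crystal of words does not depend on
the bracketing. Call two words equivalent if every sequence of operators is defined on both or on
neither, with the same weights and the same ε, φ. Column bumping is a chain of Knuth moves on three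
adjacent letters, each of which commutes with all operators, so a word is equivalent to the column
reading of its insertion tableau (`crystalEquiv_insertionTableau`).

Tableaux. The operators keep tableaux of a given shape among themselves (`IsTableau.exists_wordF`,
`IsTableau.exists_wordE`), and the resulting crystal is connected (`IsTableau.wordConn`).
Connectedness is proved on Gelfand-Tsetlin patterns, level by level (`connLevel`): once the lower
levels may be chosen freely, they are chosen so that some e_i adds a box to a prescribed column of
the next level. Equivalent tableaux are equal (`IsTableau.eq_of_crystalEquiv`): the tableau with the
smallest entries has the largest partial sums of weights, these recover the shape, and within the
shape no other tableau has them. Hence P is constant on equivalence classes and commutes with the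
operators. On a component of the crystal of words P is injective, because the shapes of the tableaux
of the prefixes are constant there and insertion with known shapes can be reversed
(`WordConn.eq_of_insertionTableau_eq`).

Matrices. Transposition exchanges the two structures, and f_i reads a matrix column by column. An
operator f_j^* changes only two adjacent columns, so its interplay with f_i takes place in a block
of two rows and two columns, where the commutation is a finite computation (`blockF_comm`,
`pairSig_move`); the other cases follow by inverting the operators (`commuteAt_op`). Therefore x_j^*
maps the first crystal isomorphically, the words i of A and x_j^*A are equivalent, and P(i) does not
change; likewise x_i preserves P(l). In a component every path can be rearranged into steps x_i
followed by steps x_j^*. The first kind moves only P(i), the second only P(l), so π is injective by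
injectivity of P on each kind of path, and surjective because crystals of tableaux are connected. -/

namespace HookCrystal

/-! ### Signatures -/

/-- The three kinds of simple roots: between two barred letters, between the last barred and the
first unbarred letter, and between two unbarred letters. -/
inductive Kind
  | even
  | mixed
  | odd

/-- The kind of an index. -/
def kind {m n : ℕ} (i : Idx m n) : Kind :=
  if i.1 + 1 < m then .even else if i.1 + 1 = m then .mixed else .odd

/-- The pair `(ε, φ)` of a tensor product, from the pairs of the factors. -/
def sigMul : Kind → ℕ × ℕ → ℕ × ℕ → ℕ × ℕ
  | .even, a, b => (a.1 + (b.1 - a.2), b.2 + (a.2 - b.1))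
  | .mixed, a, b => if a.1 + a.2 = 0 then b else a
  | .odd, a, b => (b.1 + (a.1 - b.2), a.2 + (b.2 - a.1))

/-- `f` acts on the first factor. -/
def SigF : Kind → ℕ × ℕ → ℕ × ℕ → Prop
  | .even, a, b => b.1 < a.2
  | .mixed, a, _ => 0 < a.1 + a.2
  | .odd, a, b => b.2 ≤ a.1

/-- `e` acts on the first factor. -/
def SigE : Kind → ℕ × ℕ → ℕ × ℕ → Prop
  | .even, a, b => b.1 ≤ a.2
  | .mixed, a, _ => 0 < a.1 + a.2
  | .odd, a, b => b.2 < a.1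

instance (k : Kind) (a b : ℕ × ℕ) : Decidable (SigF k a b) := by
  cases k <;> unfold SigF <;> infer_instance

instance (k : Kind) (a b : ℕ × ℕ) : Decidable (SigE k a b) := by
  cases k <;> unfold SigE <;> infer_instance

/-- The change of `(ε, φ)` under `f`. -/
def SigShift (a b : ℕ × ℕ) : Prop := a.2 = b.2 + 1 ∧ b.1 = a.1 + 1

/-- For `even` and `odd` this is the bicyclic monoid, in which φ of one factor cancels against ε of
the other; for `mixed` the leftmost nonzero factor wins. -/
theorem sigMul_assoc (k : Kind) (a b c : ℕ × ℕ) :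
    sigMul k (sigMul k a b) c = sigMul k a (sigMul k b c) := by
  obtain ⟨a1, a2⟩ := a; obtain ⟨b1, b2⟩ := b; obtain ⟨c1, c2⟩ := c
  cases k
  · simp only [sigMul, Prod.mk.injEq]; omega
  · simp only [sigMul]; split_ifs <;> simp_all
  · simp only [sigMul, Prod.mk.injEq]; omega

@[simp] theorem sigMul_zero_left (k : Kind) (a : ℕ × ℕ) : sigMul k (0, 0) a = a := by
  cases k <;> simp [sigMul]

@[simp] theorem sigMul_zero_right (k : Kind) (a : ℕ × ℕ) : sigMul k a (0, 0) = a := by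
  obtain ⟨a1, a2⟩ := a
  cases k
  · simp [sigMul]
  · simp only [sigMul]; split_ifs with h
    · simp only [Prod.mk.injEq]; omega
    · rfl
  · simp [sigMul]

/-- Together with `sigF_mul_left_iff` and `not_sigF_of_not_mul_right` this shows that the factor of
a triple product on which f acts is the same for both bracketings. -/
theorem SigF.of_mul_right {k : Kind} {a b c : ℕ × ℕ} (h : SigF k a (sigMul k b c)) :
    SigF k (sigMul k a b) c ∧ SigF k a b := by
  cases k <;> simp only [SigF, sigMul] at h ⊢
  · omega
  · split_ifs <;> omega
  · omega

theorem sigF_mul_left_iff {k : Kind} {a b c : ℕ × ℕ} (h : ¬ SigF k a (sigMul k b c)) :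
    SigF k (sigMul k a b) c ↔ SigF k b c := by
  cases k <;> simp only [SigF, sigMul] at h ⊢
  · omega
  · split_ifs <;> omega
  · omega

theorem not_sigF_of_not_mul_right {k : Kind} {a b c : ℕ × ℕ} (h : ¬ SigF k a (sigMul k b c))
    (h' : SigF k b c) : ¬ SigF k a b := by
  cases k <;> simp only [SigF, sigMul] at h h' ⊢ <;> omega

theorem SigE.of_mul_right {k : Kind} {a b c : ℕ × ℕ} (h : SigE k a (sigMul k b c)) :
    SigE k (sigMul k a b) c ∧ SigE k a b := by
  cases k <;> simp only [SigE, sigMul] at h ⊢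
  · omega
  · split_ifs <;> omega
  · omega

theorem sigE_mul_left_iff {k : Kind} {a b c : ℕ × ℕ} (h : ¬ SigE k a (sigMul k b c)) :
    SigE k (sigMul k a b) c ↔ SigE k b c := by
  cases k <;> simp only [SigE, sigMul] at h ⊢
  · omega
  · split_ifs <;> omega
  · omega

theorem not_sigE_of_not_mul_right {k : Kind} {a b c : ℕ × ℕ} (h : ¬ SigE k a (sigMul k b c))
    (h' : SigE k b c) : ¬ SigE k a b := by
  cases k <;> simp only [SigE, sigMul] at h h' ⊢ <;> omega

theorem SigShift.mul_left {k : Kind} {a a' b : ℕ × ℕ} (h : SigF k a b) (hs : SigShift a a') :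
    SigShift (sigMul k a b) (sigMul k a' b) := by
  cases k <;> simp only [SigF, sigMul, SigShift] at h hs ⊢
  · omega
  · split_ifs <;> omega
  · omega

theorem SigShift.mul_right {k : Kind} {a b b' : ℕ × ℕ} (h : ¬ SigF k a b) (hs : SigShift b b') :
    SigShift (sigMul k a b) (sigMul k a b') := by
  cases k <;> simp only [SigF, sigMul, SigShift] at h hs ⊢
  · omega
  · split_ifs <;> omega
  · omega

theorem SigShift.sigF_iff_left {k : Kind} {a a' b : ℕ × ℕ} (hs : SigShift a a') :
    SigF k a b ↔ SigE k a' b := by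
  cases k <;> simp only [SigF, SigE, SigShift] at hs ⊢ <;> omega

theorem SigShift.sigF_iff_right {k : Kind} {a b b' : ℕ × ℕ} (hs : SigShift b b') :
    SigF k a b ↔ SigE k a b' := by
  cases k <;> simp only [SigF, SigE, SigShift] at hs ⊢ <;> omega

/-- The signature rule selects a factor with φ = 0 only if φ of the whole product is 0; so f is
nonzero exactly where φ is positive. -/
theorem sigMul_snd_eq_zero {k : Kind} {a b : ℕ × ℕ} :
    (sigMul k a b).2 = 0 ↔ if SigF k a b then a.2 = 0 else b.2 = 0 := by
  split_ifs with h <;> cases k <;> simp only [SigF, sigMul] at h ⊢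
  · omega
  · split_ifs <;> omega
  · omega
  · omega
  · split_ifs <;> omega
  · omega

theorem sigMul_fst_eq_zero {k : Kind} {a b : ℕ × ℕ} :
    (sigMul k a b).1 = 0 ↔ if SigE k a b then a.1 = 0 else b.1 = 0 := by
  split_ifs with h <;> cases k <;> simp only [SigE, sigMul] at h ⊢
  · omega
  · split_ifs <;> omega
  · omega
  · omega
  · split_ifs <;> omega
  · omega

/-! ### The crystal of words -/

variable {m n : ℕ}

theorem src_ne_tgt (i : Idx m n) : src i ≠ tgt i := by
  simp [src, tgt, Fin.ext_iff]

theorem coroot_eq (i : Idx m n) (z : Weight m n) :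
    coroot m n i z = if i.1 + 1 = m then z (src i) + z (tgt i) else z (src i) - z (tgt i) := by
  have hf : form m n (root m n i) z =
      (-1) ^ degree m n (src i) * z (src i) - (-1) ^ degree m n (tgt i) * z (tgt i) := by
    simp only [form, root, Pi.sub_apply, mul_sub, sub_mul, Finset.sum_sub_distrib,
      Pi.single_apply, mul_ite, ite_mul, mul_one, mul_zero, zero_mul, Finset.sum_ite_eq',
      Finset.mem_univ, if_true]
  unfold coroot
  rw [hf]
  have e1 : degree m n (src i) = if i.1 < m then 0 else 1 := rfl
  have e2 : degree m n (tgt i) = if i.1 + 1 < m then 0 else 1 := rfl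
  rw [e1, e2]
  generalize z (src i) = x
  generalize z (tgt i) = y
  rcases lt_trichotomy (i.1 + 1) m with h | h | h
  · rw [if_pos h.le, if_pos (by omega), if_pos h, if_neg h.ne]; ring
  · rw [if_pos h.le, if_pos (by omega), if_neg (by omega), if_pos h]; ring
  · rw [if_neg (by omega), if_neg (by omega), if_neg (by omega), if_neg h.ne']; ring

/-- The pair `(ε_i, φ_i)` of a letter. -/
def letterSig (i : Idx m n) (b : Letter m n) : ℕ × ℕ :=
  (if b = tgt i then 1 else 0, if b = src i then 1 else 0)

/-- The pair `(ε_i, φ_i)` of a word. -/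
def wordSig (i : Idx m n) (w : List (Letter m n)) : ℕ × ℕ := (wordEps m n i w, wordPhi m n i w)

@[simp] theorem wordSig_nil (i : Idx m n) : wordSig i [] = (0, 0) := rfl

@[simp] theorem wordSig_fst (i : Idx m n) (w : List (Letter m n)) :
    (wordSig i w).1 = wordEps m n i w := rfl

@[simp] theorem wordSig_snd (i : Idx m n) (w : List (Letter m n)) :
    (wordSig i w).2 = wordPhi m n i w := rfl

theorem coroot_letter (i : Idx m n) (b : Letter m n) :
    coroot m n i ((letterData m n).wt b) =
      if i.1 + 1 = m then ((letterSig i b).2 : ℤ) + (letterSig i b).1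
      else (letterSig i b).2 - (letterSig i b).1 := by
  rw [coroot_eq]
  simp only [letterData, letterSig, Pi.single_apply, eq_comm (b := b)]
  split_ifs <;> simp

theorem coroot_add (i : Idx m n) (y z : Weight m n) :
    coroot m n i (y + z) = coroot m n i y + coroot m n i z := by
  simp only [coroot_eq, Pi.add_apply]; split_ifs <;> ring

theorem letterSig_cases (i : Idx m n) (b : Letter m n) :
    letterSig i b = (0, 0) ∨ letterSig i b = (0, 1) ∨ letterSig i b = (1, 0) := by
  have := src_ne_tgt i
  unfold letterSig
  split_ifs <;> simp_all

/-- The weight axioms for words; they also let the numbers h in the tensor rule be replaced by φ -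
ε, which turns that rule into `sigMul`. -/
theorem wordSig_spec (i : Idx m n) (w : List (Letter m n)) :
    (i.1 + 1 ≠ m → (wordPhi m n i w : ℤ) - wordEps m n i w = coroot m n i (wordWt m n w)) ∧
    (i.1 + 1 = m → 0 ≤ coroot m n i (wordWt m n w) ∧ wordPhi m n i w + wordEps m n i w =
      if coroot m n i (wordWt m n w) = 0 then 0 else 1) := by
  induction w with
  | nil => simp [wordPhi, wordEps, wordWt, coroot_eq]
  | cons b w ih =>
    have h1 : (letterData m n).eps i b = (letterSig i b).1 := rfl
    have h2 : (letterData m n).phi i b = (letterSig i b).2 := rfl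
    simp only [wordWt, coroot_add, wordPhi, wordEps, h1, h2, tensorEps, tensorPhi, coroot_letter]
    generalize coroot m n i (wordWt m n w) = h at *
    generalize wordPhi m n i w = p at *
    generalize wordEps m n i w = e at *
    rcases lt_trichotomy (i.1 + 1) m with hi | hi | hi
    · have h3 := ih.1 hi.ne
      refine ⟨fun _ => ?_, fun h => absurd h hi.ne⟩
      rcases letterSig_cases i b with hb | hb | hb <;> rw [hb] <;>
        simp only [hi, hi.ne, if_true, if_false] <;> omega
    · have h3 := ih.2 hi
      refine ⟨fun h => absurd hi h, fun _ => ?_⟩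
      rcases letterSig_cases i b with hb | hb | hb <;> rw [hb] <;>
        simp [hi] <;> split_ifs at * <;> omega
    · have h3 := ih.1 hi.ne'
      refine ⟨fun _ => ?_, fun h => absurd h hi.ne'⟩
      rcases letterSig_cases i b with hb | hb | hb <;> rw [hb] <;>
        simp only [hi.not_gt, hi.ne', if_false] <;> omega

theorem wordSig_cons (i : Idx m n) (b : Letter m n) (w : List (Letter m n)) :
    wordSig i (b :: w) = sigMul (kind i) (letterSig i b) (wordSig i w) := by
  have h1 : (letterData m n).eps i b = (letterSig i b).1 := rfl
  have h2 : (letterData m n).phi i b = (letterSig i b).2 := rfl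
  have hs := wordSig_spec i w
  simp only [wordSig, wordPhi, wordEps, h1, h2, tensorEps, tensorPhi, coroot_letter, kind]
  generalize coroot m n i (wordWt m n w) = h at *
  generalize wordPhi m n i w = p at *
  generalize wordEps m n i w = e at *
  rcases lt_trichotomy (i.1 + 1) m with hi | hi | hi
  · have h3 := hs.1 hi.ne
    rcases letterSig_cases i b with hb | hb | hb <;> rw [hb] <;>
      simp only [hi, hi.ne, if_true, if_false, sigMul, Prod.mk.injEq] <;> omega
  · rcases letterSig_cases i b with hb | hb | hb <;> rw [hb] <;> simp [hi, sigMul]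
  · have h3 := hs.1 hi.ne'
    rcases letterSig_cases i b with hb | hb | hb <;> rw [hb] <;>
      simp only [hi.not_gt, hi.ne', if_false, sigMul, Prod.mk.injEq] <;> omega

theorem wordF_cons (i : Idx m n) (b : Letter m n) (w : List (Letter m n)) :
    wordF m n i (b :: w) = if SigF (kind i) (letterSig i b) (wordSig i w)
      then ((letterData m n).f i b).map (fun b' => b' :: w)
      else (wordF m n i w).map (fun w' => b :: w') := by
  have h1 : (letterData m n).eps i b = (letterSig i b).1 := rfl
  have h2 : (letterData m n).phi i b = (letterSig i b).2 := rfl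
  rw [wordF]
  refine if_congr ?_ rfl rfl
  rw [coroot_letter, h1, h2]
  unfold FActsLeft kind
  split_ifs <;> simp [SigF, wordSig] <;> omega

theorem wordE_cons (i : Idx m n) (b : Letter m n) (w : List (Letter m n)) :
    wordE m n i (b :: w) = if SigE (kind i) (letterSig i b) (wordSig i w)
      then ((letterData m n).e i b).map (fun b' => b' :: w)
      else (wordE m n i w).map (fun w' => b :: w') := by
  have h1 : (letterData m n).eps i b = (letterSig i b).1 := rfl
  have h2 : (letterData m n).phi i b = (letterSig i b).2 := rfl
  rw [wordE]
  refine if_congr ?_ rfl rfl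
  rw [coroot_letter, h1, h2]
  unfold EActsLeft kind
  split_ifs <;> simp [SigE, wordSig] <;> omega

theorem letterF_eq_none (i : Idx m n) (b : Letter m n) :
    (letterData m n).f i b = none ↔ (letterSig i b).2 = 0 := by
  simp [letterData, letterSig]

theorem letterE_eq_none (i : Idx m n) (b : Letter m n) :
    (letterData m n).e i b = none ↔ (letterSig i b).1 = 0 := by
  simp [letterData, letterSig]

theorem wordF_eq_none (i : Idx m n) (w : List (Letter m n)) :
    wordF m n i w = none ↔ wordPhi m n i w = 0 := by
  induction w with
  | nil => simp [wordF, wordPhi]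
  | cons b w ih =>
    rw [← wordSig_snd, wordSig_cons, sigMul_snd_eq_zero, wordF_cons]
    split_ifs
    · simp [letterF_eq_none]
    · simp [ih]

theorem wordE_eq_none (i : Idx m n) (w : List (Letter m n)) :
    wordE m n i w = none ↔ wordEps m n i w = 0 := by
  induction w with
  | nil => simp [wordE, wordEps]
  | cons b w ih =>
    rw [← wordSig_fst, wordSig_cons, sigMul_fst_eq_zero, wordE_cons]
    split_ifs
    · simp [letterE_eq_none]
    · simp [ih]

theorem letterF_shift {i : Idx m n} {b b' : Letter m n} (h : (letterData m n).f i b = some b') :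
    b = src i ∧ b' = tgt i ∧ SigShift (letterSig i b) (letterSig i b') := by
  have := src_ne_tgt i
  simp only [letterData, Option.ite_none_right_eq_some, Option.some.injEq] at h
  obtain ⟨rfl, rfl⟩ := h
  simp [SigShift, letterSig, this, this.symm]

theorem wordF_shift {i : Idx m n} {w w' : List (Letter m n)} (h : wordF m n i w = some w') :
    SigShift (wordSig i w) (wordSig i w') := by
  induction w generalizing w' with
  | nil => simp [wordF] at h
  | cons b w ih =>
    rw [wordF_cons] at h
    split_ifs at h with hc
    · obtain ⟨b', hb, rfl⟩ := Option.map_eq_some_iff.1 h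
      rw [wordSig_cons, wordSig_cons]
      exact SigShift.mul_left hc (letterF_shift hb).2.2
    · obtain ⟨w'', hw, rfl⟩ := Option.map_eq_some_iff.1 h
      rw [wordSig_cons, wordSig_cons]
      exact SigShift.mul_right hc (ih hw)

theorem letterF_iff_letterE (i : Idx m n) (b b' : Letter m n) :
    (letterData m n).f i b = some b' ↔ (letterData m n).e i b' = some b := by
  simp only [letterData, Option.ite_none_right_eq_some, Option.some.injEq]
  constructor <;> (rintro ⟨rfl, rfl⟩; simp)

/-- The thresholds in `SigF` and `SigE` differ by one, which is the shift that f makes in (ε, φ):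
after f has acted on a factor, e selects the same factor. -/
theorem wordE_of_wordF {i : Idx m n} {w w' : List (Letter m n)} (h : wordF m n i w = some w') :
    wordE m n i w' = some w := by
  induction w generalizing w' with
  | nil => simp [wordF] at h
  | cons b w ih =>
    rw [wordF_cons] at h
    split_ifs at h with hc
    · obtain ⟨b', hb, rfl⟩ := Option.map_eq_some_iff.1 h
      rw [wordE_cons, if_pos ((letterF_shift hb).2.2.sigF_iff_left.1 hc),
        (letterF_iff_letterE i b b').1 hb]
      rfl
    · obtain ⟨w'', hw, rfl⟩ := Option.map_eq_some_iff.1 h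
      rw [wordE_cons, if_neg (fun h' => hc ((wordF_shift hw).sigF_iff_right.2 h')), ih hw]
      rfl

theorem wordF_of_wordE_aux {i : Idx m n} {w w' : List (Letter m n)}
    (h : wordE m n i w' = some w) :
    wordF m n i w = some w' := by
  induction w' generalizing w with
  | nil => simp [wordE] at h
  | cons b w' ih =>
    rw [wordE_cons] at h
    split_ifs at h with hc
    · obtain ⟨b', hb, rfl⟩ := Option.map_eq_some_iff.1 h
      rw [← letterF_iff_letterE] at hb
      rw [wordF_cons, if_pos ((letterF_shift hb).2.2.sigF_iff_left.2 hc), hb]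
      rfl
    · obtain ⟨w'', hw, rfl⟩ := Option.map_eq_some_iff.1 h
      have hw' := ih hw
      rw [wordF_cons, if_neg (fun h' => hc ((wordF_shift hw').sigF_iff_right.1 h')), hw']
      rfl

theorem wordF_iff_wordE (i : Idx m n) (w w' : List (Letter m n)) :
    wordF m n i w = some w' ↔ wordE m n i w' = some w :=
  ⟨wordE_of_wordF, wordF_of_wordE_aux⟩

theorem wordSig_append (i : Idx m n) (u w : List (Letter m n)) :
    wordSig i (u ++ w) = sigMul (kind i) (wordSig i u) (wordSig i w) := by
  induction u with
  | nil => simp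
  | cons b u ih => rw [List.cons_append, wordSig_cons, wordSig_cons, ih, sigMul_assoc]

/-- Words are built by prepending letters, so the rule for a general splitting is the independence
of bracketing of the selected factor. -/
theorem wordF_append (i : Idx m n) (u w : List (Letter m n)) :
    wordF m n i (u ++ w) = if SigF (kind i) (wordSig i u) (wordSig i w)
      then (wordF m n i u).map (· ++ w) else (wordF m n i w).map (u ++ ·) := by
  induction u with
  | nil =>
    split_ifs with h
    -- The empty word is selected only when φ of `w` is 0, and then both sides are undefined.
    · have h0 := (sigMul_snd_eq_zero (k := kind i) (a := (0, 0)) (b := wordSig i w)).2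
        (by rw [if_pos (by simpa using h)])
      rw [sigMul_zero_left] at h0
      simpa [wordF] using (wordF_eq_none i w).2 h0
    · simp
  | cons b u ih =>
    rw [List.cons_append, wordF_cons, wordF_cons, wordSig_append, ih, wordSig_cons]
    by_cases h1 : SigF (kind i) (letterSig i b) (sigMul (kind i) (wordSig i u) (wordSig i w))
    · rw [if_pos h1, if_pos h1.of_mul_right.1, if_pos h1.of_mul_right.2, Option.map_map]
      rfl
    · rw [if_neg h1]
      have h2 := sigF_mul_left_iff h1
      by_cases h3 : SigF (kind i) (wordSig i u) (wordSig i w)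
      · rw [if_pos h3, if_pos (h2.2 h3), if_neg (not_sigF_of_not_mul_right h1 h3)]
        simp [Option.map_map, Function.comp_def]
      · rw [if_neg h3, if_neg (fun h => h3 (h2.1 h))]
        simp [Option.map_map, Function.comp_def]

theorem wordE_append (i : Idx m n) (u w : List (Letter m n)) :
    wordE m n i (u ++ w) = if SigE (kind i) (wordSig i u) (wordSig i w)
      then (wordE m n i u).map (· ++ w) else (wordE m n i w).map (u ++ ·) := by
  induction u with
  | nil =>
    split_ifs with h
    · have h0 := (sigMul_fst_eq_zero (k := kind i) (a := (0, 0)) (b := wordSig i w)).2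
        (by rw [if_pos (by simpa using h)])
      rw [sigMul_zero_left] at h0
      simpa [wordE] using (wordE_eq_none i w).2 h0
    · simp
  | cons b u ih =>
    rw [List.cons_append, wordE_cons, wordE_cons, wordSig_append, ih, wordSig_cons]
    by_cases h1 : SigE (kind i) (letterSig i b) (sigMul (kind i) (wordSig i u) (wordSig i w))
    · rw [if_pos h1, if_pos h1.of_mul_right.1, if_pos h1.of_mul_right.2, Option.map_map]
      rfl
    · rw [if_neg h1]
      have h2 := sigE_mul_left_iff h1
      by_cases h3 : SigE (kind i) (wordSig i u) (wordSig i w)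
      · rw [if_pos h3, if_pos (h2.2 h3), if_neg (not_sigE_of_not_mul_right h1 h3)]
        simp [Option.map_map, Function.comp_def]
      · rw [if_neg h3, if_neg (fun h => h3 (h2.1 h))]
        simp [Option.map_map, Function.comp_def]

theorem wordWt_apply (w : List (Letter m n)) (b : Letter m n) :
    wordWt m n w b = w.count b := by
  induction w with
  | nil => simp [wordWt]
  | cons c w ih =>
    simp only [wordWt, letterData, Pi.add_apply, ih, List.count_cons, Pi.single_apply, beq_iff_eq,
      eq_comm (a := b)]
    split_ifs <;> push_cast <;> ring

theorem wordF_wt {i : Idx m n} {w w' : List (Letter m n)} (h : wordF m n i w = some w') :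
    wordWt m n w' = wordWt m n w - root m n i := by
  induction w generalizing w' with
  | nil => simp [wordF] at h
  | cons b w ih =>
    rw [wordF_cons] at h
    split_ifs at h with hc
    · obtain ⟨b', hb, rfl⟩ := Option.map_eq_some_iff.1 h
      obtain ⟨rfl, rfl, -⟩ := letterF_shift hb
      simp only [wordWt, letterData, root]; ring
    · obtain ⟨w'', hw, rfl⟩ := Option.map_eq_some_iff.1 h
      simp only [wordWt, ih hw]; ring

theorem wordF_length {i : Idx m n} {w w' : List (Letter m n)} (h : wordF m n i w = some w') :
    w'.length = w.length := by
  induction w generalizing w' with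
  | nil => simp [wordF] at h
  | cons b w ih =>
    rw [wordF_cons] at h
    split_ifs at h with hc
    · obtain ⟨b', hb, rfl⟩ := Option.map_eq_some_iff.1 h
      simp
    · obtain ⟨w'', hw, rfl⟩ := Option.map_eq_some_iff.1 h
      simp [ih hw]

end HookCrystal

namespace HookCrystal
variable {m n : ℕ}

/-! ### Crystal equivalence of words -/

/-- One Kashiwara operator on words, `f_i` for `(true, i)` and `e_i` for `(false, i)`. -/
def wordOp (o : Bool × Idx m n) (w : List (Letter m n)) : Option (List (Letter m n)) :=
  if o.1 then wordF m n o.2 w else wordE m n o.2 w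

/-- A sequence of Kashiwara operators on words. -/
def wordOps : List (Bool × Idx m n) → List (Letter m n) → Option (List (Letter m n))
  | [], w => some w
  | o :: s, w => (wordOp o w).bind (wordOps s)

/-- The weight and all `ε_i`, `φ_i` of a word. -/
def wordInfo (w : List (Letter m n)) : Weight m n × (Idx m n → ℕ × ℕ) :=
  (wordWt m n w, fun i => wordSig i w)

/-- Two words lie at the same place of isomorphic crystals. -/
def CrystalEquiv (w w' : List (Letter m n)) : Prop :=
  ∀ s, (wordOps s w).map wordInfo = (wordOps s w').map wordInfo

namespace CrystalEquiv

theorem refl (w : List (Letter m n)) : CrystalEquiv w w := fun _ => rfl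

theorem symm {w w' : List (Letter m n)} (h : CrystalEquiv w w') : CrystalEquiv w' w :=
  fun s => (h s).symm

theorem trans {w w' w'' : List (Letter m n)} (h : CrystalEquiv w w') (h' : CrystalEquiv w' w'') :
    CrystalEquiv w w'' := fun s => (h s).trans (h' s)

theorem wt_eq {w w' : List (Letter m n)} (h : CrystalEquiv w w') : wordWt m n w = wordWt m n w' :=
  congrArg Prod.fst (Option.some.inj (h []))

theorem sig_eq {w w' : List (Letter m n)} (h : CrystalEquiv w w') (i : Idx m n) :
    wordSig i w = wordSig i w' :=
  congrFun (congrArg Prod.snd (Option.some.inj (h []))) i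

theorem exists_op {w w' w₁ : List (Letter m n)} (h : CrystalEquiv w w') {o : Bool × Idx m n}
    (ho : wordOp o w = some w₁) : ∃ w₁', wordOp o w' = some w₁' ∧ CrystalEquiv w₁ w₁' := by
  have h1 := h [o]
  simp only [wordOps, ho, Option.bind_some, Option.map_some] at h1
  cases h2 : wordOp o w' with
  | none => simp [h2] at h1
  | some w₁' =>
    refine ⟨w₁', rfl, fun s => ?_⟩
    have h3 := h (o :: s)
    simpa only [wordOps, ho, h2, Option.bind_some] using h3

theorem exists_ops {s : List (Bool × Idx m n)} {w w' w₁ : List (Letter m n)}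
    (h : CrystalEquiv w w') (ho : wordOps s w = some w₁) :
    ∃ w₁', wordOps s w' = some w₁' ∧ CrystalEquiv w₁ w₁' := by
  induction s generalizing w w' with
  | nil =>
    obtain rfl : w = w₁ := Option.some.inj ho
    exact ⟨w', rfl, h⟩
  | cons o s ih =>
    simp only [wordOps, Option.bind_eq_some_iff] at ho ⊢
    obtain ⟨w₂, h2, h3⟩ := ho
    obtain ⟨w₂', h4, h5⟩ := h.exists_op h2
    obtain ⟨w₁', h6, h7⟩ := ih h5 h3
    exact ⟨w₁', ⟨w₂', h4, h6⟩, h7⟩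

/-- A relation compatible with weights, `ε_i`, `φ_i` and all operators implies equivalence. -/
theorem of_rel {R : List (Letter m n) → List (Letter m n) → Prop}
    (hwt : ∀ w w', R w w' → wordWt m n w = wordWt m n w')
    (hsig : ∀ w w', R w w' → ∀ i, wordSig i w = wordSig i w')
    (hop : ∀ w w', R w w' → ∀ o w₁, wordOp o w = some w₁ →
      ∃ w₁', wordOp o w' = some w₁' ∧ R w₁ w₁')
    {w w' : List (Letter m n)} (h : R w w') : CrystalEquiv w w' := by
  intro s
  induction s generalizing w w' with
  | nil => simp only [wordOps, Option.map_some, wordInfo, hwt _ _ h, hsig _ _ h]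
  | cons o s ih =>
    simp only [wordOps]
    cases h1 : wordOp o w with
    | none =>
      have h2 : wordOp o w' = none := by
        obtain ⟨b, i⟩ := o
        have := hsig _ _ h i
        cases b <;> simp only [wordOp, if_true, Bool.false_eq_true, if_false] at h1 ⊢
        · rw [wordE_eq_none, ← wordSig_fst] at h1 ⊢
          rw [← this, h1]
        · rw [wordF_eq_none, ← wordSig_snd] at h1 ⊢
          rw [← this, h1]
      rw [h2]
    | some w₁ =>
      obtain ⟨w₁', h2, h3⟩ := hop _ _ h _ _ h1
      rw [h2]
      exact ih h3

/-- The selection of a factor depends only on the signatures, so pairs with a common prefix and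
equivalent ends form a bisimulation. With `append_right`, equivalence is a congruence for
concatenation. -/
theorem append_left {w w' : List (Letter m n)} (h : CrystalEquiv w w') (u : List (Letter m n)) :
    CrystalEquiv (u ++ w) (u ++ w') := by
  refine of_rel (R := fun a b => ∃ u w w', CrystalEquiv w w' ∧ a = u ++ w ∧ b = u ++ w')
    ?_ ?_ ?_ ⟨u, w, w', h, rfl, rfl⟩
  · rintro _ _ ⟨u, w, w', h, rfl, rfl⟩
    ext b
    have := congrFun h.wt_eq b
    simp only [wordWt_apply, List.count_append] at this ⊢
    omega
  · rintro _ _ ⟨u, w, w', h, rfl, rfl⟩ i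
    rw [wordSig_append, wordSig_append, h.sig_eq]
  · rintro _ _ ⟨u, w, w', h, rfl, rfl⟩ ⟨b, i⟩ w₁ hw
    have hx := fun w₂ => h.exists_op (o := (b, i)) (w₁ := w₂)
    cases b <;> simp only [wordOp, if_true, Bool.false_eq_true, if_false] at hw hx ⊢
    all_goals
      first | rw [wordE_append, h.sig_eq] at hw | rw [wordF_append, h.sig_eq] at hw
      first | rw [wordE_append] | rw [wordF_append]
      split_ifs at hw ⊢
      · obtain ⟨u', hu, rfl⟩ := Option.map_eq_some_iff.1 hw
        rw [hu]
        exact ⟨_, rfl, u', w, w', h, rfl, rfl⟩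
      · obtain ⟨w₂, hu, rfl⟩ := Option.map_eq_some_iff.1 hw
        obtain ⟨w₂', h1, h2⟩ := hx _ hu
        rw [h1]
        exact ⟨_, rfl, u, w₂, w₂', h2, rfl, rfl⟩

theorem append_right {w w' : List (Letter m n)} (h : CrystalEquiv w w') (u : List (Letter m n)) :
    CrystalEquiv (w ++ u) (w' ++ u) := by
  refine of_rel (R := fun a b => ∃ u w w', CrystalEquiv w w' ∧ a = w ++ u ∧ b = w' ++ u)
    ?_ ?_ ?_ ⟨u, w, w', h, rfl, rfl⟩
  · rintro _ _ ⟨u, w, w', h, rfl, rfl⟩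
    ext b
    have := congrFun h.wt_eq b
    simp only [wordWt_apply, List.count_append] at this ⊢
    omega
  · rintro _ _ ⟨u, w, w', h, rfl, rfl⟩ i
    rw [wordSig_append, wordSig_append, h.sig_eq]
  · rintro _ _ ⟨u, w, w', h, rfl, rfl⟩ ⟨b, i⟩ w₁ hw
    have hx := fun w₂ => h.exists_op (o := (b, i)) (w₁ := w₂)
    cases b <;> simp only [wordOp, if_true, Bool.false_eq_true, if_false] at hw hx ⊢
    all_goals
      first | rw [wordE_append, h.sig_eq] at hw | rw [wordF_append, h.sig_eq] at hw
      first | rw [wordE_append] | rw [wordF_append]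
      split_ifs at hw ⊢
      · obtain ⟨w₂, hu, rfl⟩ := Option.map_eq_some_iff.1 hw
        obtain ⟨w₂', h1, h2⟩ := hx _ hu
        rw [h1]
        exact ⟨_, rfl, u, w₂, w₂', h2, rfl, rfl⟩
      · obtain ⟨u', hu, rfl⟩ := Option.map_eq_some_iff.1 hw
        rw [hu]
        exact ⟨_, rfl, u', w, w', h, rfl, rfl⟩

end CrystalEquiv

/-! ### Plactic relations -/

theorem bumps_iff (b c : Letter m n) : Bumps m n b c ↔ b.1 < c.1 ∨ (b.1 = c.1 ∧ b.1 < m) := by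
  unfold Bumps degree
  by_cases h : b.1 < m <;> simp only [h, if_true, if_false, Fin.le_def, Fin.lt_def] <;> simp <;> omega

/-- The elementary plactic relations, in both directions. -/
def KnuthRel : List (Letter m n) → List (Letter m n) → Prop
  | [a, b, c], [a', b', c'] =>
    (a.1 = a'.1 ∧ b.1 = c'.1 ∧ c.1 = b'.1 ∧
      ((Bumps m n c a ∧ ¬ Bumps m n b a) ∨ (Bumps m n b a ∧ ¬ Bumps m n c a))) ∨
    (a.1 = b'.1 ∧ b.1 = a'.1 ∧ c.1 = c'.1 ∧
      ((¬ Bumps m n c a ∧ Bumps m n c b) ∨ (¬ Bumps m n c b ∧ Bumps m n c a)))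
  | _, _ => False

theorem letter_cases (i : Idx m n) (a : Letter m n) :
    (a = src i ∧ letterSig i a = (0, 1) ∧ (letterData m n).f i a = some (tgt i) ∧
      (letterData m n).e i a = none) ∨
    (a = tgt i ∧ letterSig i a = (1, 0) ∧ (letterData m n).f i a = none ∧
      (letterData m n).e i a = some (src i)) ∨
    (a.1 ≠ i.1 ∧ a.1 ≠ i.1 + 1 ∧ letterSig i a = (0, 0) ∧ (letterData m n).f i a = none ∧
      (letterData m n).e i a = none) := by
  have h := src_ne_tgt i
  by_cases h1 : a = src i
  · subst h1; simp [letterSig, letterData, h]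
  by_cases h2 : a = tgt i
  · subst h2; simp [letterSig, letterData, h.symm]
  · refine Or.inr (Or.inr ⟨fun h => h1 (Fin.ext h), fun h => h2 (Fin.ext h), ?_⟩)
    simp [letterSig, letterData, h1, h2]

theorem kind_cases (i : Idx m n) : (kind i = .even ∧ i.1 + 1 < m) ∨ (kind i = .mixed ∧ i.1 + 1 = m)
    ∨ (kind i = .odd ∧ m < i.1 + 1) := by
  unfold kind
  split_ifs <;> simp <;> omega

theorem wordF_three (i : Idx m n) (a b c : Letter m n) :
    wordF m n i [a, b, c] =
      if SigF (kind i) (letterSig i a) (sigMul (kind i) (letterSig i b) (letterSig i c))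
      then ((letterData m n).f i a).map (fun a => [a, b, c])
      else if SigF (kind i) (letterSig i b) (letterSig i c)
      then ((letterData m n).f i b).map (fun b => [a, b, c])
      else ((letterData m n).f i c).map (fun c => [a, b, c]) := by
  rw [wordF_cons, wordF_cons, wordF_cons, wordSig_cons, wordSig_cons, wordSig_nil,
    sigMul_zero_right]
  rcases letter_cases i c with ⟨-, h1, h2, -⟩ | ⟨-, h1, h2, -⟩ | ⟨-, -, h1, h2, -⟩ <;> rw [h1, h2] <;>
  rcases kind_cases i with ⟨hk, -⟩ | ⟨hk, -⟩ | ⟨hk, -⟩ <;> rw [hk] <;>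
  split_ifs <;> simp_all [SigF, wordF, Function.comp_def]

theorem wordE_three (i : Idx m n) (a b c : Letter m n) :
    wordE m n i [a, b, c] =
      if SigE (kind i) (letterSig i a) (sigMul (kind i) (letterSig i b) (letterSig i c))
      then ((letterData m n).e i a).map (fun a => [a, b, c])
      else if SigE (kind i) (letterSig i b) (letterSig i c)
      then ((letterData m n).e i b).map (fun b => [a, b, c])
      else ((letterData m n).e i c).map (fun c => [a, b, c]) := by
  rw [wordE_cons, wordE_cons, wordE_cons, wordSig_cons, wordSig_cons, wordSig_nil,
    sigMul_zero_right]
  rcases letter_cases i c with ⟨-, h1, -, h2⟩ | ⟨-, h1, -, h2⟩ | ⟨-, -, h1, -, h2⟩ <;> rw [h1, h2] <;>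
  rcases kind_cases i with ⟨hk, -⟩ | ⟨hk, -⟩ | ⟨hk, -⟩ <;> rw [hk] <;>
  split_ifs <;> simp_all [SigE, wordE, Function.comp_def]

theorem wordSig_three (i : Idx m n) (a b c : Letter m n) :
    wordSig i [a, b, c] =
      sigMul (kind i) (letterSig i a) (sigMul (kind i) (letterSig i b) (letterSig i c)) := by
  rw [wordSig_cons, wordSig_cons, wordSig_cons, wordSig_nil, sigMul_zero_right]

/-- Only the position of each letter relative to `src i` and `tgt i` matters; every case is an
identity of signatures or contradicts the order of the three letters. -/
theorem KnuthRel.sig_eq {w w' : List (Letter m n)} (h : KnuthRel w w') (i : Idx m n) :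
    wordSig i w = wordSig i w' := by
  unfold KnuthRel at h
  split at h
  · rename_i a b c a' b' c'
    simp only [bumps_iff] at h
    rcases h with ⟨h1, h2, h3, h4⟩ | ⟨h1, h2, h3, h4⟩
    all_goals
      obtain rfl := Fin.ext h1
      obtain rfl := Fin.ext h2
      obtain rfl := Fin.ext h3
      rw [wordSig_three, wordSig_three]
      have hs : (src i).1 = i.1 := rfl
      have ht : (tgt i).1 = i.1 + 1 := rfl
      rcases letter_cases i a with ⟨ha, ka, -⟩ | ⟨ha, ka, -⟩ | ⟨ha, ha', ka, -⟩ <;>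
      rcases letter_cases i b with ⟨hb, kb, -⟩ | ⟨hb, kb, -⟩ | ⟨hb, hb', kb, -⟩ <;>
      rcases letter_cases i c with ⟨hc, kc, -⟩ | ⟨hc, kc, -⟩ | ⟨hc, hc', kc, -⟩ <;>
      rw [ka, kb, kc] <;>
      rcases kind_cases i with ⟨hk, hi⟩ | ⟨hk, hi⟩ | ⟨hk, hi⟩ <;> rw [hk] <;>
      first
        | rfl
        | (exfalso; simp only [Fin.ext_iff] at ha hb hc; omega)
  · exact h.elim

-- The operator may exchange the two types of relation. For barred neighbours 1, 2 it turns 121,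
-- 112, which differ in the last two places, into 122, 212, which differ in the first two; hence
-- both types belong to one relation.
set_option maxHeartbeats 4000000 in
theorem KnuthRel.exists_wordF {w w' w₁ : List (Letter m n)} (h : KnuthRel w w') {i : Idx m n}
    (hw : wordF m n i w = some w₁) : ∃ w₁', wordF m n i w' = some w₁' ∧ KnuthRel w₁ w₁' := by
  unfold KnuthRel at h
  split at h
  · rename_i a b c a' b' c'
    simp only [bumps_iff] at h
    rcases h with ⟨h1, h2, h3, h4⟩ | ⟨h1, h2, h3, h4⟩
    all_goals
      obtain rfl := Fin.ext h1
      obtain rfl := Fin.ext h2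
      obtain rfl := Fin.ext h3
      rw [wordF_three] at hw ⊢
      have hs : (src i).1 = i.1 := rfl
      have ht : (tgt i).1 = i.1 + 1 := rfl
      rcases letter_cases i a with ⟨ha, ka, la, -⟩ | ⟨ha, ka, la, -⟩ | ⟨ha, ha', ka, la, -⟩ <;>
      rcases letter_cases i b with ⟨hb, kb, lb, -⟩ | ⟨hb, kb, lb, -⟩ | ⟨hb, hb', kb, lb, -⟩ <;>
      rcases letter_cases i c with ⟨hc, kc, lc, -⟩ | ⟨hc, kc, lc, -⟩ | ⟨hc, hc', kc, lc, -⟩ <;>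
      rw [ka, kb, kc, la, lb, lc] at hw ⊢ <;>
      rcases kind_cases i with ⟨hk, hi⟩ | ⟨hk, hi⟩ | ⟨hk, hi⟩ <;> rw [hk] at hw ⊢ <;>
      first
        | (exfalso; simp only [Fin.ext_iff] at ha hb hc; omega)
        | (simp [SigF, sigMul] at hw; done)
        | (simp [SigF, sigMul] at hw ⊢
           subst hw
           simp only [Fin.ext_iff] at ha hb hc
           simp only [KnuthRel, bumps_iff, true_and]
           omega)
  · exact h.elim

end HookCrystal

namespace HookCrystal
variable {m n : ℕ}

set_option maxHeartbeats 4000000 in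
theorem KnuthRel.exists_wordE {w w' w₁ : List (Letter m n)} (h : KnuthRel w w') {i : Idx m n}
    (hw : wordE m n i w = some w₁) : ∃ w₁', wordE m n i w' = some w₁' ∧ KnuthRel w₁ w₁' := by
  unfold KnuthRel at h
  split at h
  · rename_i a b c a' b' c'
    simp only [bumps_iff] at h
    rcases h with ⟨h1, h2, h3, h4⟩ | ⟨h1, h2, h3, h4⟩
    all_goals
      obtain rfl := Fin.ext h1
      obtain rfl := Fin.ext h2
      obtain rfl := Fin.ext h3
      rw [wordE_three] at hw ⊢
      have hs : (src i).1 = i.1 := rfl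
      have ht : (tgt i).1 = i.1 + 1 := rfl
      rcases letter_cases i a with ⟨ha, ka, -, la⟩ | ⟨ha, ka, -, la⟩ | ⟨ha, ha', ka, -, la⟩ <;>
      rcases letter_cases i b with ⟨hb, kb, -, lb⟩ | ⟨hb, kb, -, lb⟩ | ⟨hb, hb', kb, -, lb⟩ <;>
      rcases letter_cases i c with ⟨hc, kc, -, lc⟩ | ⟨hc, kc, -, lc⟩ | ⟨hc, hc', kc, -, lc⟩ <;>
      rw [ka, kb, kc, la, lb, lc] at hw ⊢ <;>
      rcases kind_cases i with ⟨hk, hi⟩ | ⟨hk, hi⟩ | ⟨hk, hi⟩ <;> rw [hk] at hw ⊢ <;>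
      first
        | (exfalso; simp only [Fin.ext_iff] at ha hb hc; omega)
        | (simp [SigE, sigMul] at hw; done)
        | (simp [SigE, sigMul] at hw ⊢
           subst hw
           simp only [Fin.ext_iff] at ha hb hc
           simp only [KnuthRel, bumps_iff, true_and]
           omega)
  · exact h.elim

theorem KnuthRel.crystalEquiv {w w' : List (Letter m n)} (h : KnuthRel w w') :
    CrystalEquiv w w' := by
  refine CrystalEquiv.of_rel ?_ (fun w w' h i => h.sig_eq i) ?_ h
  · intro w w' h
    have hp : w.Perm w' := by
      unfold KnuthRel at h
      split at h
      · rcases h with ⟨h1, h2, h3, -⟩ | ⟨h1, h2, h3, -⟩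
        · rw [Fin.ext h1, Fin.ext h2, Fin.ext h3]
          exact (List.Perm.swap _ _ _).cons _
        · rw [Fin.ext h1, Fin.ext h2, Fin.ext h3]
          exact List.Perm.swap _ _ _
      · exact h.elim
    ext b
    rw [wordWt_apply, wordWt_apply, hp.count_eq]
  · rintro w w' h ⟨b, i⟩ w₁ hw
    cases b
    · exact h.exists_wordE hw
    · exact h.exists_wordF hw

/-! ### Column bumping and equivalence -/

/-- Columns of semistandard tableaux. -/
def IsCol (C : List (Letter m n)) : Prop := C.Pairwise fun a b => ¬ Bumps m n b a

/-- A letter that bumps the top of a column bumps every entry below it, so it climbs from the bottom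
to just below the top by Knuth moves d y b ~ d b y. -/
theorem crystalEquiv_move (b d : Letter m n) (C : List (Letter m n)) (hC : IsCol (d :: C))
    (hb : Bumps m n b d) : CrystalEquiv (d :: (C ++ [b])) (d :: b :: C) := by
  induction C generalizing d with
  | nil => exact CrystalEquiv.refl _
  | cons y C ih =>
    obtain ⟨h1, h2⟩ := List.pairwise_cons.1 hC
    have hy : ¬ Bumps m n y d := h1 y (by simp)
    have hby : Bumps m n b y := by
      rw [bumps_iff] at hb hy ⊢; omega
    have h3 := (ih y h2 hby).append_left [d]
    have h4 : KnuthRel [d, y, b] [d, b, y] := by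
      simp [KnuthRel, hb, hy]
    exact h3.trans (h4.crystalEquiv.append_right C)

/-- The order relations between the bumped letter and the top of the new column, which are needed to
move the bumped letter past an entry above them. -/
theorem bumpColumn_head {b c : Letter m n} {C C' : List (Letter m n)}
    (h : bumpColumn m n b C = (C', some c)) :
    Bumps m n b c ∧ c ∈ C ∧ ∃ x t, C' = x :: t ∧ Bumps m n x c ∧ (x = b ∨ x ∈ C) := by
  induction C generalizing C' with
  | nil => simp [bumpColumn] at h
  | cons d C ih =>
    rw [bumpColumn] at h
    split_ifs at h with hb
    · obtain ⟨rfl, h2⟩ := Prod.mk.inj h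
      obtain rfl := Option.some.inj h2
      exact ⟨hb, by simp, b, C, rfl, hb, Or.inl rfl⟩
    · obtain ⟨rfl, h2⟩ := Prod.mk.inj h
      obtain ⟨h3, h4, -⟩ := ih (C' := (bumpColumn m n b C).1) (by rw [← h2])
      refine ⟨h3, by simp [h4], d, _, rfl, ?_, by simp⟩
      rw [bumps_iff] at hb h3 ⊢; omega

theorem bumpColumn_none {b : Letter m n} {C C' : List (Letter m n)}
    (h : bumpColumn m n b C = (C', none)) : C' = C ++ [b] ∧ ∀ d ∈ C, ¬ Bumps m n b d := by
  induction C generalizing C' with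
  | nil => simp [bumpColumn] at h; simp [h]
  | cons d C ih =>
    rw [bumpColumn] at h
    split_ifs at h with hb
    · simp at h
    · obtain ⟨rfl, h2⟩ := Prod.mk.inj h
      obtain ⟨h3, h4⟩ := ih (C' := (bumpColumn m n b C).1) (by rw [← h2])
      rw [h3]
      simp [hb]
      exact h4

/-- In the column reading the next column stands to the left, so the bumped letter has to emerge at
the left end of the column word, ready to be inserted there. -/
theorem crystalEquiv_bumpColumn {b c : Letter m n} {C C' : List (Letter m n)} (hC : IsCol C)
    (h : bumpColumn m n b C = (C', some c)) : CrystalEquiv (C ++ [b]) (c :: C') := by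
  induction C generalizing C' with
  | nil => simp [bumpColumn] at h
  | cons d C ih =>
    have hC' := List.pairwise_cons.1 hC
    rw [bumpColumn] at h
    split_ifs at h with hb
    · obtain ⟨rfl, h2⟩ := Prod.mk.inj h
      obtain rfl := Option.some.inj h2
      exact crystalEquiv_move b d C hC hb
    · obtain ⟨rfl, h2⟩ := Prod.mk.inj h
      have h3 : bumpColumn m n b C = ((bumpColumn m n b C).1, some c) := by rw [← h2]
      obtain ⟨-, -, x, t, h4, h5, h6⟩ := bumpColumn_head h3
      have h7 := (ih hC'.2 h3).append_left [d]
      rw [h4] at h7 ⊢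
      have hx : ¬ Bumps m n x d := by
        rcases h6 with rfl | h6
        · exact hb
        · exact hC'.1 x h6
      -- The new top `x` of the lower part lies between `d` and `c`, so it witnesses the exchange of
      -- `d` and `c`.
      have h8 : KnuthRel [d, c, x] [c, d, x] := by
        simp [KnuthRel, h5, hx]
      exact h7.trans (h8.crystalEquiv.append_right t)

theorem crystalEquiv_insertLetter (T : Filling m n) (b : Letter m n) (hT : ∀ C ∈ T, IsCol C) :
    CrystalEquiv (T.reading ++ [b]) (insertLetter m n T b).reading := by
  induction T generalizing b with
  | nil => exact CrystalEquiv.refl _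
  | cons C T ih =>
    have hr : ∀ (C : List (Letter m n)) (T : Filling m n),
        Filling.reading (C :: T) = T.reading ++ C := by
      intro C T; simp [Filling.reading]
    rw [insertLetter]
    split
    · rename_i C' h
      rw [hr, hr, (bumpColumn_none h).1, List.append_assoc]
      exact CrystalEquiv.refl _
    · rename_i C' c h
      rw [hr, hr, List.append_assoc]
      have h1 := (crystalEquiv_bumpColumn (hT C (by simp)) h).append_left (Filling.reading T)
      have h2 := (ih c (fun D hD => hT D (by simp [hD]))).append_right C'
      rw [List.append_assoc] at h2
      exact h1.trans h2

/-! ### Semistandard tableaux as lists of columns -/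

/-- The column `C` may stand immediately to the left of the column `D`. -/
def Fits : List (Letter m n) → List (Letter m n) → Prop
  | _, [] => True
  | [], _ :: _ => False
  | c :: C, d :: D => Bumps m n c d ∧ Fits C D

/-- Lists of non-empty columns that form a semistandard tableau. -/
structure IsTableau (T : Filling m n) : Prop where
  col : ∀ C ∈ T, IsCol C
  ne_nil : ∀ C ∈ T, C ≠ []
  fits : T.IsChain Fits

theorem IsCol.bumpColumn {b : Letter m n} {C : List (Letter m n)} (hC : IsCol C) :
    IsCol (bumpColumn m n b C).1 := by
  have aux : ∀ (C : List (Letter m n)) x, x ∈ (HookCrystal.bumpColumn m n b C).1 → x = b ∨ x ∈ C := by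
    intro C
    induction C with
    | nil => intro x hx; simpa [HookCrystal.bumpColumn] using hx
    | cons d C ih =>
      intro x hx
      rw [HookCrystal.bumpColumn] at hx
      split_ifs at hx with h
      · simp at hx ⊢; tauto
      · simp at hx ⊢
        rcases hx with rfl | hx
        · simp
        · rcases ih x hx with h | h <;> simp [h]
  induction C with
  | nil => simp [HookCrystal.bumpColumn, IsCol]
  | cons d C ih =>
    obtain ⟨h1, h2⟩ := List.pairwise_cons.1 hC
    rw [HookCrystal.bumpColumn]
    split_ifs with h
    · refine List.pairwise_cons.2 ⟨fun y hy => ?_, h2⟩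
      have := h1 y hy
      rw [bumps_iff] at h this ⊢; omega
    · refine List.pairwise_cons.2 ⟨fun y hy => ?_, ih h2⟩
      rcases aux C y hy with rfl | hy
      · exact h
      · exact h1 y hy

theorem bumpColumn_ne_nil (b : Letter m n) (C : List (Letter m n)) : (bumpColumn m n b C).1 ≠ [] := by
  cases C with
  | nil => simp [bumpColumn]
  | cons d C => rw [bumpColumn]; split_ifs <;> simp

theorem Fits.bump_left {b c : Letter m n} {C C' D : List (Letter m n)} (hf : Fits C D)
    (h : bumpColumn m n b C = (C', some c)) : Fits C' D := by
  induction C generalizing C' D with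
  | nil => simp [bumpColumn] at h
  | cons d C ih =>
    cases D with
    | nil => cases C' <;> trivial
    | cons e D =>
      rw [bumpColumn] at h
      split_ifs at h with hb
      · obtain ⟨rfl, h2⟩ := Prod.mk.inj h
        refine ⟨?_, hf.2⟩
        have := hf.1
        rw [bumps_iff] at this hb ⊢; omega
      · obtain ⟨rfl, h2⟩ := Prod.mk.inj h
        exact ⟨hf.1, ih hf.2 (by rw [← h2])⟩

theorem Fits.append_left {C D : List (Letter m n)} (hf : Fits C D) (w : List (Letter m n)) :
    Fits (C ++ w) D := by
  induction C generalizing D with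
  | nil => cases D with
    | nil => cases w <;> trivial
    | cons => exact hf.elim
  | cons c C ih => cases D with
    | nil => trivial
    | cons d D => exact ⟨hf.1, ih hf.2⟩

/-- The bumped letter c stood beside an entry of `D` that it bumps, or below the end of `D`; hence
it enters the next column no lower than the row it left, where its left neighbour is small enough.
-/
theorem Fits.bump {b c : Letter m n} {C C' D : List (Letter m n)} (hf : Fits C D)
    (h : bumpColumn m n b C = (C', some c)) : Fits C' (bumpColumn m n c D).1 := by
  induction C generalizing C' D with
  | nil => simp [bumpColumn] at h
  | cons d C ih =>
    rw [bumpColumn] at h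
    split_ifs at h with hb
    · obtain ⟨rfl, h2⟩ := Prod.mk.inj h
      obtain rfl := Option.some.inj h2
      cases D with
      | nil => exact ⟨hb, by cases C <;> trivial⟩
      | cons e D =>
        rw [bumpColumn, if_pos hf.1]
        exact ⟨hb, hf.2⟩
    · obtain ⟨rfl, h2⟩ := Prod.mk.inj h
      have h3 : bumpColumn m n b C = ((bumpColumn m n b C).1, some c) := by rw [← h2]
      have hdc : Bumps m n d c := by
        have := (bumpColumn_head h3).1
        rw [bumps_iff] at this hb ⊢; omega
      cases D with
      | nil => exact ⟨hdc, by cases (bumpColumn m n b C).1 <;> trivial⟩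
      | cons e D =>
        rw [bumpColumn]
        split_ifs with he
        · exact ⟨hdc, hf.2.bump_left h3⟩
        · exact ⟨hf.1, ih hf.2 h3⟩

theorem IsTableau.nil : IsTableau ([] : Filling m n) := ⟨by simp, by simp, by simp⟩

theorem IsTableau.of_cons {C : List (Letter m n)} {T : Filling m n} (h : IsTableau (C :: T)) :
    IsTableau T :=
  ⟨fun D hD => h.col D (by simp [hD]), fun D hD => h.ne_nil D (by simp [hD]), h.fits.tail⟩

theorem insertLetter_head (T : Filling m n) (b : Letter m n) :
    ∃ T', insertLetter m n T b = (bumpColumn m n b (T.headD [])).1 :: T' := by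
  cases T with
  | nil => exact ⟨[], rfl⟩
  | cons C T =>
    rw [insertLetter]
    split <;> (rename_i h; simp [h])

theorem IsTableau.insertLetter {T : Filling m n} (hT : IsTableau T) (b : Letter m n) :
    IsTableau (insertLetter m n T b) := by
  induction T generalizing b with
  | nil =>
    refine ⟨?_, ?_, ?_⟩ <;> simp [HookCrystal.insertLetter, IsCol]
  | cons C T ih =>
    have hC : IsCol C := hT.col C (by simp)
    have hC1 := hC.bumpColumn (b := b)
    have hC2 := bumpColumn_ne_nil b C
    rw [HookCrystal.insertLetter]
    split
    · rename_i C' h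
      rw [h] at hC1 hC2
      refine ⟨?_, ?_, ?_⟩
      · rintro D hD
        rcases List.mem_cons.1 hD with rfl | hD
        · exact hC1
        · exact hT.col D (by simp [hD])
      · rintro D hD
        rcases List.mem_cons.1 hD with rfl | hD
        · exact hC2
        · exact hT.ne_nil D (by simp [hD])
      · rw [(bumpColumn_none h).1]
        cases T with
        | nil => simp
        | cons D T =>
          have := hT.fits
          rw [List.isChain_cons_cons] at this ⊢
          exact ⟨this.1.append_left _, this.2⟩
    · rename_i C' c h
      rw [h] at hC1 hC2
      have hI := ih hT.of_cons c
      refine ⟨?_, ?_, ?_⟩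
      · rintro D hD
        rcases List.mem_cons.1 hD with rfl | hD
        · exact hC1
        · exact hI.col D hD
      · rintro D hD
        rcases List.mem_cons.1 hD with rfl | hD
        · exact hC2
        · exact hI.ne_nil D hD
      · obtain ⟨T', hT'⟩ := insertLetter_head T c
        have hI' := hI.fits
        rw [hT'] at hI' ⊢
        rw [List.isChain_cons_cons]
        refine ⟨?_, hI'⟩
        cases T with
        | nil => exact Fits.bump (D := []) (by cases C <;> trivial) h
        | cons D T => exact Fits.bump (List.isChain_cons_cons.1 hT.fits).1 h

theorem isTableau_insertionTableau (w : List (Letter m n)) : IsTableau (insertionTableau m n w) := by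
  induction w using List.reverseRecOn with
  | nil => exact IsTableau.nil
  | append_singleton w b ih =>
    rw [insertionTableau, List.foldl_append]
    exact ih.insertLetter b

theorem crystalEquiv_insertionTableau (w : List (Letter m n)) :
    CrystalEquiv w (insertionTableau m n w).reading := by
  induction w using List.reverseRecOn with
  | nil => exact CrystalEquiv.refl _
  | append_singleton w b ih =>
    refine (ih.append_right [b]).trans ?_
    have := crystalEquiv_insertLetter (insertionTableau m n w) b
      (isTableau_insertionTableau w).col
    simpa [insertionTableau] using this

/-! ### Insertion is reversible -/

theorem bumpColumn_length (b : Letter m n) (C : List (Letter m n)) :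
    (bumpColumn m n b C).1.length = C.length + if (bumpColumn m n b C).2 = none then 1 else 0 := by
  induction C with
  | nil => simp [bumpColumn]
  | cons d C ih =>
    rw [bumpColumn]
    split_ifs at * <;> simp_all

/-- The row of the bump can be recovered from the result: two different rows would put the inserted
letter of one bump below `c` in a column, although that letter bumps `c`. -/
theorem bumpColumn_injective {b b' c : Letter m n} {C C' D : List (Letter m n)} (hC : IsCol C)
    (hC' : IsCol C') (h : bumpColumn m n b C = (D, some c))
    (h' : bumpColumn m n b' C' = (D, some c)) : C = C' ∧ b = b' := by
  have key : ∀ {b c : Letter m n} {C D : List (Letter m n)},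
      bumpColumn m n b C = (D, some c) → b ∈ D := by
    intro b c C D h
    induction C generalizing D with
    | nil => simp [bumpColumn] at h
    | cons d C ih =>
      rw [bumpColumn] at h
      split_ifs at h with hb
      · obtain ⟨rfl, -⟩ := Prod.mk.inj h
        simp
      · obtain ⟨rfl, h2⟩ := Prod.mk.inj h
        exact List.mem_cons_of_mem _ (ih (by rw [← h2]))
  -- The inserted letter lies in `D`; below `c` in a column it could not bump `c`.
  have key2 : ∀ {b c : Letter m n} {C D : List (Letter m n)}, IsCol (c :: D) →
      bumpColumn m n b C ≠ (D, some c) := by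
    intro b c C D hc h
    have h1 := (List.pairwise_cons.1 hc).1 b (key h)
    exact h1 (bumpColumn_head h).1
  induction C generalizing C' D with
  | nil => simp [bumpColumn] at h
  | cons d C ih =>
    cases C' with
    | nil => simp [bumpColumn] at h'
    | cons d' C' =>
      rw [bumpColumn] at h h'
      split_ifs at h with hb <;> split_ifs at h' with hb' <;> obtain ⟨h1, h2⟩ := Prod.mk.inj h <;>
        obtain ⟨h3, h4⟩ := Prod.mk.inj h'
      · obtain ⟨h5, h6⟩ := List.cons.inj (h1.trans h3.symm)
        obtain rfl := Option.some.inj (h2.trans h4.symm)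
        exact ⟨by rw [h6], h5⟩
      · obtain ⟨h5, h6⟩ := List.cons.inj (h1.trans h3.symm)
        obtain rfl := Option.some.inj h2
        exact absurd (Prod.ext h6.symm h4) (key2 hC)
      · obtain ⟨h5, h6⟩ := List.cons.inj (h1.trans h3.symm)
        obtain rfl := Option.some.inj h4
        exact absurd (Prod.ext h6 h2) (key2 hC')
      · obtain ⟨h5, h6⟩ := List.cons.inj (h1.trans h3.symm)
        obtain ⟨h7, h8⟩ := ih (List.pairwise_cons.1 hC).2 (List.pairwise_cons.1 hC').2
          (D := (bumpColumn m n b C).1) (by rw [← h2]) (by rw [h6, ← h4])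
        exact ⟨by rw [h5, h7], h8⟩

/-- Because the old shapes agree, the lengths of the new columns tell in which column both
insertions stop; from there each bump is undone in turn. -/
theorem insertLetter_injective {T T' : Filling m n} {b b' : Letter m n} (hT : ∀ C ∈ T, IsCol C)
    (hT' : ∀ C ∈ T', IsCol C) (hl : T.map List.length = T'.map List.length)
    (h : insertLetter m n T b = insertLetter m n T' b') : T = T' ∧ b = b' := by
  induction T generalizing T' b b' with
  | nil =>
    obtain rfl : T' = [] := by simpa using hl.symm
    simpa [insertLetter] using h
  | cons C T ih =>
    cases T' with
    | nil => simp at hl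
    | cons C' T' =>
      obtain ⟨hl1, hl2⟩ := List.cons.inj hl
      have l1 := bumpColumn_length b C
      have l2 := bumpColumn_length b' C'
      rw [insertLetter, insertLetter] at h
      cases h1 : bumpColumn m n b C with
      | mk D o =>
        cases h2 : bumpColumn m n b' C' with
        | mk D' o' =>
          rw [h1] at h l1
          rw [h2] at h l2
          have hD : D = D' := by
            cases o <;> cases o' <;> exact (List.cons.inj h).1
          subst hD
          cases o with
          | none =>
            cases o' with
            | none =>
              have h3 := (bumpColumn_none h1).1.symm.trans (bumpColumn_none h2).1
              obtain ⟨h4, h5⟩ := List.append_inj' h3 rfl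
              exact ⟨by rw [h4, (List.cons.inj h).2], by simpa using h5⟩
            | some c' => simp at l1 l2; omega
          | some c =>
            cases o' with
            | none => simp at l1 l2; omega
            | some c' =>
              obtain ⟨h3, h4⟩ := ih (fun C hC => hT C (by simp [hC]))
                (fun C hC => hT' C (by simp [hC])) hl2 (List.cons.inj h).2
              subst h4
              obtain ⟨h5, h6⟩ := bumpColumn_injective (hT C (by simp)) (hT' C' (by simp)) h1 h2
              exact ⟨by rw [h3, h5], h6⟩

end HookCrystal

namespace HookCrystal
variable {m n : ℕ}

/-! ### Sorted words -/

/-- The word with multiplicities `z`, in increasing order if `d = 1` and in decreasing order if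
`d = 0`. -/
def sortedWord (d : ℕ) (z : Letter m n → ℕ) : List (Letter m n) :=
  (if d = 0 then (List.finRange (m + n)).reverse else List.finRange (m + n)).flatMap
    fun b => List.replicate (z b) b

/-- The multiplicities of letters of degree other than `d` are at most one. -/
def Admissible (d : ℕ) (z : Letter m n → ℕ) : Prop := ∀ b, degree m n b ≠ d → z b ≤ 1

/-- The multiplicities after `f_i`. -/
def lower (i : Idx m n) (z : Letter m n → ℕ) : Letter m n → ℕ := fun b =>
  if b = src i then z b - 1 else if b = tgt i then z b + 1 else z b

/-- The multiplicities after `e_i`. -/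
def raise (i : Idx m n) (z : Letter m n → ℕ) : Letter m n → ℕ := fun b =>
  if b = src i then z b + 1 else if b = tgt i then z b - 1 else z b

/-- The exponent of the signature of a power of a letter. -/
def powSig : Kind → ℕ → ℕ
  | .mixed, a => min a 1
  | _, a => a

/-- The signature of a sorted word in which the first letter occurs `a` times and the second one
`c` times. -/
def blockSig (k : Kind) (d a c : ℕ) : ℕ × ℕ :=
  if d = 0 then sigMul k (powSig k c, 0) (0, powSig k a)
  else sigMul k (0, powSig k a) (powSig k c, 0)

theorem letterSig_src (i : Idx m n) : letterSig i (src i) = (0, 1) := by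
  simp [letterSig, src_ne_tgt]

theorem letterSig_tgt (i : Idx m n) : letterSig i (tgt i) = (1, 0) := by
  simp [letterSig, (src_ne_tgt i).symm]

theorem wordSig_replicate_src (i : Idx m n) (a : ℕ) :
    wordSig i (List.replicate a (src i)) = (0, powSig (kind i) a) := by
  induction a with
  | zero => cases h : kind i <;> simp [powSig]
  | succ a ih =>
    rw [List.replicate_succ, wordSig_cons, ih, letterSig_src]
    cases h : kind i <;> simp [powSig, sigMul]; omega

theorem wordSig_replicate_tgt (i : Idx m n) (a : ℕ) :
    wordSig i (List.replicate a (tgt i)) = (powSig (kind i) a, 0) := by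
  induction a with
  | zero => cases h : kind i <;> simp [powSig]
  | succ a ih =>
    rw [List.replicate_succ, wordSig_cons, ih, letterSig_tgt]
    cases h : kind i <;> simp [powSig, sigMul]
    omega

theorem wordSig_eq_zero (i : Idx m n) (w : List (Letter m n)) (h1 : src i ∉ w) (h2 : tgt i ∉ w) :
    wordSig i w = (0, 0) := by
  induction w with
  | nil => rfl
  | cons b w ih =>
    simp only [List.mem_cons, not_or] at h1 h2
    rw [wordSig_cons, ih h1.2 h2.2]
    simp [letterSig, Ne.symm h1.1, Ne.symm h2.1]

theorem wordF_append_of_left {i : Idx m n} {u w : List (Letter m n)} (h : wordSig i u = (0, 0)) :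
    wordF m n i (u ++ w) = (wordF m n i w).map (u ++ ·) := by
  rw [wordF_append, h]
  split_ifs with hs
  · have h1 : (wordSig i w).2 = 0 := by
      have := (sigMul_snd_eq_zero (k := kind i) (a := (0, 0)) (b := wordSig i w)).2 (by simp [hs])
      simpa using this
    rw [(wordF_eq_none i w).2 h1, (wordF_eq_none i u).2 (by rw [← wordSig_snd, h])]
    rfl
  · rfl

theorem wordF_append_of_right {i : Idx m n} {u w : List (Letter m n)} (h : wordSig i w = (0, 0)) :
    wordF m n i (u ++ w) = (wordF m n i u).map (· ++ w) := by
  rw [wordF_append, h]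
  split_ifs with hs
  · rfl
  · have h1 : (wordSig i u).2 = 0 := by
      have := (sigMul_snd_eq_zero (k := kind i) (a := wordSig i u) (b := (0, 0))).2 (by simp [hs])
      simpa using this
    rw [(wordF_eq_none i u).2 h1, (wordF_eq_none i w).2 (by rw [← wordSig_snd, h])]
    rfl

theorem exists_finRange_eq (i : Idx m n) : ∃ L R : List (Letter m n),
    List.finRange (m + n) = L ++ (src i :: tgt i :: R) ∧ src i ∉ L ∧ tgt i ∉ L ∧ src i ∉ R ∧
      tgt i ∉ R := by
  have hi := i.2
  have h : List.finRange (m + n) = (List.finRange (m + n)).take i.1 ++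
      (src i :: tgt i :: (List.finRange (m + n)).drop (i.1 + 2)) := by
    conv_lhs => rw [← List.take_append_drop i.1 (List.finRange (m + n))]
    congr 1
    rw [List.drop_eq_getElem_cons (by simp; omega), List.drop_eq_getElem_cons (by simp; omega)]
    simp [src, tgt]
  refine ⟨_, _, h, ?_⟩
  have hn := List.nodup_finRange (m + n)
  rw [h, List.nodup_append, List.nodup_cons, List.nodup_cons] at hn
  obtain ⟨-, ⟨h1, h2, -⟩, h3⟩ := hn
  refine ⟨fun h => h3 _ h _ (by simp) rfl, fun h => h3 _ h _ (by simp) rfl, ?_, h2⟩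
  intro h
  exact h1 (by simp [h])

/-- A sorted word around the letters of the colour `i`. -/
theorem exists_sortedWord_eq (i : Idx m n) (d : ℕ) (z : Letter m n → ℕ) :
    ∃ L R : List (Letter m n), wordSig i L = (0, 0) ∧ wordSig i R = (0, 0) ∧
      ∀ z' : Letter m n → ℕ, (∀ b, b ≠ src i → b ≠ tgt i → z' b = z b) →
        sortedWord d z' = L ++ ((if d = 0 then List.replicate (z' (tgt i)) (tgt i) ++
          List.replicate (z' (src i)) (src i) else List.replicate (z' (src i)) (src i) ++
          List.replicate (z' (tgt i)) (tgt i)) ++ R) := by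
  obtain ⟨L, R, h, h1, h2, h3, h4⟩ := exists_finRange_eq i
  have key : ∀ l : List (Letter m n), src i ∉ l → tgt i ∉ l → ∀ z' : Letter m n → ℕ,
      (∀ b, b ≠ src i → b ≠ tgt i → z' b = z b) →
      (l.flatMap fun b => List.replicate (z' b) b) = l.flatMap fun b => List.replicate (z b) b := by
    intro l hs ht z' hz
    refine List.flatMap_congr fun b hb => ?_
    rw [hz b (fun h => hs (h ▸ hb)) (fun h => ht (h ▸ hb))]
  have sig : ∀ l : List (Letter m n), src i ∉ l → tgt i ∉ l →
      wordSig i (l.flatMap fun b => List.replicate (z b) b) = (0, 0) := by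
    intro l hs ht
    apply wordSig_eq_zero <;>
    · intro hm
      obtain ⟨b, hb, hb'⟩ := List.mem_flatMap.1 hm
      have := List.eq_of_mem_replicate hb'
      subst this
      contradiction
  by_cases hd : d = 0
  · refine ⟨R.reverse.flatMap fun b => List.replicate (z b) b,
      L.reverse.flatMap fun b => List.replicate (z b) b, sig _ (by simpa) (by simpa),
      sig _ (by simpa) (by simpa), fun z' hz => ?_⟩
    rw [sortedWord, if_pos hd, if_pos hd, h]
    simp only [List.reverse_append, List.reverse_cons, List.flatMap_append, List.append_assoc,
      List.flatMap_cons, List.flatMap_nil, List.append_nil]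
    rw [key _ (by simpa) (by simpa) z' hz, key _ (by simpa) (by simpa) z' hz]
  · refine ⟨L.flatMap fun b => List.replicate (z b) b,
      R.flatMap fun b => List.replicate (z b) b, sig _ (by simpa) (by simpa),
      sig _ (by simpa) (by simpa), fun z' hz => ?_⟩
    rw [sortedWord, if_neg hd, if_neg hd, h]
    simp only [List.flatMap_append, List.append_assoc, List.flatMap_cons]
    rw [key _ (by simpa) (by simpa) z' hz, key _ (by simpa) (by simpa) z' hz]

theorem wordSig_sortedWord (i : Idx m n) (d : ℕ) (z : Letter m n → ℕ) :
    wordSig i (sortedWord d z) = blockSig (kind i) d (z (src i)) (z (tgt i)) := by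
  obtain ⟨L, R, hL, hR, h⟩ := exists_sortedWord_eq i d z
  rw [h z (fun _ _ _ => rfl), wordSig_append, wordSig_append, hL, hR, sigMul_zero_left,
    sigMul_zero_right, blockSig]
  split_ifs <;> rw [wordSig_append, wordSig_replicate_src, wordSig_replicate_tgt]

theorem letterF_src (i : Idx m n) : (letterData m n).f i (src i) = some (tgt i) := by
  simp [letterData]

theorem degree_src_tgt (i : Idx m n) :
    (kind i = .even ∧ degree m n (src i) = 0 ∧ degree m n (tgt i) = 0) ∨
    (kind i = .mixed ∧ degree m n (src i) = 0 ∧ degree m n (tgt i) = 1) ∨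
    (kind i = .odd ∧ degree m n (src i) = 1 ∧ degree m n (tgt i) = 1) := by
  have h1 : (src i).1 = i.1 := rfl
  have h2 : (tgt i).1 = i.1 + 1 := rfl
  unfold degree
  rcases kind_cases i with ⟨hk, h⟩ | ⟨hk, h⟩ | ⟨hk, h⟩
  · rw [if_pos (by omega), if_pos (by omega)]; simp [hk]
  · rw [if_pos (by omega), if_neg (by omega)]; simp [hk]
  · rw [if_neg (by omega), if_neg (by omega)]; simp [hk]

/-- The changed copy is the first one in the barred and mixed cases and the last one in the unbarred
case. -/
theorem wordF_replicate_src (i : Idx m n) (a : ℕ) : wordF m n i (List.replicate (a + 1) (src i)) =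
    some (match kind i with
      | .odd => List.replicate a (src i) ++ [tgt i]
      | _ => tgt i :: List.replicate a (src i)) := by
  rcases kind_cases i with ⟨hk, -⟩ | ⟨hk, -⟩ | ⟨hk, -⟩
  · rw [List.replicate_succ, wordF_cons, wordSig_replicate_src, letterSig_src, letterF_src, hk]
    simp [SigF]
  · rw [List.replicate_succ, wordF_cons, wordSig_replicate_src, letterSig_src, letterF_src, hk]
    simp [SigF]
  · rw [List.replicate_succ', wordF_append, wordSig_replicate_src, wordSig_cons, letterSig_src,
      wordSig_nil, sigMul_zero_right, hk, if_neg (by simp [SigF]), wordF_cons, letterSig_src,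
      wordSig_nil, letterF_src, hk, if_pos (by simp [SigF])]
    simp

/-- f changes the copy of `src i` adjacent to the block of `tgt i`, or the only copy, so the word
stays sorted. Admissibility excludes the repetitions for which this would fail. A positive φ also
ensures that a multiplicity bounded by one is not raised to two. -/
theorem wordF_sortedWord {i : Idx m n} {d : ℕ} {z : Letter m n → ℕ} (hd : d ≤ 1)
    (hz : Admissible d z) (h : 0 < (blockSig (kind i) d (z (src i)) (z (tgt i))).2) :
    wordF m n i (sortedWord d z) = some (sortedWord d (lower i z)) ∧ 0 < z (src i) ∧
      Admissible d (lower i z) := by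
  obtain ⟨L, R, hL, hR, hw⟩ := exists_sortedWord_eq i d z
  have hne := src_ne_tgt i
  have hs := hz (src i)
  have ht := hz (tgt i)
  have hadm : (degree m n (tgt i) ≠ d → z (tgt i) = 0) → Admissible d (lower i z) := by
    intro h0 b hb
    have := hz b hb
    unfold lower
    split_ifs with h1 h2
    · omega
    · subst h2; have := h0 hb; omega
    · exact this
  have hl1 : lower i z (src i) = z (src i) - 1 := by simp [lower]
  have hl2 : lower i z (tgt i) = z (tgt i) + 1 := by simp [lower, hne.symm]
  rw [hw z (fun _ _ _ => rfl), hw (lower i z) (fun b h1 h2 => by simp [lower, h1, h2]),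
    wordF_append_of_left hL, wordF_append_of_right hR, hl1, hl2]
  generalize hA : z (src i) = A at *
  generalize hC : z (tgt i) = C at *
  obtain rfl | rfl : d = 0 ∨ d = 1 := by omega
  · rcases degree_src_tgt i with ⟨hk, h1, h2⟩ | ⟨hk, h1, h2⟩ | ⟨hk, h1, h2⟩
    · simp only [hk, blockSig, sigMul, powSig, if_true] at h
      obtain ⟨a, rfl⟩ : ∃ a, A = a + 1 := ⟨A - 1, by omega⟩
      refine ⟨?_, by omega, hadm fun h => absurd h2 h⟩
      simp only [if_true]
      rw [wordF_append, wordSig_replicate_tgt, wordSig_replicate_src, wordF_replicate_src, hk,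
        if_neg (by simp [SigF]), List.replicate_succ']
      simp
    · simp only [hk, blockSig, sigMul, powSig, if_true] at h
      obtain rfl : C = 0 := by
        by_contra h0
        rw [if_neg (by omega)] at h
        simp at h
      simp at h
      obtain ⟨a, rfl⟩ : ∃ a, A = a + 1 := ⟨A - 1, by omega⟩
      refine ⟨?_, by omega, hadm fun _ => rfl⟩
      simp only [if_true, List.replicate_zero, List.nil_append]
      rw [wordF_replicate_src, hk]
      simp
    · simp only [hk, blockSig, sigMul, powSig, if_true] at h
      have h3 := hs (by omega)
      obtain rfl : C = 0 := by omega
      obtain rfl : A = 1 := by omega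
      refine ⟨?_, by omega, hadm fun _ => rfl⟩
      simp only [if_true, List.replicate_zero, List.nil_append]
      rw [wordF_replicate_src, hk]
      simp
  · rcases degree_src_tgt i with ⟨hk, h1, h2⟩ | ⟨hk, h1, h2⟩ | ⟨hk, h1, h2⟩
    · simp only [hk, blockSig, sigMul, powSig, one_ne_zero, if_false] at h
      have h3 := hs (by omega)
      obtain rfl : C = 0 := by omega
      obtain rfl : A = 1 := by omega
      refine ⟨?_, by omega, hadm fun _ => rfl⟩
      simp only [one_ne_zero, if_false, List.replicate_zero, List.append_nil]
      rw [wordF_replicate_src, hk]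
      simp
    · simp only [hk, blockSig, sigMul, powSig, one_ne_zero, if_false] at h
      obtain rfl : A = 1 := by
        have := hs (by omega)
        by_contra h0
        obtain rfl : A = 0 := by omega
        simp at h
      refine ⟨?_, by omega, hadm fun h => absurd h2 h⟩
      simp only [one_ne_zero, if_false]
      rw [wordF_append, wordSig_replicate_tgt, wordSig_replicate_src, wordF_replicate_src, hk,
        if_pos (by simp [SigF, powSig]), List.replicate_succ]
      simp
    · simp only [hk, blockSig, sigMul, powSig, one_ne_zero, if_false] at h
      obtain ⟨a, rfl⟩ : ∃ a, A = a + 1 := ⟨A - 1, by omega⟩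
      refine ⟨?_, by omega, hadm fun h => absurd h2 h⟩
      simp only [one_ne_zero, if_false]
      rw [wordF_append, wordSig_replicate_tgt, wordSig_replicate_src, wordF_replicate_src, hk,
        if_pos (by simp [SigF]), List.replicate_succ (n := C)]
      simp

/-- Deduced from `wordF_sortedWord` for the raised multiplicities, since e inverts f. -/
theorem wordE_sortedWord {i : Idx m n} {d : ℕ} {z : Letter m n → ℕ} (hd : d ≤ 1)
    (hz : Admissible d z) (h : 0 < (blockSig (kind i) d (z (src i)) (z (tgt i))).1) :
    wordE m n i (sortedWord d z) = some (sortedWord d (raise i z)) ∧ 0 < z (tgt i) ∧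
      Admissible d (raise i z) := by
  have hne := src_ne_tgt i
  have hs := hz (src i)
  have ht := hz (tgt i)
  -- What is needed for the raised multiplicities to be admissible and for f to be defined on them.
  have key : 0 < z (tgt i) ∧ (degree m n (src i) ≠ d → z (src i) = 0) ∧
      0 < (blockSig (kind i) d (z (src i) + 1) (z (tgt i) - 1)).2 := by
    generalize z (src i) = A at *
    generalize z (tgt i) = C at *
    obtain rfl | rfl : d = 0 ∨ d = 1 := by omega
    · rcases degree_src_tgt i with ⟨hk, h1, h2⟩ | ⟨hk, h1, h2⟩ | ⟨hk, h1, h2⟩ <;>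
        simp only [hk, blockSig, sigMul, powSig, if_true] at h ⊢ <;>
        (try split_ifs at *) <;> omega
    · rcases degree_src_tgt i with ⟨hk, h1, h2⟩ | ⟨hk, h1, h2⟩ | ⟨hk, h1, h2⟩ <;>
        simp only [hk, blockSig, sigMul, powSig, one_ne_zero, if_false] at h ⊢ <;>
        (try split_ifs at *) <;> omega
  obtain ⟨h1, h2, h3⟩ := key
  have hadm : Admissible d (raise i z) := by
    intro b hb
    have := hz b hb
    unfold raise
    split_ifs with h4 h5
    · subst h4; have := h2 hb; omega
    · omega
    · exact this
  refine ⟨?_, h1, hadm⟩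
  have h4 := (wordF_sortedWord (i := i) hd hadm (by
    simpa [raise, hne.symm] using h3)).1
  have h5 : lower i (raise i z) = z := by
    ext b
    unfold lower raise
    split_ifs with h6 h7
    · simp
    · subst h7; omega
    · rfl
  rw [h5] at h4
  exact wordE_of_wordF h4

theorem count_sortedWord (d : ℕ) (z : Letter m n → ℕ) (b : Letter m n) :
    (sortedWord d z).count b = z b := by
  have key : ∀ l : List (Letter m n), l.Perm (List.finRange (m + n)) →
      (l.flatMap fun c => List.replicate (z c) c).count b = z b := by
    intro l hl
    rw [List.count_flatMap, (hl.map _).sum_eq, ← List.ofFn_eq_map, List.sum_ofFn]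
    simp [List.count_replicate]
  unfold sortedWord
  split_ifs
  · exact key _ (List.reverse_perm _)
  · exact key _ (List.Perm.refl _)

theorem length_sortedWord (d : ℕ) (z : Letter m n → ℕ) : (sortedWord d z).length = ∑ b, z b := by
  have key : ∀ l : List (Letter m n), l.Perm (List.finRange (m + n)) →
      (l.flatMap fun c => List.replicate (z c) c).length = ∑ b, z b := by
    intro l hl
    rw [List.length_flatMap, (hl.map _).sum_eq, ← List.ofFn_eq_map, List.sum_ofFn]
    simp
  unfold sortedWord
  split_ifs
  · exact key _ (List.reverse_perm _)
  · exact key _ (List.Perm.refl _)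

theorem sortedWord_pairwise_le (z : Letter m n → ℕ) : (sortedWord 1 z).Pairwise (· ≤ ·) := by
  rw [sortedWord, if_neg one_ne_zero, List.pairwise_flatMap]
  refine ⟨fun b _ => List.pairwise_replicate.2 (Or.inr le_rfl), ?_⟩
  refine (List.pairwise_lt_finRange _).imp ?_
  intro a c hac x hx y hy
  rw [List.eq_of_mem_replicate hx, List.eq_of_mem_replicate hy]
  exact hac.le

theorem isCol_sortedWord {z : Letter m n → ℕ} (hz : Admissible 1 z) : IsCol (sortedWord 1 z) := by
  rw [IsCol, sortedWord, if_neg one_ne_zero, List.pairwise_flatMap]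
  refine ⟨fun b _ => List.pairwise_replicate.2 ?_, ?_⟩
  · by_cases hb : degree m n b = 1
    · right; unfold Bumps; simp [hb]
    · left; exact hz b hb
  · refine (List.pairwise_lt_finRange _).imp ?_
    intro a c hac x hx y hy
    rw [List.eq_of_mem_replicate hx, List.eq_of_mem_replicate hy, bumps_iff]
    have : a.1 < c.1 := hac
    omega

/-- A column is an increasing word whose barred letters are distinct, so operators on columns reduce
to operators on multiplicities. -/
theorem IsCol.eq_sortedWord {C : List (Letter m n)} (hC : IsCol C) :
    C = sortedWord 1 (fun b => C.count b) ∧ Admissible 1 (fun b => C.count b) := by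
  constructor
  · refine List.Perm.eq_of_pairwise (le := (· ≤ ·)) (fun _ _ _ _ => le_antisymm) ?_
      (sortedWord_pairwise_le _) ?_
    · refine hC.imp ?_
      intro a b h
      rw [bumps_iff] at h
      rw [Fin.le_def]; omega
    · rw [List.perm_iff_count]
      intro b
      rw [count_sortedWord]
  · intro b hb
    by_contra h
    change ¬ C.count b ≤ 1 at h
    have h2 : (List.replicate 2 b).Sublist C := List.replicate_sublist_iff.2 (by omega)
    have := hC.sublist h2
    simp only [List.replicate_succ, List.pairwise_cons] at this
    have := this.1 b (by simp)
    unfold degree at hb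
    rw [bumps_iff] at this
    split_ifs at hb with h3 <;> simp at hb
    omega

theorem IsCol.sig_eq {C : List (Letter m n)} (hC : IsCol C) (i : Idx m n) :
    wordSig i C = blockSig (kind i) 1 (C.count (src i)) (C.count (tgt i)) := by
  conv_lhs => rw [hC.eq_sortedWord.1]
  rw [wordSig_sortedWord]

theorem IsCol.wordF {C C' : List (Letter m n)} (hC : IsCol C) {i : Idx m n}
    (h : wordF m n i C = some C') : IsCol C' ∧ ∀ b, C'.count b = lower i (fun b => C.count b) b := by
  obtain ⟨h1, h2⟩ := hC.eq_sortedWord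
  have h3 : 0 < (wordSig i C).2 := by
    rw [pos_iff_ne_zero]
    intro h0
    rw [(wordF_eq_none i C).2 h0] at h
    cases h
  rw [hC.sig_eq] at h3
  obtain ⟨h4, -, h5⟩ := wordF_sortedWord le_rfl h2 h3
  rw [← h1, h] at h4
  obtain rfl := Option.some.inj h4
  exact ⟨isCol_sortedWord h5, fun b => count_sortedWord _ _ _⟩

theorem IsCol.wordE {C C' : List (Letter m n)} (hC : IsCol C) {i : Idx m n}
    (h : wordE m n i C = some C') : IsCol C' ∧ ∀ b, C'.count b = raise i (fun b => C.count b) b := by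
  obtain ⟨h1, h2⟩ := hC.eq_sortedWord
  have h3 : 0 < (wordSig i C).1 := by
    rw [pos_iff_ne_zero]
    intro h0
    rw [(wordE_eq_none i C).2 h0] at h
    cases h
  rw [hC.sig_eq] at h3
  obtain ⟨h4, -, h5⟩ := wordE_sortedWord le_rfl h2 h3
  rw [← h1, h] at h4
  obtain rfl := Option.some.inj h4
  exact ⟨isCol_sortedWord h5, fun b => count_sortedWord _ _ _⟩

end HookCrystal

namespace HookCrystal
variable {m n : ℕ}

/-! ### Cumulative counts -/

/-- The number of letters below `t`. -/
def cum (C : List (Letter m n)) (t : ℕ) : ℕ := C.countP (fun b => b.1 < t)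

theorem cum_cons (c : Letter m n) (C : List (Letter m n)) (t : ℕ) :
    cum (c :: C) t = cum C t + if c.1 < t then 1 else 0 := by
  simp [cum, List.countP_cons]

theorem cum_zero (C : List (Letter m n)) : cum C 0 = 0 := by
  simp [cum]

theorem cum_eq_zero {C : List (Letter m n)} {t : ℕ} (h : ∀ b ∈ C, t ≤ b.1) : cum C t = 0 := by
  simpa [cum] using h

theorem cum_mono (C : List (Letter m n)) {s t : ℕ} (h : s ≤ t) : cum C s ≤ cum C t := by
  unfold cum
  refine List.countP_mono_left fun b _ hb => ?_
  simp at hb ⊢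
  omega

theorem cum_succ (C : List (Letter m n)) (b : Letter m n) :
    cum C (b.1 + 1) = cum C b.1 + C.count b := by
  induction C with
  | nil => simp [cum]
  | cons c C ih =>
    rw [cum_cons, cum_cons, List.count_cons, ih]
    simp only [beq_iff_eq, Fin.ext_iff]
    split_ifs <;> omega

theorem cum_top (C : List (Letter m n)) {t : ℕ} (ht : m + n ≤ t) : cum C t = C.length := by
  unfold cum
  rw [List.countP_eq_length]
  intro b _
  have := b.2
  simp; omega

theorem cum_append (C D : List (Letter m n)) (t : ℕ) : cum (C ++ D) t = cum C t + cum D t := by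
  simp [cum, List.countP_append]

/-- The relation between adjacent columns, in terms of cumulative counts. -/
def CumFits (m n : ℕ) (f g : ℕ → ℕ) : Prop :=
  ∀ t, t < m + n → if t < m then g (t + 1) ≤ f (t + 1) else g (t + 1) ≤ f t

theorem IsCol.head_le {c : Letter m n} {C : List (Letter m n)} (h : IsCol (c :: C)) :
    ∀ b ∈ c :: C, c.1 ≤ b.1 := by
  intro b hb
  rcases List.mem_cons.1 hb with rfl | hb
  · exact le_rfl
  · have := (List.pairwise_cons.1 h).1 b hb
    rw [bumps_iff] at this; omega

/-- Row by row comparison of two sorted columns is dominance of their counting functions; the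
strictness for unbarred letters appears as the shift from `t + 1` to `t`. -/
theorem fits_iff {C D : List (Letter m n)} (hC : IsCol C) (hD : IsCol D) :
    Fits C D ↔ CumFits m n (cum C) (cum D) := by
  induction D generalizing C with
  | nil =>
    constructor
    · intro _ t _
      have : ∀ s, cum ([] : List (Letter m n)) s = 0 := fun s => by simp [cum]
      simp [this]
    · intro _; cases C <;> trivial
  | cons d D ih =>
    cases C with
    | nil =>
      refine ⟨fun h => h.elim, fun h => ?_⟩
      have h1 := h d.1 d.2
      have h2 : ∀ s, cum ([] : List (Letter m n)) s = 0 := fun s => by simp [cum]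
      rw [h2, h2, cum_cons, if_pos (Nat.lt_succ_self _)] at h1
      split_ifs at h1 <;> omega
    | cons c C =>
      have hC' := (List.pairwise_cons.1 hC).2
      have hD' := (List.pairwise_cons.1 hD).2
      rw [Fits, ih hC' hD']
      constructor
      · rintro ⟨h1, h2⟩ t ht
        have h3 := h2 t ht
        rw [bumps_iff] at h1
        simp only [cum_cons]
        split_ifs at * <;> omega
      · intro h
        -- Otherwise `C` would have no letter counted at the level of `d`, while `D` has at least
        -- one there.
        have hcd : Bumps m n c d := by
          have h1 := h d.1 d.2
          rw [cum_cons (t := d.1 + 1) (c := d), if_pos (Nat.lt_succ_self _)] at h1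
          rw [bumps_iff]
          by_contra hc
          split_ifs at h1 with hm
          · rw [cum_eq_zero (C := c :: C) (t := d.1 + 1) (fun b hb => by
              have := hC.head_le b hb; omega)] at h1
            omega
          · rw [cum_eq_zero (C := c :: C) (t := d.1) (fun b hb => by
              have := hC.head_le b hb; omega)] at h1
            omega
        refine ⟨hcd, fun t ht => ?_⟩
        rw [bumps_iff] at hcd
        by_cases hdt : d.1 < t + 1
        · have h1 := h t ht
          simp only [cum_cons, if_pos hdt] at h1
          split_ifs at * <;> omega
        · rw [cum_eq_zero (C := D) (t := t + 1) (fun b hb => by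
            have := hD.head_le b (by simp [hb]); omega)]
          split_ifs <;> omega

/-- Replacing one `src i` by `tgt i` is visible only at the single threshold between these two
letters. -/
theorem cum_lower {C C' : List (Letter m n)} {i : Idx m n}
    (h : ∀ b, C'.count b = lower i (fun b => C.count b) b) (h0 : 0 < C.count (src i)) (t : ℕ) :
    cum C t = cum C' t + if t = i.1 + 1 then 1 else 0 := by
  have hs : (src i).1 = i.1 := rfl
  have ht : (tgt i).1 = i.1 + 1 := rfl
  induction t with
  | zero => simp [cum_zero]
  | succ t ih =>
    by_cases htl : t < m + n
    · have h1 := cum_succ C ⟨t, htl⟩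
      have h2 := cum_succ C' ⟨t, htl⟩
      rw [h] at h2
      simp only [lower] at h1 h2
      rw [h1, h2, ih]
      by_cases h3 : (⟨t, htl⟩ : Letter m n) = src i
      · have : t = i.1 := by rw [Fin.ext_iff, hs] at h3; exact h3
        rw [if_pos h3, h3]
        split_ifs <;> omega
      · have h3' : t ≠ i.1 := fun h => h3 (Fin.ext h)
        by_cases h4 : (⟨t, htl⟩ : Letter m n) = tgt i
        · have : t = i.1 + 1 := by rw [Fin.ext_iff, ht] at h4; exact h4
          rw [if_neg h3, if_pos h4]
          split_ifs <;> omega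
        · have h4' : t ≠ i.1 + 1 := fun h => h4 (Fin.ext h)
          rw [if_neg h3, if_neg h4]
          split_ifs <;> omega
    · have hi := i.2
      have e1 := cum_top C (t := t) (by omega)
      have e2 := cum_top C' (t := t) (by omega)
      rw [cum_top C (by omega), cum_top C' (by omega)]
      split_ifs at * <;> omega

theorem cum_src_tgt (C : List (Letter m n)) (i : Idx m n) :
    cum C (i.1 + 1) = cum C i.1 + C.count (src i) ∧
    cum C (i.1 + 2) = cum C (i.1 + 1) + C.count (tgt i) :=
  ⟨cum_succ C (src i), cum_succ C (tgt i)⟩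

theorem IsCol.cum_wordF {C C' : List (Letter m n)} (hC : IsCol C) {i : Idx m n}
    (h : HookCrystal.wordF m n i C = some C') (t : ℕ) :
    cum C t = cum C' t + if t = i.1 + 1 then 1 else 0 := by
  refine cum_lower (hC.wordF h).2 ?_ t
  by_contra h0
  have h1 := (wordF_wt h)
  have h2 := congrFun h1 (src i)
  rw [wordWt_apply, Pi.sub_apply, wordWt_apply, root] at h2
  simp [src_ne_tgt] at h2
  omega

theorem IsCol.cum_wordE {C C' : List (Letter m n)} (hC : IsCol C) {i : Idx m n}
    (h : HookCrystal.wordE m n i C = some C') (t : ℕ) :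
    cum C' t = cum C t + if t = i.1 + 1 then 1 else 0 :=
  (hC.wordE h).1.cum_wordF ((wordF_iff_wordE _ _ _).2 h) t

/-- `f` acting on the left column. -/
theorem Fits.wordF_left {C D C' : List (Letter m n)} (hC : IsCol C) (hD : IsCol D) (h : Fits C D)
    {i : Idx m n} (hf : wordF m n i C = some C')
    (hs : ¬ SigF (kind i) (wordSig i D) (wordSig i C)) : Fits C' D := by
  have hp : 0 < (wordSig i C).2 := by have := (wordF_shift hf).1; omega
  rw [fits_iff (hC.wordF hf).1 hD]
  rw [fits_iff hC hD] at h
  intro t ht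
  have h1 := hC.cum_wordF hf
  have h2 := h t ht
  obtain ⟨c1, c2⟩ := cum_src_tgt C i
  obtain ⟨d1, d2⟩ := cum_src_tgt D i
  have hi := i.2
  have a1 := h i.1 (by omega)
  have a2 := h (i.1 + 1) (by omega)
  have a0 : 0 < i.1 → _ := fun _ => h (i.1 - 1) (by omega)
  have z1 := cum_zero C
  have z2 := cum_zero D
  have b1 := hC.eq_sortedWord.2 (src i)
  have b2 := hD.eq_sortedWord.2 (src i)
  rw [hC.sig_eq] at hs hp
  rw [hD.sig_eq] at hs
  have e1 := h1 t
  have e2 := h1 (t + 1)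
  -- Only `cum C (i.1 + 1)` drops. The inequalities at risk are the one at `t = i.1` in the barred
  -- and mixed cases and the one at `t = i.1 + 1` in the mixed and unbarred cases; `hs` excludes
  -- equality there.
  rcases kind_cases i with ⟨hk, hi'⟩ | ⟨hk, hi'⟩ | ⟨hk, hi'⟩
  · have hdeg : degree m n (src i) ≠ 1 := by
      rcases degree_src_tgt i with h | h | h <;> simp_all
    have b1 := b1 hdeg
    have b2 := b2 hdeg
    simp only [hk, blockSig, one_ne_zero, if_false, SigF, sigMul, powSig] at hs hp
    rw [if_pos (by omega)] at a1 a2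
    by_cases hti : t = i.1
    · subst hti
      rw [if_pos (by omega)]
      rw [if_pos rfl] at e2
      have q3 : cum D i.1 ≤ cum C i.1 := by
        by_cases h0 : i.1 = 0
        · rw [h0, z1, z2]
        · have a0 := a0 (by omega)
          rw [if_pos (by omega), Nat.sub_add_cancel (by omega)] at a0
          exact a0
      have f1 : cum D (i.1 + 1 + 1) = cum D (i.1 + 2) := rfl
      have f2 : cum C (i.1 + 1 + 1) = cum C (i.1 + 2) := rfl
      dsimp only at b1 b2
      omega
    · rw [if_neg (by omega)] at e2
      split_ifs at * <;> omega
  · simp only [hk, blockSig, one_ne_zero, if_false, SigF, sigMul, powSig] at hs hp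
    -- In the mixed case f passes over `D` only if `D` contains neither of the two letters.
    have q1 : D.count (src i) = 0 := by
      by_contra h0; rw [if_neg (by omega)] at hs; omega
    have q2 : D.count (tgt i) = 0 := by
      rw [if_pos (by omega)] at hs; omega
    rw [if_pos (by omega)] at a1
    rw [if_neg (by omega)] at a2
    have q3 : cum D i.1 ≤ cum C i.1 := by
      by_cases h0 : i.1 = 0
      · rw [h0, z1, z2]
      · have a0 := a0 (by omega)
        rw [if_pos (by omega), Nat.sub_add_cancel (by omega)] at a0
        exact a0
    have q4 : 0 < C.count (src i) := by
      by_contra h0; rw [if_pos (by omega)] at hp; omega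
    by_cases hti : t = i.1
    · subst hti
      rw [if_pos (by omega)]
      rw [if_pos rfl] at e2
      omega
    · rw [if_neg (by omega)] at e2
      by_cases hti : t = i.1 + 1
      · subst hti
        rw [if_neg (by omega)]
        rw [if_pos rfl] at e1
        have : cum D (i.1 + 1 + 1) = cum D (i.1 + 2) := rfl
        omega
      · rw [if_neg hti] at e1
        split_ifs at * <;> omega
  · simp only [hk, blockSig, one_ne_zero, if_false, SigF, sigMul, powSig] at hs hp
    rw [if_neg (by omega)] at a1 a2
    have : cum D (i.1 + 1 + 1) = cum D (i.1 + 2) := rfl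
    by_cases hti : t = i.1 + 1
    · subst hti
      rw [if_neg (by omega)]
      rw [if_pos rfl] at e1
      omega
    · rw [if_neg hti] at e1
      split_ifs at * <;> omega

/-- `f` acting on the right column. -/
theorem Fits.wordF_right {C D D' : List (Letter m n)} (hC : IsCol C) (hD : IsCol D) (h : Fits C D)
    {i : Idx m n} (hf : wordF m n i D = some D') : Fits C D' := by
  rw [fits_iff hC (hD.wordF hf).1]
  rw [fits_iff hC hD] at h
  intro t ht
  have h1 := hD.cum_wordF hf (t + 1)
  have h2 := h t ht
  split_ifs at * <;> omega

/-- `e` acting on the left column. -/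
theorem Fits.wordE_left {C D C' : List (Letter m n)} (hC : IsCol C) (hD : IsCol D) (h : Fits C D)
    {i : Idx m n} (hf : wordE m n i C = some C') : Fits C' D := by
  rw [fits_iff (hC.wordE hf).1 hD]
  rw [fits_iff hC hD] at h
  intro t ht
  have h1 := hC.cum_wordE hf (t + 1)
  have h3 := hC.cum_wordE hf t
  have h2 := h t ht
  split_ifs at * <;> omega

/-- `e` acting on the right column. -/
theorem Fits.wordE_right {C D D' : List (Letter m n)} (hC : IsCol C) (hD : IsCol D) (h : Fits C D)
    {i : Idx m n} (hf : wordE m n i D = some D')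
    (hs : SigE (kind i) (wordSig i D) (wordSig i C)) : Fits C D' := by
  have hp : 0 < (wordSig i D).1 := by
    have := (wordF_shift ((wordF_iff_wordE _ _ _).2 hf)).2; omega
  rw [fits_iff hC (hD.wordE hf).1]
  rw [fits_iff hC hD] at h
  intro t ht
  have h1 := hD.cum_wordE hf (t + 1)
  have h2 := h t ht
  -- Raising `D` increases only `cum D (i.1 + 1)`, which is the left side of the inequality at `t =
  -- i.1` alone.
  by_cases hti : t = i.1
  · subst hti
    obtain ⟨c1, c2⟩ := cum_src_tgt C i
    obtain ⟨d1, d2⟩ := cum_src_tgt D i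
    have hi := i.2
    have a2 := h (i.1 + 1) (by omega)
    have a0 : 0 < i.1 → _ := fun _ => h (i.1 - 1) (by omega)
    have z1 := cum_zero C
    have z2 := cum_zero D
    have b1 := hC.eq_sortedWord.2 (tgt i)
    have b2 := hD.eq_sortedWord.2 (tgt i)
    rw [hC.sig_eq] at hs
    rw [hD.sig_eq] at hs hp
    rw [if_pos rfl] at h1
    have e1 : cum D (i.1 + 1 + 1) = cum D (i.1 + 2) := rfl
    have e2 : cum C (i.1 + 1 + 1) = cum C (i.1 + 2) := rfl
    rcases kind_cases i with ⟨hk, hi'⟩ | ⟨hk, hi'⟩ | ⟨hk, hi'⟩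
    · have hdeg : degree m n (tgt i) ≠ 1 := by
        rcases degree_src_tgt i with h | h | h <;> simp_all
      have b1 := b1 hdeg
      have b2 := b2 hdeg
      simp only [hk, blockSig, one_ne_zero, if_false, SigE, sigMul, powSig] at hs hp
      rw [if_pos (by omega)] at a2 h2 ⊢
      have q3 : cum D i.1 ≤ cum C i.1 := by
        by_cases h0 : i.1 = 0
        · rw [h0, z1, z2]
        · have a0 := a0 (by omega)
          rw [if_pos (by omega), Nat.sub_add_cancel (by omega)] at a0
          exact a0
      omega
    · simp only [hk, blockSig, one_ne_zero, if_false, SigE, sigMul, powSig] at hs hp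
      have q1 : 0 < D.count (tgt i) := by
        by_contra h0; split_ifs at hp <;> dsimp only at hp <;> omega
      rw [if_pos (by omega)] at h2 ⊢
      rw [if_neg (by omega)] at a2
      omega
    · simp only [hk, blockSig, one_ne_zero, if_false, SigE, sigMul, powSig] at hs hp
      rw [if_neg (by omega)] at a2 h2 ⊢
      omega
  · split_ifs at * <;> omega

end HookCrystal

namespace HookCrystal
variable {m n : ℕ}

/-! ### The crystal structure of tableaux -/

theorem reading_cons (C : List (Letter m n)) (T : Filling m n) :
    Filling.reading (C :: T) = Filling.reading T ++ C := by
  simp [Filling.reading]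

theorem isTableau_cons {C : List (Letter m n)} {T : Filling m n} :
    IsTableau (C :: T) ↔ IsCol C ∧ C ≠ [] ∧ (∀ D ∈ T.head?, Fits C D) ∧ IsTableau T := by
  constructor
  · intro h
    exact ⟨h.col C (by simp), h.ne_nil C (by simp), (List.isChain_cons.1 h.fits).1, h.of_cons⟩
  · rintro ⟨h1, h2, h3, h4⟩
    refine ⟨?_, ?_, List.isChain_cons.2 ⟨h3, h4.fits⟩⟩
    · intro D hD
      rcases List.mem_cons.1 hD with rfl | hD
      · exact h1
      · exact h4.col D hD
    · intro D hD
      rcases List.mem_cons.1 hD with rfl | hD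
      · exact h2
      · exact h4.ne_nil D hD

/-- The reading of the columns to the right ends with the column next to `C`; this passes from the
signature of all of them to that of the neighbour. -/
theorem not_sigF_of_not_mul_left {k : Kind} {a b c : ℕ × ℕ} (h : ¬ SigF k (sigMul k a b) c) :
    ¬ SigF k b c := by
  cases k <;> simp only [SigF, sigMul] at h ⊢
  · omega
  · split_ifs at h <;> omega
  · omega

theorem SigE.of_mul_left {k : Kind} {a b c : ℕ × ℕ} (h : SigE k (sigMul k a b) c)
    (h' : ¬ SigE k a b) : SigE k b c := by
  cases k <;> simp only [SigE, sigMul] at h h' ⊢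
  · omega
  · split_ifs at h <;> omega
  · omega

/-- Only one column changes, so only its two adjacencies need checking. The last clause records what
happened to the first column, for use when another column is put on its left. -/
theorem IsTableau.exists_wordF {T : Filling m n} (hT : IsTableau T) {i : Idx m n}
    {w : List (Letter m n)} (h : wordF m n i T.reading = some w) :
    ∃ T' : Filling m n, IsTableau T' ∧ T'.reading = w ∧ T'.map List.length = T.map List.length ∧
      ∀ D' ∈ T'.head?, ∃ D ∈ T.head?, D' = D ∨ wordF m n i D = some D' := by
  induction T generalizing w with
  | nil => simp [Filling.reading, wordF] at h
  | cons C T ih =>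
    obtain ⟨h1, h2, h3, h4⟩ := isTableau_cons.1 hT
    rw [reading_cons, wordF_append] at h
    split_ifs at h with hs
    · obtain ⟨w', hw, rfl⟩ := Option.map_eq_some_iff.1 h
      obtain ⟨T', g1, g2, g3, g4⟩ := ih h4 hw
      refine ⟨C :: T', isTableau_cons.2 ⟨h1, h2, ?_, g1⟩, ?_, ?_, ?_⟩
      · intro D' hD'
        obtain ⟨D, hD, g5⟩ := g4 D' hD'
        rcases g5 with rfl | g5
        · exact h3 _ hD
        · exact (h3 D hD).wordF_right h1 (h4.col D (List.mem_of_mem_head? hD)) g5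
      · rw [reading_cons, g2]
      · simp [g3]
      · simp
    · obtain ⟨C', hC', rfl⟩ := Option.map_eq_some_iff.1 h
      have hl := wordF_length hC'
      refine ⟨C' :: T, isTableau_cons.2 ⟨(h1.wordF hC').1, ?_, ?_, h4⟩, ?_, ?_, ?_⟩
      · rintro rfl
        exact h2 (List.length_eq_zero_iff.1 hl.symm)
      · intro D hD
        refine (h3 D hD).wordF_left h1 (h4.col D (List.mem_of_mem_head? hD)) hC' ?_
        cases T with
        | nil => simp at hD
        | cons E T =>
          obtain rfl : E = D := by simpa using hD
          rw [reading_cons, wordSig_append] at hs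
          exact not_sigF_of_not_mul_left hs
      · rw [reading_cons]
      · simp [hl]
      · simp [hC']

theorem wordE_length {i : Idx m n} {w w' : List (Letter m n)} (h : wordE m n i w = some w') :
    w'.length = w.length :=
  (wordF_length ((wordF_iff_wordE _ _ _).2 h)).symm

/-- As for f, but here it is the raised right column that endangers the adjacency. The extra
implication therefore carries the signature condition from the whole tableau down to its first
column. -/
theorem IsTableau.exists_wordE {T : Filling m n} (hT : IsTableau T) {i : Idx m n}
    {w : List (Letter m n)} (h : wordE m n i T.reading = some w) :
    ∃ T' : Filling m n, IsTableau T' ∧ T'.reading = w ∧ T'.map List.length = T.map List.length ∧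
      ∀ D' ∈ T'.head?, ∃ D ∈ T.head?, D' = D ∨ (wordE m n i D = some D' ∧
        ∀ s, SigE (kind i) (wordSig i T.reading) s → SigE (kind i) (wordSig i D) s) := by
  induction T generalizing w with
  | nil => simp [Filling.reading, wordE] at h
  | cons C T ih =>
    obtain ⟨h1, h2, h3, h4⟩ := isTableau_cons.1 hT
    rw [reading_cons, wordE_append] at h
    split_ifs at h with hs
    · obtain ⟨w', hw, rfl⟩ := Option.map_eq_some_iff.1 h
      obtain ⟨T', g1, g2, g3, g4⟩ := ih h4 hw
      refine ⟨C :: T', isTableau_cons.2 ⟨h1, h2, ?_, g1⟩, ?_, ?_, ?_⟩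
      · intro D' hD'
        obtain ⟨D, hD, g5⟩ := g4 D' hD'
        rcases g5 with rfl | g5
        · exact h3 _ hD
        · exact (h3 D hD).wordE_right h1 (h4.col D (List.mem_of_mem_head? hD)) g5.1 (g5.2 _ hs)
      · rw [reading_cons, g2]
      · simp [g3]
      · simp
    · obtain ⟨C', hC', rfl⟩ := Option.map_eq_some_iff.1 h
      have hl := wordE_length hC'
      refine ⟨C' :: T, isTableau_cons.2 ⟨(h1.wordE hC').1, ?_, ?_, h4⟩, ?_, ?_, ?_⟩
      · rintro rfl
        exact h2 (List.length_eq_zero_iff.1 hl.symm)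
      · intro D hD
        exact (h3 D hD).wordE_left h1 (h4.col D (List.mem_of_mem_head? hD)) hC'
      · rw [reading_cons]
      · simp [hl]
      · simp only [List.head?_cons, Option.mem_some_iff, forall_eq', exists_eq_left']
        right
        refine ⟨hC', fun s hs' => ?_⟩
        rw [reading_cons, wordSig_append] at hs'
        exact hs'.of_mul_left hs

/-- A filling is determined by its reading and its column lengths, so operators on fillings can be
studied on readings. -/
theorem refill_eq {T T' : Filling m n} {w : List (Letter m n)} (h : T'.reading = w)
    (hl : T'.map List.length = T.map List.length) : T.refill w = T' := by
  have key : ∀ S : List (List (Letter m n)), (S.map List.length).splitLengths S.flatten = S := by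
    intro S
    induction S with
    | nil => rfl
    | cons C S ih => simp [ih]
  subst h
  unfold Filling.refill Filling.reading
  rw [List.map_reverse, ← hl, ← List.map_reverse, key, List.reverse_reverse]

theorem reading_injective {T T' : Filling m n} (h : T.reading = T'.reading)
    (hl : T.map List.length = T'.map List.length) : T = T' :=
  (refill_eq (T := T') h hl).symm.trans (refill_eq (T := T') rfl rfl)

/-! ### Comparison with Young diagrams -/

theorem bumps_trans {a b c : Letter m n} (h : Bumps m n a b) (h' : Bumps m n b c) :
    Bumps m n a c := by
  rw [bumps_iff] at *; omega

theorem fits_iff_getElem {C D : List (Letter m n)} :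
    Fits C D ↔ ∀ (r : ℕ) d, D[r]? = some d → ∃ c, C[r]? = some c ∧ Bumps m n c d := by
  induction D generalizing C with
  | nil => cases C <;> simp [Fits]
  | cons d D ih =>
    cases C with
    | nil =>
      simp only [Fits, false_iff, not_forall]
      exact ⟨0, d, by simp, by simp⟩
    | cons c C =>
      rw [Fits, ih]
      constructor
      · rintro ⟨h1, h2⟩ r e he
        cases r with
        | zero => simp at he ⊢; exact he ▸ h1
        | succ r => simp at he ⊢; exact h2 r e he
      · intro h
        refine ⟨?_, fun r e he => ?_⟩
        · simpa using h 0 d (by simp)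
        · simpa using h (r + 1) e (by simpa using he)

theorem Fits.trans {C D E : List (Letter m n)} (h : Fits C D) (h' : Fits D E) : Fits C E := by
  rw [fits_iff_getElem] at *
  intro r e he
  obtain ⟨d, hd, h1⟩ := h' r e he
  obtain ⟨c, hc, h2⟩ := h r d hd
  exact ⟨c, hc, bumps_trans h2 h1⟩

theorem Fits.length_le {C D : List (Letter m n)} (h : Fits C D) : D.length ≤ C.length := by
  rw [fits_iff_getElem] at h
  by_contra hl
  push Not at hl
  obtain ⟨c, hc, -⟩ := h C.length D[C.length] (List.getElem?_eq_getElem hl)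
  simp at hc

theorem bumps_iff_degree (a b : Letter m n) :
    Bumps m n a b ↔ a ≤ b ∧ (degree m n a = 1 → degree m n b = 1 → a < b) := by
  rw [bumps_iff, Fin.le_def, Fin.lt_def]
  unfold degree
  split_ifs <;> simp <;> omega

theorem not_bumps_iff_degree (a b : Letter m n) :
    ¬ Bumps m n b a ↔ a ≤ b ∧ (degree m n a = 0 → degree m n b = 0 → a < b) := by
  rw [bumps_iff, Fin.le_def, Fin.lt_def]
  unfold degree
  split_ifs <;> simp <;> omega

/-- Transitivity of `Fits` extends the row conditions from adjacent columns to all pairs of columns,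
and the shape is just the list of column lengths. -/
theorem mem_tableaux_iff {T : Filling m n} {μ : YoungDiagram} :
    T ∈ tableaux m n μ ↔ IsTableau T ∧ T.map List.length = μ.transpose.rowLens := by
  have hsh : μ.transpose.rowLens = (List.range (μ.rowLen 0)).map μ.colLen := by
    unfold YoungDiagram.rowLens
    rw [YoungDiagram.colLen_transpose]
    simp
  constructor
  · rintro ⟨h1, h2⟩
    unfold HasShape at h1
    rw [← hsh] at h1
    refine ⟨⟨?_, ?_, ?_⟩, h1⟩
    · intro C hC
      obtain ⟨c, hc, rfl⟩ := List.getElem_of_mem hC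
      unfold IsCol
      rw [List.pairwise_iff_getElem]
      intro r r' hr hr' hrr
      have e1 : Filling.entry T r c = some T[c][r] := by simp [Filling.entry, hc, hr]
      have e2 : Filling.entry T r' c = some T[c][r'] := by simp [Filling.entry, hc, hr']
      rw [not_bumps_iff_degree]
      exact ⟨h2.col_weak _ _ _ _ _ hrr e1 e2, h2.col_strict _ _ _ _ _ hrr e1 e2⟩
    · intro C hC h0
      have : C.length ∈ T.map List.length := List.mem_map_of_mem hC
      rw [h1] at this
      have := YoungDiagram.pos_of_mem_rowLens _ _ this
      rw [h0] at this
      simp at this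
    · rw [List.isChain_iff_getElem]
      intro c hc
      rw [fits_iff_getElem]
      intro r d hd
      have hl : (T[c + 1]).length ≤ (T[c]).length := by
        have := (YoungDiagram.rowLens_sorted μ.transpose)
        rw [← h1] at this
        have := this.getElem_ge_getElem_of_le (j := c) (i := c + 1)
          (hi := by simpa using hc) (hj := by simp; omega) (Nat.le_succ c)
        simpa using this
      have hr : r < (T[c + 1]).length := by
        by_contra h0
        rw [List.getElem?_eq_none (by omega)] at hd
        cases hd
      have e1 : Filling.entry T r c = some (T[c][r]'(by omega)) := by
        simp [Filling.entry, List.getElem?_eq_getElem (show c < T.length by omega),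
          List.getElem?_eq_getElem (show r < T[c].length by omega)]
      have e2 : Filling.entry T r (c + 1) = some d := by
        simp [Filling.entry, List.getElem?_eq_getElem hc, hd]
      refine ⟨T[c][r]'(by omega), List.getElem?_eq_getElem _, ?_⟩
      rw [bumps_iff_degree]
      exact ⟨h2.row_weak _ _ _ _ _ (Nat.lt_succ_self c) e1 e2,
        h2.row_strict _ _ _ _ _ (Nat.lt_succ_self c) e1 e2⟩
  · rintro ⟨h1, h2⟩
    have hent : ∀ r c a, Filling.entry T r c = some a →
        ∃ hc : c < T.length, T[c][r]? = some a := by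
      intro r c a h
      unfold Filling.entry at h
      obtain ⟨C, hC, h⟩ := Option.bind_eq_some_iff.1 h
      obtain ⟨hc, rfl⟩ := List.getElem?_eq_some_iff.1 hC
      exact ⟨hc, h⟩
    have hrow : ∀ r c c' a b, c < c' → Filling.entry T r c = some a →
        Filling.entry T r c' = some b → Bumps m n a b := by
      intro r c c' a b hcc ha hb
      obtain ⟨hc, ha⟩ := hent _ _ _ ha
      obtain ⟨hc', hb⟩ := hent _ _ _ hb
      have : IsTrans (List (Letter m n)) Fits := ⟨fun _ _ _ => Fits.trans⟩
      have h3 := List.pairwise_iff_getElem.1 h1.fits.pairwise c c' hc hc' hcc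
      obtain ⟨x, hx, h4⟩ := fits_iff_getElem.1 h3 r b hb
      rw [ha] at hx
      exact Option.some.inj hx ▸ h4
    have hcol : ∀ r r' c a b, r < r' → Filling.entry T r c = some a →
        Filling.entry T r' c = some b → ¬ Bumps m n b a := by
      intro r r' c a b hrr ha hb
      obtain ⟨hc, ha⟩ := hent _ _ _ ha
      obtain ⟨_, hb⟩ := hent _ _ _ hb
      obtain ⟨hr, rfl⟩ := List.getElem?_eq_some_iff.1 ha
      obtain ⟨hr', rfl⟩ := List.getElem?_eq_some_iff.1 hb
      exact List.pairwise_iff_getElem.1 (h1.col T[c] (List.getElem_mem _)) r r' hr hr' hrr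
    refine ⟨by unfold HasShape; rw [h2, hsh], ⟨?_, ?_, ?_, ?_⟩⟩
    · intro r c c' a b h ha hb
      exact ((bumps_iff_degree _ _).1 (hrow r c c' a b h ha hb)).1
    · intro r r' c a b h ha hb
      exact ((not_bumps_iff_degree _ _).1 (hcol r r' c a b h ha hb)).1
    · intro r c c' a b h ha hb
      exact ((bumps_iff_degree _ _).1 (hrow r c c' a b h ha hb)).2
    · intro r r' c a b h ha hb
      exact ((not_bumps_iff_degree _ _).1 (hcol r r' c a b h ha hb)).2

theorem cum_le {C : List (Letter m n)} (hC : IsCol C) {t : ℕ} (ht : t ≤ m) : cum C t ≤ t := by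
  induction t with
  | zero => simp [cum_zero]
  | succ t ih =>
    have h1 := cum_succ C ⟨t, by omega⟩
    have h2 := hC.eq_sortedWord.2 ⟨t, by omega⟩ (by simp [degree]; omega)
    have h3 := ih (by omega)
    dsimp only at h1 h2
    omega

/-- The columns of a tableau of hook shape. -/
theorem IsTableau.cum_le_of_le {T : Filling m n} (hT : IsTableau T) {c s : ℕ} (hc : c < T.length)
    (hs : s ≤ c) (hsn : s ≤ n) : cum T[c] (m + s) ≤ m := by
  induction s generalizing c with
  | zero => exact cum_le (hT.col _ (List.getElem_mem _)) le_rfl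
  | succ s ih =>
    obtain ⟨c, rfl⟩ : ∃ c', c = c' + 1 := ⟨c - 1, by omega⟩
    have h1 := List.isChain_iff_getElem.1 hT.fits c hc
    rw [fits_iff (hT.col _ (List.getElem_mem _)) (hT.col _ (List.getElem_mem _))] at h1
    have h2 := h1 (m + s) (by omega)
    rw [if_neg (by omega)] at h2
    exact h2.trans (ih (by omega) (by omega) (by omega))

/-- Column lengths decrease by `Fits.length_le`. An unbarred letter occurs at most once in a row, so
only the first `n` columns can be longer than `m`, which is the hook condition. -/
theorem IsTableau.exists_shape {T : Filling m n} (hT : IsTableau T) :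
    ∃ μ : YoungDiagram, IsHook m n μ ∧ T ∈ tableaux m n μ := by
  have : IsTrans (List (Letter m n)) Fits := ⟨fun _ _ _ => Fits.trans⟩
  have h1 : (T.map List.length).SortedGE := by
    refine List.Pairwise.sortedGE ?_
    rw [List.pairwise_map]
    exact hT.fits.pairwise.imp fun h => h.length_le
  have h2 : ∀ x ∈ T.map List.length, 0 < x := by
    intro x hx
    obtain ⟨C, hC, rfl⟩ := List.mem_map.1 hx
    exact List.length_pos_iff.2 (hT.ne_nil C hC)
  refine ⟨(YoungDiagram.ofRowLens _ h1).transpose, ?_, ?_⟩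
  · unfold IsHook
    rw [YoungDiagram.rowLen_transpose]
    by_contra h3
    push Not at h3
    have h4 : (n, m) ∈ YoungDiagram.ofRowLens _ h1 := YoungDiagram.mem_iff_lt_colLen.2 h3
    rw [YoungDiagram.mem_ofRowLens] at h4
    obtain ⟨h5, h6⟩ := h4
    simp only [List.length_map] at h5
    simp only [List.getElem_map] at h6
    -- Taken for column `n` and all `n` unbarred letters, so the count is the full length of that
    -- column.
    have := hT.cum_le_of_le h5 le_rfl le_rfl
    rw [cum_top _ le_rfl] at this
    omega
  · rw [mem_tableaux_iff, YoungDiagram.transpose_transpose,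
      YoungDiagram.rowLens_ofRowLens_eq_self h2]
    exact ⟨hT, rfl⟩

end HookCrystal

namespace HookCrystal
variable {m n : ℕ}

/-! ### Patterns -/

/-- The condition on two consecutive levels of a pattern. -/
structure IsStrip (m t : ℕ) (μ l : ℕ → ℕ) : Prop where
  le : ∀ c, μ c ≤ l c
  even_le : t < m → ∀ c, l c ≤ μ c + 1
  even_anti : t < m → ∀ c, l (c + 1) ≤ l c
  odd_le : m ≤ t → ∀ c, l (c + 1) ≤ μ c

/-- Gelfand-Tsetlin patterns: `N t c` is the number of letters below `t` in column `c`. -/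
structure IsPattern (m n k : ℕ) (N : ℕ → ℕ → ℕ) : Prop where
  zero : ∀ c, N 0 c = 0
  strip : ∀ t, t < m + n → IsStrip m t (N t) (N (t + 1))
  supp : ∀ c, k ≤ c → N (m + n) c = 0

/-- A column of the tableau of a pattern. -/
def patCol (m n : ℕ) (N : ℕ → ℕ → ℕ) (c : ℕ) : List (Letter m n) :=
  sortedWord 1 fun b => N (b.1 + 1) c - N b.1 c

/-- The columns `a, …, a + k - 1` of the tableau of a pattern. -/
def patTab (m n : ℕ) (N : ℕ → ℕ → ℕ) (a k : ℕ) : Filling m n :=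
  (List.range' a k).map (patCol m n N)

/-- The pattern of a tableau. -/
def tabPat (T : Filling m n) (t c : ℕ) : ℕ := cum (T.getD c []) t

namespace IsPattern

variable {k : ℕ} {N : ℕ → ℕ → ℕ}

theorem anti (h : IsPattern m n k N) {t : ℕ} (ht : t ≤ m + n) (c : ℕ) : N t (c + 1) ≤ N t c := by
  cases t with
  | zero => simp [h.zero]
  | succ t =>
    have h1 := h.strip t (by omega)
    by_cases htm : t < m
    · exact h1.even_anti htm c
    · exact (h1.odd_le (by omega) c).trans (h1.le c)

theorem anti_le (h : IsPattern m n k N) {t : ℕ} (ht : t ≤ m + n) {c c' : ℕ} (hc : c ≤ c') :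
    N t c' ≤ N t c := by
  induction c', hc using Nat.le_induction with
  | base => exact le_rfl
  | succ c' _ ih => exact (h.anti ht c').trans ih

theorem mono (h : IsPattern m n k N) {s t : ℕ} (hst : s ≤ t) (ht : t ≤ m + n) (c : ℕ) :
    N s c ≤ N t c := by
  induction t, hst using Nat.le_induction with
  | base => exact le_rfl
  | succ t _ ih => exact (ih (by omega)).trans ((h.strip t (by omega)).le c)

theorem eq_zero (h : IsPattern m n k N) {t : ℕ} (ht : t ≤ m + n) {c : ℕ} (hc : k ≤ c) :
    N t c = 0 := by
  have := h.mono ht le_rfl c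
  rw [h.supp c hc] at this
  omega

theorem le_level (h : IsPattern m n k N) {t : ℕ} (ht : t ≤ m) (c : ℕ) : N t c ≤ t := by
  induction t with
  | zero => simp [h.zero]
  | succ t ih => exact ((h.strip t (by omega)).even_le (by omega) c).trans (by
      have := ih (by omega); omega)

/-- Each unbarred letter costs one column: after `s` of them only the columns before `s` can exceed
length `m`. -/
theorem le_hook (h : IsPattern m n k N) {s : ℕ} (hs : s ≤ n) {c : ℕ} (hc : s ≤ c) :
    N (m + s) c ≤ m := by
  induction s generalizing c with
  | zero => exact h.le_level le_rfl c
  | succ s ih =>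
    obtain ⟨c, rfl⟩ : ∃ c', c = c' + 1 := ⟨c - 1, by omega⟩
    exact ((h.strip (m + s) (by omega)).odd_le (by omega) c).trans (ih (by omega) (by omega))

theorem admissible (h : IsPattern m n k N) (c : ℕ) :
    Admissible 1 (fun b : Letter m n => N (b.1 + 1) c - N b.1 c) := by
  intro b hb
  have hb' : b.1 < m := by
    unfold degree at hb; split_ifs at hb with h1
    · exact h1
    · simp at hb
  have := (h.strip b.1 b.2).even_le hb' c
  dsimp only
  omega

theorem cum_patCol (h : IsPattern m n k N) (c : ℕ) {t : ℕ} (ht : t ≤ m + n) :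
    cum (patCol m n N c) t = N t c := by
  induction t with
  | zero => rw [cum_zero, h.zero]
  | succ t ih =>
    have h1 := cum_succ (patCol m n N c) ⟨t, by omega⟩
    have h2 := (h.strip t (by omega)).le c
    dsimp only at h1
    rw [h1, ih (by omega), patCol, count_sortedWord]
    dsimp only
    omega

theorem isCol (h : IsPattern m n k N) (c : ℕ) : IsCol (patCol m n N c) :=
  isCol_sortedWord (h.admissible c)

theorem length_patCol (h : IsPattern m n k N) (c : ℕ) :
    (patCol m n N c).length = N (m + n) c := by
  rw [← cum_top _ le_rfl, h.cum_patCol c le_rfl]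

theorem isTableau (h : IsPattern m n k N) (a : ℕ) (hk : ∀ c < k, N (m + n) c ≠ 0) :
    IsTableau (patTab m n N a (k - a)) := by
  refine ⟨?_, ?_, ?_⟩
  · intro C hC
    obtain ⟨c, -, rfl⟩ := List.mem_map.1 hC
    exact h.isCol c
  · intro C hC h0
    obtain ⟨c, hc, rfl⟩ := List.mem_map.1 hC
    have h1 := h.length_patCol c
    rw [List.mem_range'_1] at hc
    rw [h0] at h1
    exact hk c (by omega) h1.symm
  · rw [List.isChain_iff_getElem]
    intro c hc
    simp only [patTab, List.getElem_map, List.getElem_range', one_mul]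
    rw [fits_iff (h.isCol _) (h.isCol _)]
    intro t ht
    have h1 := h.strip t ht
    rw [h.cum_patCol _ (by omega), h.cum_patCol _ (by omega), h.cum_patCol _ (by omega)]
    split_ifs with htm
    · exact h1.even_anti htm _
    · exact h1.odd_le (by omega) _

end IsPattern

theorem patCol_congr {N N' : ℕ → ℕ → ℕ} {c : ℕ} (h : ∀ t ≤ m + n, N t c = N' t c) :
    patCol m n N c = patCol m n N' c := by
  unfold patCol
  congr 1
  ext b
  have := b.2
  rw [h _ (by omega), h _ (by omega)]

theorem patTab_congr {N N' : ℕ → ℕ → ℕ} {a k : ℕ} (h : ∀ t ≤ m + n, ∀ c, N t c = N' t c) :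
    patTab m n N a k = patTab m n N' a k := by
  unfold patTab
  exact List.map_congr_left fun c _ => patCol_congr fun t ht => h t ht c

/-- The letters added at one level form a horizontal strip if they are barred and a vertical strip
if they are unbarred. -/
theorem IsTableau.isPattern {T : Filling m n} (hT : IsTableau T) :
    IsPattern m n T.length (tabPat T) := by
  have hcol : ∀ c, IsCol (T.getD c []) := by
    intro c
    rw [List.getD_eq_getElem?_getD]
    by_cases hc : c < T.length
    · rw [List.getElem?_eq_getElem hc]; exact hT.col _ (List.getElem_mem _)
    · rw [List.getElem?_eq_none (by omega)]; exact List.Pairwise.nil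
  have hfit : ∀ c, Fits (T.getD c []) (T.getD (c + 1) []) := by
    intro c
    rw [List.getD_eq_getElem?_getD, List.getD_eq_getElem?_getD]
    by_cases hc : c + 1 < T.length
    · rw [List.getElem?_eq_getElem hc, List.getElem?_eq_getElem (by omega : c < T.length)]
      exact List.isChain_iff_getElem.1 hT.fits c hc
    · rw [List.getElem?_eq_none (by omega : T.length ≤ c + 1)]
      cases (T[c]?.getD []) <;> trivial
  have hcf : ∀ c, CumFits m n (cum (T.getD c [])) (cum (T.getD (c + 1) [])) := fun c =>
    (fits_iff (hcol _) (hcol _)).1 (hfit c)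
  refine ⟨fun c => cum_zero _, fun t ht => ⟨?_, ?_, ?_, ?_⟩, ?_⟩
  · intro c
    exact cum_mono _ (Nat.le_succ t)
  · intro htm c
    have h1 := cum_succ (T.getD c []) ⟨t, ht⟩
    have h2 := (hcol c).eq_sortedWord.2 ⟨t, ht⟩ (by simp [degree, htm])
    dsimp only at h1 h2
    unfold tabPat
    omega
  · intro htm c
    have := hcf c t ht
    rwa [if_pos htm] at this
  · intro htm c
    have := hcf c t ht
    rwa [if_neg (by omega)] at this
  · intro c hc
    unfold tabPat
    rw [List.getD_eq_getElem?_getD, List.getElem?_eq_none hc]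
    simp [cum]

theorem IsTableau.eq_patTab {T : Filling m n} (hT : IsTableau T) :
    T = patTab m n (tabPat T) 0 T.length := by
  refine List.ext_getElem (by simp [patTab]) fun c hc hc' => ?_
  simp only [patTab, List.getElem_map, List.getElem_range', one_mul, zero_add]
  rw [(hT.col _ (List.getElem_mem hc)).eq_sortedWord.1, patCol]
  congr 1
  ext b
  have h1 := cum_succ T[c] b
  have h2 : T.getD c [] = T[c] := by simp [List.getD_eq_getElem?_getD, hc]
  unfold tabPat
  rw [h2]
  omega

/-! ### One step of the crystal in terms of patterns -/

/-- The signature of the columns `a + len - 1, …, a`, in this order. -/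
def segSig (k : Kind) (s : ℕ → ℕ × ℕ) : ℕ → ℕ → ℕ × ℕ
  | _, 0 => (0, 0)
  | a, len + 1 => sigMul k (segSig k s (a + 1) len) (s a)

theorem segSig_succ' (k : Kind) (s : ℕ → ℕ × ℕ) (a len : ℕ) :
    segSig k s a (len + 1) = sigMul k (s (a + len)) (segSig k s a len) := by
  induction len generalizing a with
  | zero => simp [segSig]
  | succ len ih =>
    rw [segSig, ih (a + 1), sigMul_assoc, ← segSig]
    congr 2
    omega

theorem segSig_snd_eq_zero {k : Kind} {s : ℕ → ℕ × ℕ} {a len : ℕ}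
    (h : ∀ c, a ≤ c → c < a + len → (s c).2 = 0) : (segSig k s a len).2 = 0 := by
  induction len generalizing a with
  | zero => rfl
  | succ len ih =>
    rw [segSig, sigMul_snd_eq_zero]
    rw [ih fun c h1 h2 => h c (by omega) (by omega), h a le_rfl (by omega)]
    simp

theorem segSig_fst_eq_zero {k : Kind} {s : ℕ → ℕ × ℕ} {a len : ℕ}
    (h : ∀ c, a ≤ c → c < a + len → (s c).1 = 0) : (segSig k s a len).1 = 0 := by
  induction len generalizing a with
  | zero => rfl
  | succ len ih =>
    rw [segSig, sigMul_fst_eq_zero]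
    rw [ih fun c h1 h2 => h c (by omega) (by omega), h a le_rfl (by omega)]
    simp

/-- The signature of a column of a pattern. -/
def patSig (i : Idx m n) (N : ℕ → ℕ → ℕ) (c : ℕ) : ℕ × ℕ :=
  blockSig (kind i) 1 (N (i.1 + 1) c - N i.1 c) (N (i.1 + 2) c - N (i.1 + 1) c)

theorem wordSig_patTab (i : Idx m n) (N : ℕ → ℕ → ℕ) (a len : ℕ) :
    wordSig i (patTab m n N a len).reading = segSig (kind i) (patSig i N) a len := by
  induction len generalizing a with
  | zero => rfl
  | succ len ih =>
    have : patTab m n N a (len + 1) = patCol m n N a :: patTab m n N (a + 1) len := by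
      simp [patTab, List.range'_succ]
    rw [this, reading_cons, wordSig_append, ih, segSig, patCol, wordSig_sortedWord]
    rfl

theorem reading_append (S T : Filling m n) :
    Filling.reading (S ++ T) = Filling.reading T ++ Filling.reading S := by
  simp [Filling.reading]

theorem reading_patTab_split (N : ℕ → ℕ → ℕ) {k L : ℕ} (hL : L < k) :
    (patTab m n N 0 k).reading = (patTab m n N (L + 1) (k - L - 1)).reading ++
      (patCol m n N L ++ (patTab m n N 0 L).reading) := by
  have h1 : patTab m n N 0 k =
      patTab m n N 0 L ++ (patCol m n N L :: patTab m n N (L + 1) (k - L - 1)) := by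
    unfold patTab
    rw [← List.map_cons, ← List.map_append]
    congr 1
    rw [← List.range'_succ, show k - L - 1 + 1 = k - L by omega]
    have := List.range'_append (s := 0) (m := L) (n := k - L) (step := 1)
    simp only [one_mul, zero_add] at this
    rw [this]
    congr 1
    omega
  rw [h1, reading_append, reading_cons, List.append_assoc]

/-- `e_i` acts on the column `L` of a pattern. -/
theorem wordE_patTab {k : ℕ} {N N' : ℕ → ℕ → ℕ} (hN : IsPattern m n k N) {i : Idx m n} {L : ℕ}
    (hL : L < k) (hN' : ∀ t ≤ m + n, ∀ c, N' t c = N t c + if t = i.1 + 1 ∧ c = L then 1 else 0)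
    (h0 : 0 < (patSig i N L).1)
    (h1 : SigE (kind i) (patSig i N L) (segSig (kind i) (patSig i N) 0 L))
    (h2 : ¬ SigE (kind i) (segSig (kind i) (patSig i N) (L + 1) (k - L - 1))
      (sigMul (kind i) (patSig i N L) (segSig (kind i) (patSig i N) 0 L))) :
    wordE m n i (patTab m n N 0 k).reading = some (patTab m n N' 0 k).reading := by
  have hi := i.2
  have hL1 : ∀ c, c ≠ L → patCol m n N' c = patCol m n N c := by
    intro c hc
    exact patCol_congr fun t ht => by rw [hN' t ht, if_neg (by simp [hc]), add_zero]
  have hL2 : wordE m n i (patCol m n N L) = some (patCol m n N' L) := by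
    obtain ⟨g1, g2, -⟩ := wordE_sortedWord (i := i) le_rfl (hN.admissible L) h0
    rw [patCol, g1, patCol]
    congr 2
    ext b
    have hb := b.2
    have hs : (src i).1 = i.1 := rfl
    have ht : (tgt i).1 = i.1 + 1 := rfl
    have e1 := (hN.strip i.1 (by omega)).le L
    unfold raise
    rw [hN' _ (by omega), hN' _ (by omega)]
    rw [ht] at g2
    split_ifs with a1 a2 a3 a4 <;> simp only [Fin.ext_iff, hs, ht] at * <;> grind
  have hS : wordSig i (patCol m n N L) = patSig i N L := by
    rw [patCol, wordSig_sortedWord]; rfl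
  have hT1 : patTab m n N' (L + 1) (k - L - 1) = patTab m n N (L + 1) (k - L - 1) := by
    refine List.map_congr_left fun c hc => hL1 c ?_
    rw [List.mem_range'_1] at hc; omega
  have hT2 : patTab m n N' 0 L = patTab m n N 0 L := by
    refine List.map_congr_left fun c hc => hL1 c ?_
    rw [List.mem_range'_1] at hc; omega
  rw [reading_patTab_split N hL, reading_patTab_split N' hL, hT1, hT2, wordE_append,
    wordSig_append, wordSig_patTab, wordSig_patTab, hS, if_neg h2, wordE_append, hS,
    wordSig_patTab, if_pos h1, hL2]
  rfl

end HookCrystal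

namespace HookCrystal
variable {m n : ℕ}

/-! ### Connectedness of the crystal of tableaux -/

/-- Two words are in the same connected component of the crystal of words. -/
def WordConn (w w' : List (Letter m n)) : Prop :=
  Relation.EqvGen (fun w w' => ∃ i, wordF m n i w = some w') w w'

/-- The pattern with the largest entries and the level `l` above it. -/
def hookPat (m : ℕ) (l : ℕ → ℕ) (s c : ℕ) : ℕ :=
  if s ≤ m then min (l c) s else if c < s - m then l c else min (l c) m

theorem isStrip_hookPat {l : ℕ → ℕ} (hl : ∀ c, l (c + 1) ≤ l c) (s : ℕ) :
    IsStrip m s (hookPat m l s) (hookPat m l (s + 1)) := by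
  refine ⟨fun c => ?_, fun h c => ?_, fun h c => ?_, fun h c => ?_⟩ <;>
    have := hl c <;> unfold hookPat <;> split_ifs <;> omega

/-- The pattern with maximal entries below the level `t - 1`, the level `ν` there, the level `μ` at
`t`, and the levels of `N` above it. -/
def buildPat (m t : ℕ) (ν μ : ℕ → ℕ) (N : ℕ → ℕ → ℕ) (s c : ℕ) : ℕ :=
  if s < t then hookPat m ν s c else if s = t then μ c else N s c

theorem isPattern_build {k t : ℕ} {ν μ : ℕ → ℕ} {N : ℕ → ℕ → ℕ} (hN : IsPattern m n k N)
    (ht : 0 < t) (htn : t < m + n) (hν : ∀ c, ν (c + 1) ≤ ν c)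
    (hνh : ∀ c, hookPat m ν (t - 1) c = ν c) (h1 : IsStrip m (t - 1) ν μ)
    (h2 : IsStrip m t μ (N (t + 1))) : IsPattern m n k (buildPat m t ν μ N) := by
  have e1 : ∀ s, s < t → buildPat m t ν μ N s = hookPat m ν s := by
    intro s hs; ext c; simp [buildPat, hs]
  have e2 : buildPat m t ν μ N t = μ := by
    ext c; simp [buildPat]
  have e3 : ∀ s, t < s → buildPat m t ν μ N s = N s := by
    intro s hs; ext c; simp [buildPat, hs.ne', hs.not_gt]
  refine ⟨fun c => ?_, fun s hs => ?_, fun c hc => ?_⟩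
  · rw [e1 0 ht]; simp [hookPat]
  · rcases lt_trichotomy (s + 1) t with h | h | h
    · rw [e1 s (by omega), e1 _ h]
      exact isStrip_hookPat hν s
    · rw [e1 s (by omega), h, e2]
      have : hookPat m ν s = ν := by
        ext c
        have := hνh c
        rwa [show t - 1 = s by omega] at this
      rw [this]
      obtain rfl : s = t - 1 := by omega
      exact h1
    · rw [e3 _ h]
      by_cases hst : s = t
      · rw [hst, e2]; exact h2
      · rw [e3 s (by omega)]; exact hN.strip s hs
  · rw [e3 _ htn]; exact hN.supp c hc

/-- Patterns that agree from the level `t` on are connected. -/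
def ConnLevel (m n k t : ℕ) : Prop := ∀ N N' : ℕ → ℕ → ℕ, IsPattern m n k N → IsPattern m n k N' →
  (∀ s, t ≤ s → s ≤ m + n → ∀ c, N s c = N' s c) →
  WordConn (patTab m n N 0 k).reading (patTab m n N' 0 k).reading

/-- One more box in the column `L`. -/
def addBox (μ : ℕ → ℕ) (L c : ℕ) : ℕ := μ c + if c = L then 1 else 0

/-- One more box at level `t` in column `L`, all other levels being fixed, is one application of e
with the colour `t - 1`; it changes a letter `t` of that column into `t - 1`. -/
theorem wordConn_build {k t : ℕ} {ν μ : ℕ → ℕ} {N : ℕ → ℕ → ℕ} (i : Idx m n) (hi : i.1 + 1 = t)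
    (hP : IsPattern m n k (buildPat m t ν μ N)) (hνh : ∀ c, hookPat m ν (t - 1) c = ν c)
    {L : ℕ} (hL : L < k) {s : ℕ → ℕ × ℕ}
    (hs : ∀ c, s c = blockSig (kind i) 1 (μ c - ν c) (N (t + 1) c - μ c))
    (h0 : 0 < (s L).1)
    (h1 : SigE (kind i) (s L) (segSig (kind i) s 0 L))
    (h2 : ¬ SigE (kind i) (segSig (kind i) s (L + 1) (k - L - 1))
      (sigMul (kind i) (s L) (segSig (kind i) s 0 L))) :
    WordConn (patTab m n (buildPat m t ν μ N) 0 k).reading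
      (patTab m n (buildPat m t ν (addBox μ L) N) 0 k).reading := by
  have hs' : patSig i (buildPat m t ν μ N) = s := by
    ext1 c
    rw [hs, patSig]
    have e1 : buildPat m t ν μ N (i.1 + 2) c = N (t + 1) c := by
      simp [buildPat, ← hi]
    have e2 : buildPat m t ν μ N (i.1 + 1) c = μ c := by
      simp [buildPat, ← hi]
    have e3 : buildPat m t ν μ N i.1 c = ν c := by
      have := hνh c
      rw [show t - 1 = i.1 by omega] at this
      rw [buildPat, if_pos (by omega), this]
    rw [e1, e2, e3]
  refine Relation.EqvGen.symm _ _ (Relation.EqvGen.rel _ _ ⟨i, ?_⟩)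
  rw [wordF_iff_wordE]
  refine wordE_patTab hP hL ?_ (by rwa [hs']) (by rwa [hs']) (by rwa [hs'])
  intro r hr c
  unfold buildPat addBox
  split_ifs <;> omega

theorem exists_least {p : ℕ → Prop} (h : ∃ c, p c) : ∃ c, p c ∧ ∀ c' < c, ¬ p c' := by
  classical exact ⟨Nat.find h, Nat.find_spec h, fun c' hc' => Nat.find_min h hc'⟩

/-- The levels below `t` are first replaced, by `hS`, with ones that leave as few letters `t - 1` as
possible; then e of the colour `t - 1` acts on the leftmost column that is not yet full. -/
theorem stepAt_even {k t : ℕ} (hS : ConnLevel m n k t) (ht : 0 < t) (htm : t < m)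
    {N : ℕ → ℕ → ℕ} (hN : IsPattern m n k N) (hne : ∃ c, N t c < hookPat m (N (t + 1)) t c) :
    ∃ N' L, IsPattern m n k N' ∧
      WordConn (patTab m n N 0 k).reading (patTab m n N' 0 k).reading ∧
      (∀ s, t < s → s ≤ m + n → ∀ c, N' s c = N s c) ∧ L < k ∧
      N t L < hookPat m (N (t + 1)) t L ∧ ∀ c, N' t c = addBox (N t) L c := by
  obtain ⟨L, hL, hmin⟩ := exists_least hne
  have hH : ∀ c, hookPat m (N (t + 1)) t c = min (N (t + 1) c) t := by
    intro c; unfold hookPat; rw [if_pos htm.le]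
  simp only [hH] at hL hmin
  have hst := hN.strip t (by omega)
  have hle := hN.le_level htm.le
  have hanti := hN.anti (t := t) (by omega)
  have hlam := hN.anti (t := t + 1) (by omega)
  have hantiL : ∀ c, L < c → N t c ≤ N t L := fun c hc => hN.anti_le (by omega) hc.le
  -- The largest level possible below `N t`: a letter `t - 1` remains only in columns of length `t`,
  -- where it is forced.
  set ν : ℕ → ℕ := fun c => min (N t c) (t - 1) with hνdef
  have hνa : ∀ c, ν (c + 1) ≤ ν c := by
    intro c; have := hanti c; simp only [hνdef]; omega
  have hνh : ∀ c, hookPat m ν (t - 1) c = ν c := by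
    intro c; unfold hookPat; rw [if_pos (by omega)]; simp only [hνdef]; omega
  have s1 : IsStrip m (t - 1) ν (N t) := by
    refine ⟨fun c => ?_, fun _ c => ?_, fun _ c => hanti c, fun h => by omega⟩ <;>
      have := hle c <;> simp only [hνdef] <;> omega
  have s1' : IsStrip m (t - 1) ν (addBox (N t) L) := by
    refine ⟨fun c => ?_, fun _ c => ?_, fun _ c => ?_, fun h => by omega⟩
    · have := s1.le c; unfold addBox; omega
    · have := s1.even_le (by omega) c
      unfold addBox; split_ifs with hc
      · subst hc; simp only [hνdef]; omega
      · omega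
    · have h1 := hanti c
      unfold addBox
      by_cases hc : c + 1 = L
      · have h2 := hmin c (by omega)
        have h3 := hlam c
        have h4 := hst.le c
        subst hc
        rw [if_pos rfl, if_neg (by omega)]; omega
      · rw [if_neg hc]; omega
  have s2' : IsStrip m t (addBox (N t) L) (N (t + 1)) := by
    refine ⟨fun c => ?_, fun _ c => ?_, fun _ => hlam, fun h => by omega⟩
    · have := hst.le c
      unfold addBox; split_ifs with hc
      · subst hc; omega
      · omega
    · have := hst.even_le htm c
      unfold addBox; omega
  have P1 := isPattern_build hN ht (by omega) hνa hνh s1 hst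
  have P2 := isPattern_build hN ht (by omega) hνa hνh s1' s2'
  have hLk : L < k := by
    by_contra h
    have := hN.eq_zero (t := t + 1) (by omega) (c := L) (by omega)
    omega
  refine ⟨_, L, P2, ?_, ?_, hLk, by rw [hH]; exact hL, ?_⟩
  · refine Relation.EqvGen.trans _ _ _ (hS N _ hN P1 ?_) ?_
    · intro s hs _ c
      unfold buildPat
      rw [if_neg (by omega)]
      split_ifs with h
      · rw [h]
      · rfl
    · have hk : kind (⟨t - 1, by omega⟩ : Idx m n) = .even := by
        unfold kind; rw [if_pos (by dsimp only; omega)]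
      have hsig : ∀ c, blockSig .even 1 (N t c - ν c) (N (t + 1) c - N t c) =
          ((N (t + 1) c - N t c) - (N t c - ν c), (N t c - ν c) - (N (t + 1) c - N t c)) := by
        intro c; simp [blockSig, sigMul, powSig]
      refine wordConn_build (⟨t - 1, by omega⟩ : Idx m n) (by dsimp only; omega) P1 hνh hLk
        (fun c => rfl) ?_ ?_ ?_ <;> rw [hk]
      · rw [hsig]; simp only [hνdef]; have := hst.le L; omega
      -- A column left of `L` either has no letter `t`, or has length `t` at this level and its
      -- forced letter `t - 1` cancels the letter `t`.
      · have hz := segSig_fst_eq_zero (k := .even)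
          (s := fun c => blockSig .even 1 (N t c - ν c) (N (t + 1) c - N t c)) (a := 0) (len := L)
          (fun c _ hc => by
            have h1 := hmin c (by omega)
            have h2 := hst.le c
            have h3 := hst.even_le htm c
            rw [hsig]; simp only [hνdef]; omega)
        simp only [SigE]
        omega
      -- Columns right of `L` have length below `t` at this level, so they contain no letter `t -
      -- 1`.
      · have hz := segSig_snd_eq_zero (k := .even)
          (s := fun c => blockSig .even 1 (N t c - ν c) (N (t + 1) c - N t c)) (a := L + 1)
          (len := k - L - 1)
          (fun c hc _ => by
            have h1 := hantiL c (by omega)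
            have h2 := hst.le c
            rw [hsig]; simp only [hνdef]; omega)
        simp only [SigE, sigMul]
        rw [hz, hsig]
        have := hst.le L
        simp only [hνdef]; omega
  · intro s hs _ c
    unfold buildPat
    rw [if_neg (by omega), if_neg (by omega)]
  · intro c; simp [buildPat]

/-- The odd operator acts on the first column, in reading order, that contains either letter. So the
box is added to the rightmost column that contains the letter `m`, and nothing is required of the
columns to its left. -/
theorem stepAt_mixed {k : ℕ} (hS : ConnLevel m n k m) (hm : 0 < m) (hn : 0 < n)
    {N : ℕ → ℕ → ℕ} (hN : IsPattern m n k N) (hne : ∃ c, N m c < hookPat m (N (m + 1)) m c) :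
    ∃ N' L, IsPattern m n k N' ∧
      WordConn (patTab m n N 0 k).reading (patTab m n N' 0 k).reading ∧
      (∀ s, m < s → s ≤ m + n → ∀ c, N' s c = N s c) ∧ L < k ∧
      N m L < hookPat m (N (m + 1)) m L ∧ ∀ c, N' m c = addBox (N m) L c := by
  classical
  obtain ⟨c₀, hc₀⟩ := hne
  have hH : ∀ c, hookPat m (N (m + 1)) m c = min (N (m + 1) c) m := by
    intro c; unfold hookPat; rw [if_pos le_rfl]
  simp only [hH] at hc₀
  have hst := hN.strip m (by omega)
  have hbound : ∀ c, N m c < N (m + 1) c → c < k := by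
    intro c hc
    by_contra h
    have := hN.eq_zero (t := m + 1) (by omega) (c := c) (by omega)
    omega
  -- This column lies at or to the right of `c₀`, so it and all later columns have length below `m`
  -- at this level, and no letter `m - 1` is forced in them.
  set L := Nat.findGreatest (fun c => N m c < N (m + 1) c) k with hLdef
  have hLs : N m L < N (m + 1) L :=
    Nat.findGreatest_spec (P := fun c => N m c < N (m + 1) c) (hbound c₀ (by omega)).le (by omega)
  have hmax : ∀ c, L < c → ¬ N m c < N (m + 1) c := fun c hc h =>
    Nat.findGreatest_is_greatest hc (hbound c h).le h
  have hcL : c₀ ≤ L := by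
    by_contra h
    exact hmax c₀ (by omega) (by omega)
  have hLk := hbound L hLs
  have hantiL : ∀ c, L ≤ c → N m c < m := fun c hc => by
    have := hN.anti_le (t := m) (by omega) (hcL.trans hc); omega
  have hle := hN.le_level le_rfl
  have hanti := hN.anti (t := m) (by omega)
  set ν : ℕ → ℕ := fun c => min (N m c) (m - 1) with hνdef
  have hνa : ∀ c, ν (c + 1) ≤ ν c := by
    intro c; have := hanti c; simp only [hνdef]; omega
  have hνh : ∀ c, hookPat m ν (m - 1) c = ν c := by
    intro c; unfold hookPat; rw [if_pos (by omega)]; simp only [hνdef]; omega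
  have s1 : IsStrip m (m - 1) ν (N m) := by
    refine ⟨fun c => ?_, fun _ c => ?_, fun _ c => hanti c, fun h => by omega⟩ <;>
      have := hle c <;> simp only [hνdef] <;> omega
  have hLm := hantiL L le_rfl
  have s1' : IsStrip m (m - 1) ν (addBox (N m) L) := by
    refine ⟨fun c => ?_, fun _ c => ?_, fun _ c => ?_, fun h => by omega⟩
    · have := s1.le c; unfold addBox; omega
    · have := s1.even_le (by omega) c
      unfold addBox; split_ifs with hc
      · subst hc; simp only [hνdef]; omega
      · omega
    · have h1 := hanti c
      unfold addBox
      -- The new box still leaves decreasing lengths: the vertical strip above gives `N m L < N (m +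
      -- 1) L ≤ N m c`.
      by_cases hc : c + 1 = L
      · have h2 := hst.odd_le le_rfl c
        have h3 : N (m + 1) (c + 1) = N (m + 1) L := by rw [hc]
        have h4 : N m (c + 1) = N m L := by rw [hc]
        rw [if_pos hc, if_neg (by omega)]; omega
      · rw [if_neg hc]; omega
  have s2' : IsStrip m m (addBox (N m) L) (N (m + 1)) := by
    refine ⟨fun c => ?_, fun h => by omega, fun h => by omega, fun _ c => ?_⟩
    · have := hst.le c
      unfold addBox; split_ifs with hc
      · subst hc; omega
      · omega
    · have := hst.odd_le le_rfl c
      unfold addBox; omega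
  have P1 := isPattern_build hN hm (by omega) hνa hνh s1 hst
  have P2 := isPattern_build hN hm (by omega) hνa hνh s1' s2'
  refine ⟨_, L, P2, ?_, ?_, hLk, by rw [hH]; omega, ?_⟩
  · refine Relation.EqvGen.trans _ _ _ (hS N _ hN P1 ?_) ?_
    · intro s hs _ c
      unfold buildPat
      rw [if_neg (by omega)]
      split_ifs with h
      · rw [h]
      · rfl
    · have hk : kind (⟨m - 1, by omega⟩ : Idx m n) = .mixed := by
        unfold kind; rw [if_neg (by dsimp only; omega), if_pos (by dsimp only; omega)]
      have hz : ∀ c, L ≤ c → blockSig .mixed 1 (N m c - ν c) (N (m + 1) c - N m c) =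
          (min (N (m + 1) c - N m c) 1, 0) := by
        intro c hc
        have h1 := hantiL c hc
        have : N m c - ν c = 0 := by simp only [hνdef]; omega
        rw [this]; simp [blockSig, sigMul, powSig]
      refine wordConn_build (⟨m - 1, by omega⟩ : Idx m n) (by dsimp only; omega) P1 hνh hLk
        (fun c => rfl) ?_ ?_ ?_ <;> rw [hk]
      · rw [hz L le_rfl]; dsimp only; omega
      · simp only [SigE]; rw [hz L le_rfl]; dsimp only; omega
      · have hz1 := segSig_snd_eq_zero (k := .mixed)
          (s := fun c => blockSig .mixed 1 (N m c - ν c) (N (m + 1) c - N m c)) (a := L + 1)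
          (len := k - L - 1) (fun c hc _ => by rw [hz c (by omega)])
        have hz2 := segSig_fst_eq_zero (k := .mixed)
          (s := fun c => blockSig .mixed 1 (N m c - ν c) (N (m + 1) c - N m c)) (a := L + 1)
          (len := k - L - 1) (fun c hc _ => by
            rw [hz c (by omega)]; have := hmax c (by omega); dsimp only; omega)
        simp only [SigE]
        omega
  · intro s hs _ c
    unfold buildPat
    rw [if_neg (by omega), if_neg (by omega)]
  · intro c; simp [buildPat]

end HookCrystal

/-! ### Connectedness at the levels between unbarred letters -/

namespace HookCrystal
variable {m n : ℕ}

/-- The level below `μ` for which `e` acts on the column `L`, between unbarred letters. -/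
def oddLevel (m p L : ℕ) (μ : ℕ → ℕ) (c : ℕ) : ℕ :=
  if c < L then (if c + 1 < p then μ c else min (μ c) m) else μ (c + 1)

/-- Here letters of the lower value in a column cancel letters of the upper value in columns to its
right. The level `oddLevel` is as large as the strip and hook conditions allow left of `L`, so that
little interferes with column `L`, and as small as allowed from `L` on, so that everything to the
right is cancelled. The level `μ` need not be `N (m + p)`: this freedom is used to reach columns
beyond `p`. -/
theorem wordConn_odd {k p L : ℕ} {N : ℕ → ℕ → ℕ} (hN : IsPattern m n k N) (hp : 0 < p)
    (hpn : p < n) {μ : ℕ → ℕ} (hμ : IsStrip m (m + p) μ (N (m + p + 1)))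
    (hμm : ∀ c, p ≤ c → μ c ≤ m) (hL : μ L < N (m + p + 1) L)
    (hcase : L < p ∨ (p ≤ L ∧ μ L < m ∧ μ (p - 1) = N (m + p + 1) p)) :
    IsPattern m n k (buildPat m (m + p) (oddLevel m p L μ) μ N) ∧
    IsPattern m n k (buildPat m (m + p) (oddLevel m p L μ) (addBox μ L) N) ∧
    WordConn (patTab m n (buildPat m (m + p) (oddLevel m p L μ) μ N) 0 k).reading
      (patTab m n (buildPat m (m + p) (oddLevel m p L μ) (addBox μ L) N) 0 k).reading := by
  have hle := hμ.le
  have hlow := hμ.odd_le (by omega)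
  have hanti : ∀ c, μ (c + 1) ≤ μ c := fun c => (hle (c + 1)).trans (hlow c)
  set ν := oddLevel m p L μ with hν
  have hνa : ∀ c, ν (c + 1) ≤ ν c := by
    intro c
    have h1 := hanti c
    have h2 := hanti (c + 1)
    have h3 := hμm (c + 1)
    simp only [hν, oddLevel]
    split_ifs <;> omega
  have hνm : ∀ c, p ≤ c + 1 → ν c ≤ m := by
    intro c hc
    have h3 := hμm (c + 1) hc
    simp only [hν, oddLevel]
    split_ifs <;> omega
  have hνh : ∀ c, hookPat m ν (m + p - 1) c = ν c := by
    intro c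
    have := hνm c
    unfold hookPat
    split_ifs <;> omega
  have s1 : IsStrip m (m + p - 1) ν μ := by
    refine ⟨fun c => ?_, fun h => by omega, fun h => by omega, fun _ c => ?_⟩
    · have := hanti c
      simp only [hν, oddLevel]
      split_ifs <;> omega
    · have := hanti c
      have h3 := hμm (c + 1)
      simp only [hν, oddLevel]
      split_ifs <;> omega
  have s1' : IsStrip m (m + p - 1) ν (addBox μ L) := by
    refine ⟨fun c => ?_, fun h => by omega, fun h => by omega, fun _ c => ?_⟩
    · have := s1.le c
      unfold addBox; omega
    · have h1 := s1.odd_le (by omega) c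
      unfold addBox
      by_cases hc : c + 1 = L
      · have h2 := hlow c
        rw [hc] at h2
        rw [if_pos hc, hc]
        simp only [hν, oddLevel]
        rw [if_pos (by omega)]
        split_ifs <;> omega
      · rw [if_neg hc]; omega
  have s2' : IsStrip m (m + p) (addBox μ L) (N (m + p + 1)) := by
    refine ⟨fun c => ?_, fun h => by omega, fun h => by omega, fun _ c => ?_⟩
    · have := hle c
      unfold addBox; split_ifs with hc
      · subst hc; omega
      · omega
    · have := hlow c
      unfold addBox; omega
  have P1 := isPattern_build hN (by omega) (by omega) hνa hνh s1 hμ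
  have P2 := isPattern_build hN (by omega) (by omega) hνa hνh s1' s2'
  refine ⟨P1, P2, ?_⟩
  have hLk : L < k := by
    by_contra h
    have := hN.eq_zero (t := m + p + 1) (by omega) (c := L) (by omega)
    omega
  have hk : kind (⟨m + p - 1, by omega⟩ : Idx m n) = .odd := by
    unfold kind; rw [if_neg (by dsimp only; omega), if_neg (by dsimp only; omega)]
  have hsig : ∀ c, blockSig .odd 1 (μ c - ν c) (N (m + p + 1) c - μ c) =
      (N (m + p + 1) c - μ c, μ c - ν c) := by
    intro c; simp [blockSig, sigMul, powSig]
  -- Column `a` has `μ a - μ (a + 1)` lower letters, at least the number of upper letters in column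
  -- `a + 1`; so what survives is bounded by the upper letters of column `a` itself.
  have hright : ∀ len a, L + 1 ≤ a → (segSig .odd (fun c => blockSig .odd 1 (μ c - ν c)
      (N (m + p + 1) c - μ c)) a len).1 ≤ N (m + p + 1) a - μ a := by
    intro len
    induction len with
    | zero => intro a _; simp [segSig]
    | succ len ih =>
      intro a ha
      have h1 := ih (a + 1) (by omega)
      have h2 := hlow a
      have h3 := hle (a + 1)
      have h4 : ν a = μ (a + 1) := by simp only [hν, oddLevel]; rw [if_neg (by omega)]
      rw [segSig]
      simp only [sigMul]
      rw [hsig]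
      dsimp only
      omega
  have hleft : (segSig .odd (fun c => blockSig .odd 1 (μ c - ν c)
      (N (m + p + 1) c - μ c)) 0 L).2 < N (m + p + 1) L - μ L := by
    rcases hcase with h | ⟨h1, h2, h3⟩
    · rw [segSig_snd_eq_zero]
      · omega
      · intro c _ hc
        rw [hsig]
        simp only [hν, oddLevel]
        rw [if_pos (by omega), if_pos (by omega)]
        omega
    -- The hook condition on the level below forces lower letters only in column `p - 1`, and by
    -- `h3` there are `N (m + p + 1) p - m` of them. Column `p` has at least as many upper letters,
    -- which cancel them; if `L = p`, one upper letter is left because `μ p < m`.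
    · have key : ∀ len, len ≤ L → (segSig .odd (fun c => blockSig .odd 1 (μ c - ν c)
          (N (m + p + 1) c - μ c)) 0 len).2 ≤ if len = p then N (m + p + 1) p - m else 0 := by
        intro len
        induction len with
        | zero => intro _; simp [segSig]
        | succ len ih =>
          intro hlen
          have h4 := ih (by omega)
          rw [segSig_succ']
          simp only [sigMul, zero_add]
          rw [hsig]
          dsimp only
          have h5 : ν len = if len + 1 < p then μ len else min (μ len) m := by
            simp only [hν, oddLevel]; rw [if_pos (by omega)]
          have h6 := hμm len
          rw [h5]
          by_cases e1 : len + 1 = p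
          · rw [if_neg (by omega)] at h4
            rw [if_pos e1, if_neg (by omega)]
            have : μ len = N (m + p + 1) p := by rw [← h3]; congr 1; omega
            omega
          · rw [if_neg e1]
            by_cases e2 : len = p
            · subst e2
              rw [if_pos rfl] at h4
              rw [if_neg (by omega)]
              have := h6 le_rfl
              omega
            · rw [if_neg e2] at h4
              split_ifs <;> omega
      have := key L le_rfl
      split_ifs at this with hLp
      · subst hLp; omega
      · omega
  refine wordConn_build (⟨m + p - 1, by omega⟩ : Idx m n) (by dsimp only; omega) P1 hνh hLk
    (fun c => rfl) ?_ ?_ ?_ <;> rw [hk]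
  · rw [hsig]; dsimp only; omega
  · simp only [SigE]; rw [hsig]; exact hleft
  · have h1 := hright (k - L - 1) (L + 1) le_rfl
    have h2 := hlow L
    have h4 : ν L = μ (L + 1) := by simp only [hν, oddLevel]; rw [if_neg (by omega)]
    simp only [SigE, sigMul]
    rw [hsig]
    dsimp only at h1 ⊢
    omega

theorem buildPat_above {t s c : ℕ} {ν μ : ℕ → ℕ} {N : ℕ → ℕ → ℕ} (h : t < s) :
    buildPat m t ν μ N s c = N s c := by
  unfold buildPat; rw [if_neg (by omega), if_neg (by omega)]

theorem buildPat_at {t c : ℕ} {ν μ : ℕ → ℕ} {N : ℕ → ℕ → ℕ} : buildPat m t ν μ N t c = μ c := by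
  simp [buildPat]

theorem sum_addBox_lt {f g : ℕ → ℕ} {s : Finset ℕ} {L : ℕ} (hL : L ∈ s) (h : g L < f L) :
    ∑ c ∈ s, (f c - addBox g L c) < ∑ c ∈ s, (f c - g c) := by
  refine Finset.sum_lt_sum (fun c _ => ?_) ⟨L, hL, ?_⟩
  · unfold addBox; omega
  · unfold addBox; rw [if_pos rfl]; omega

/-- The first columns at the level `m + p` can be made as long as possible. -/
theorem exists_full_columns {k p : ℕ} (hS : ConnLevel m n k (m + p)) (hp : 0 < p) (hpn : p < n)
    (N : ℕ → ℕ → ℕ) (hN : IsPattern m n k N) : ∃ N', IsPattern m n k N' ∧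
      WordConn (patTab m n N 0 k).reading (patTab m n N' 0 k).reading ∧
      (∀ s, m + p < s → s ≤ m + n → ∀ c, N' s c = N s c) ∧
      ∀ c, N' (m + p) c = if c < p then N (m + p + 1) c else N (m + p) c := by
  induction hM : ∑ c ∈ Finset.range p, (N (m + p + 1) c - N (m + p) c) using Nat.strong_induction_on
    generalizing N with
  | _ M ih =>
    have hst := hN.strip (m + p) (by omega)
    by_cases h : ∃ L, L < p ∧ N (m + p) L < N (m + p + 1) L
    · obtain ⟨L, hLp, hL⟩ := h
      obtain ⟨P1, P2, hc⟩ := wordConn_odd hN hp hpn hst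
        (fun c hc => hN.le_hook (by omega) hc) hL (Or.inl hLp)
      have e1 : ∀ c, buildPat m (m + p) (oddLevel m p L (N (m + p))) (addBox (N (m + p)) L) N
          (m + p + 1) c = N (m + p + 1) c := fun c => buildPat_above (by omega)
      have e2 : ∀ c, buildPat m (m + p) (oddLevel m p L (N (m + p))) (addBox (N (m + p)) L) N
          (m + p) c = addBox (N (m + p)) L c := fun c => buildPat_at
      obtain ⟨N', h1, h2, h3, h4⟩ := ih _ (by
        rw [← hM]
        simp only [e1, e2]
        exact sum_addBox_lt (Finset.mem_range.2 hLp) hL) _ P2 rfl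
      refine ⟨N', h1, ?_, ?_, ?_⟩
      · refine Relation.EqvGen.trans _ _ _ (hS N _ hN P1 ?_) (Relation.EqvGen.trans _ _ _ hc h2)
        intro s hs _ c
        rcases hs.eq_or_lt with rfl | hs
        · rw [buildPat_at]
        · rw [buildPat_above hs]
      · intro s hs hs' c
        rw [h3 s hs hs', buildPat_above hs]
      · intro c
        rw [h4, e1, e2]
        split_ifs with hc
        · rfl
        · unfold addBox; rw [if_neg (by omega)]; rfl
    · push Not at h
      refine ⟨N, hN, Relation.EqvGen.refl _, fun _ _ _ _ => rfl, fun c => ?_⟩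
      split_ifs with hc
      · exact le_antisymm (hst.le c) (h c hc)
      · rfl

/-- Both patterns can be made full in the first `p` columns without disturbing the others, so those
columns may be altered at will. -/
theorem wordConn_of_agree {k p : ℕ} (hS : ConnLevel m n k (m + p)) (hp : 0 < p) (hpn : p < n)
    {N N' : ℕ → ℕ → ℕ} (hN : IsPattern m n k N) (hN' : IsPattern m n k N')
    (h : ∀ s, m + p < s → s ≤ m + n → ∀ c, N s c = N' s c)
    (h' : ∀ c, p ≤ c → N (m + p) c = N' (m + p) c) :
    WordConn (patTab m n N 0 k).reading (patTab m n N' 0 k).reading := by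
  obtain ⟨N1, a1, a2, a3, a4⟩ := exists_full_columns hS hp hpn N hN
  obtain ⟨N2, b1, b2, b3, b4⟩ := exists_full_columns hS hp hpn N' hN'
  refine Relation.EqvGen.trans _ _ _ a2 (Relation.EqvGen.trans _ _ _ ?_
    (Relation.EqvGen.symm _ _ b2))
  refine hS N1 N2 a1 b1 fun s hs hs' c => ?_
  rcases hs.eq_or_lt with rfl | hs
  · rw [a4, b4]
    split_ifs with hc
    · exact h _ (by omega) (by omega) c
    · exact h' c (by omega)
  · rw [a3 s hs hs', b3 s hs hs', h s hs hs']

/-- The last columns at the level `m + p` can be made as long as possible. -/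
theorem exists_full_odd {k p : ℕ} (hS : ConnLevel m n k (m + p)) (hp : 0 < p) (hpn : p < n)
    (N : ℕ → ℕ → ℕ) (hN : IsPattern m n k N) : ∃ N', IsPattern m n k N' ∧
      WordConn (patTab m n N 0 k).reading (patTab m n N' 0 k).reading ∧
      (∀ s, m + p < s → s ≤ m + n → ∀ c, N' s c = N s c) ∧
      ∀ c, p ≤ c → N' (m + p) c = min (N (m + p + 1) c) m := by
  induction hM : ∑ c ∈ Finset.Ico p k, (min (N (m + p + 1) c) m - N (m + p) c)
    using Nat.strong_induction_on generalizing N with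
  | _ M ih =>
    have hst := hN.strip (m + p) (by omega)
    have hhook : ∀ c, p ≤ c → N (m + p) c ≤ m := fun c hc => hN.le_hook (by omega) hc
    by_cases h : ∃ L, p ≤ L ∧ N (m + p) L < min (N (m + p + 1) L) m
    · obtain ⟨L, hLp, hL⟩ := h
      have hLk : L < k := by
        by_contra h
        have := hN.eq_zero (t := m + p + 1) (by omega) (c := L) (by omega)
        omega
      -- Column `p - 1` is shortened to the least length that the vertical strip allows, as
      -- `wordConn_odd` requires beyond column `p`; this is permitted by `wordConn_of_agree`.
      set μ : ℕ → ℕ := fun c => if c = p - 1 then N (m + p + 1) p else N (m + p) c with hμdef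
      have hμp : ∀ c, p ≤ c → μ c = N (m + p) c := by
        intro c hc; simp only [hμdef]; rw [if_neg (by omega)]
      have hμ1 : μ (p - 1) = N (m + p + 1) p := by simp [hμdef]
      have hμs : IsStrip m (m + p) μ (N (m + p + 1)) := by
        refine ⟨fun c => ?_, fun h => by omega, fun h => by omega, fun _ c => ?_⟩
        · simp only [hμdef]
          split_ifs with hc
          · have := hN.anti (t := m + p + 1) (by omega) c
            rw [show c + 1 = p by omega] at this
            exact this
          · exact hst.le c
        · simp only [hμdef]
          split_ifs with hc
          · rw [show c + 1 = p by omega]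
          · exact hst.odd_le (by omega) c
      obtain ⟨P1, P2, hc⟩ := wordConn_odd hN hp hpn hμs
        (fun c hc => by rw [hμp c hc]; exact hhook c hc)
        (L := L) (by rw [hμp L hLp]; omega) (Or.inr ⟨hLp, by rw [hμp L hLp]; omega, hμ1⟩)
      have e1 : ∀ c, buildPat m (m + p) (oddLevel m p L μ) (addBox μ L) N
          (m + p + 1) c = N (m + p + 1) c := fun c => buildPat_above (by omega)
      have e2 : ∀ c, p ≤ c → buildPat m (m + p) (oddLevel m p L μ) (addBox μ L) N
          (m + p) c = addBox (N (m + p)) L c := by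
        intro c hc
        rw [buildPat_at]
        unfold addBox
        rw [hμp c hc]
      obtain ⟨N', h1, h2, h3, h4⟩ := ih _ (by
        rw [← hM]
        have : ∑ c ∈ Finset.Ico p k, (min (buildPat m (m + p) (oddLevel m p L μ) (addBox μ L) N
            (m + p + 1) c) m - buildPat m (m + p) (oddLevel m p L μ) (addBox μ L) N (m + p) c) =
            ∑ c ∈ Finset.Ico p k, (min (N (m + p + 1) c) m - addBox (N (m + p)) L c) := by
          refine Finset.sum_congr rfl fun c hc => ?_
          rw [e1, e2 c (Finset.mem_Ico.1 hc).1]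
        rw [this]
        exact sum_addBox_lt (f := fun c => min (N (m + p + 1) c) m)
          (Finset.mem_Ico.2 ⟨hLp, hLk⟩) hL) _ P2 rfl
      refine ⟨N', h1, ?_, ?_, ?_⟩
      · refine Relation.EqvGen.trans _ _ _ (wordConn_of_agree hS hp hpn hN P1 ?_ ?_)
          (Relation.EqvGen.trans _ _ _ hc h2)
        · intro s hs _ c
          rw [buildPat_above hs]
        · intro c hc
          rw [buildPat_at, hμp c hc]
      · intro s hs hs' c
        rw [h3 s hs hs', buildPat_above hs]
      · intro c hc
        rw [h4 c hc, e1]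
    · push Not at h
      refine ⟨N, hN, Relation.EqvGen.refl _, fun _ _ _ _ => rfl, fun c hc => ?_⟩
      have h1 := h c hc
      have h2 := hst.le c
      have h3 := hhook c hc
      omega

/-- Each step lowers the total deficit from the maximal level, so iteration reaches that level. -/
theorem exists_full_of_step {k t : ℕ}
    (step : ∀ N, IsPattern m n k N → (∃ c, N t c < hookPat m (N (t + 1)) t c) →
      ∃ N' L, IsPattern m n k N' ∧
      WordConn (patTab m n N 0 k).reading (patTab m n N' 0 k).reading ∧
      (∀ s, t < s → s ≤ m + n → ∀ c, N' s c = N s c) ∧ L < k ∧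
      N t L < hookPat m (N (t + 1)) t L ∧ ∀ c, N' t c = addBox (N t) L c)
    (htm : t ≤ m) (htn : t < m + n)
    (N : ℕ → ℕ → ℕ) (hN : IsPattern m n k N) : ∃ N', IsPattern m n k N' ∧
      WordConn (patTab m n N 0 k).reading (patTab m n N' 0 k).reading ∧
      (∀ s, t < s → s ≤ m + n → ∀ c, N' s c = N s c) ∧
      ∀ c, N' t c = hookPat m (N (t + 1)) t c := by
  induction hM : ∑ c ∈ Finset.range k, (hookPat m (N (t + 1)) t c - N t c)
    using Nat.strong_induction_on generalizing N with
  | _ M ih =>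
    by_cases h : ∃ c, N t c < hookPat m (N (t + 1)) t c
    · obtain ⟨N1, L, h1, h2, h3, h4, h5, h6⟩ := step N hN h
      have e1 : N1 (t + 1) = N (t + 1) := by ext c; exact h3 _ (by omega) (by omega) c
      obtain ⟨N', g1, g2, g3, g4⟩ := ih _ (by
        rw [← hM, e1]
        simp only [h6]
        exact sum_addBox_lt (Finset.mem_range.2 h4) h5) _ h1 rfl
      refine ⟨N', g1, Relation.EqvGen.trans _ _ _ h2 g2, ?_, ?_⟩
      · intro s hs hs' c
        rw [g3 s hs hs', h3 s hs hs']
      · intro c; rw [g4, e1]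
    · push Not at h
      refine ⟨N, hN, Relation.EqvGen.refl _, fun _ _ _ _ => rfl, fun c => ?_⟩
      have h1 := h c
      have h2 := (hN.strip t htn).le c
      have h3 := hN.le_level htm c
      refine le_antisymm ?_ h1
      unfold hookPat
      rw [if_pos htm]
      omega

/-- Two patterns that agree above level `t` are both brought to the same maximal level `t`, after
which the induction hypothesis applies. Beyond level `m` only the columns that the hook condition
bounds are normalised; the remaining ones are free by `wordConn_of_agree`. -/
theorem connLevel (m n k : ℕ) {t : ℕ} (ht : t ≤ m + n) : ConnLevel m n k t := by
  induction t with
  | zero =>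
    intro N N' _ _ h
    rw [patTab_congr (fun t ht c => h t (by omega) ht c)]
    exact Relation.EqvGen.refl _
  | succ t ih =>
    have hS := ih (by omega)
    intro N N' hN hN' h
    have hup : ∀ s, t < s → s ≤ m + n → ∀ c, N s c = N' s c := fun s hs => h s hs
    have e : N (t + 1) = N' (t + 1) := by ext c; exact hup _ (by omega) (by omega) c
    rcases Nat.eq_zero_or_pos t with rfl | htpos
    · refine hS N N' hN hN' fun s _ hs c => ?_
      rcases Nat.eq_zero_or_pos s with rfl | hspos
      · rw [hN.zero, hN'.zero]
      · exact hup s hspos hs c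
    · rcases le_or_gt t m with htm | htm
      · have step : ∀ N, IsPattern m n k N → (∃ c, N t c < hookPat m (N (t + 1)) t c) →
            ∃ N' L, IsPattern m n k N' ∧
            WordConn (patTab m n N 0 k).reading (patTab m n N' 0 k).reading ∧
            (∀ s, t < s → s ≤ m + n → ∀ c, N' s c = N s c) ∧ L < k ∧
            N t L < hookPat m (N (t + 1)) t L ∧ ∀ c, N' t c = addBox (N t) L c := by
          intro N hN hne
          rcases htm.eq_or_lt with rfl | htm
          · exact stepAt_mixed hS htpos (by omega) hN hne
          · exact stepAt_even hS htpos htm hN hne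
        obtain ⟨N1, a1, a2, a3, a4⟩ := exists_full_of_step step htm (by omega) N hN
        obtain ⟨N2, b1, b2, b3, b4⟩ := exists_full_of_step step htm (by omega) N' hN'
        refine Relation.EqvGen.trans _ _ _ a2 (Relation.EqvGen.trans _ _ _ ?_
          (Relation.EqvGen.symm _ _ b2))
        refine hS N1 N2 a1 b1 fun s hs hs' c => ?_
        rcases hs.eq_or_lt with rfl | hs
        · rw [a4, b4, e]
        · rw [a3 s hs hs', b3 s hs hs', hup s hs hs']
      · obtain ⟨p, rfl⟩ : ∃ p, t = m + p := ⟨t - m, by omega⟩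
        obtain ⟨N1, a1, a2, a3, a4⟩ := exists_full_odd hS (by omega) (by omega) N hN
        obtain ⟨N2, b1, b2, b3, b4⟩ := exists_full_odd hS (by omega) (by omega) N' hN'
        refine Relation.EqvGen.trans _ _ _ a2 (Relation.EqvGen.trans _ _ _ ?_
          (Relation.EqvGen.symm _ _ b2))
        refine wordConn_of_agree hS (by omega) (by omega) a1 b1 ?_ ?_
        · intro s hs hs' c
          rw [a3 s hs hs', b3 s hs hs', hup s hs hs']
        · intro c hc
          rw [a4 c hc, b4 c hc, e]

theorem tabPat_top {T T' : Filling m n} (hl : T.map List.length = T'.map List.length) (c : ℕ) :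
    tabPat T (m + n) c = tabPat T' (m + n) c := by
  unfold tabPat
  rw [cum_top _ le_rfl, cum_top _ le_rfl]
  have h1 : ∀ S : Filling m n, (S.getD c []).length = (S.map List.length).getD c 0 := by
    intro S
    simp only [List.getD_eq_getElem?_getD, List.getElem?_map]
    cases S[c]? <;> rfl
  rw [h1, h1, hl]

/-- The crystal of tableaux of a given shape is connected. -/
theorem IsTableau.wordConn {T T' : Filling m n} (hT : IsTableau T) (hT' : IsTableau T')
    (hl : T.map List.length = T'.map List.length) : WordConn T.reading T'.reading := by
  have hk : T.length = T'.length := by simpa using congrArg List.length hl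
  have h2 := hT'.isPattern
  have h3 := connLevel m n T.length le_rfl (tabPat T) (tabPat T') hT.isPattern (by rwa [hk]) (by
    intro s hs hs' c
    obtain rfl : s = m + n := by omega
    exact tabPat_top hl c)
  rw [← hT.eq_patTab] at h3
  rw [hk, ← hT'.eq_patTab] at h3
  exact h3

end HookCrystal

namespace HookCrystal
variable {m n : ℕ}

/-! ### Rigidity of tableaux -/

theorem IsPattern.tabPat_patTab {k : ℕ} {N : ℕ → ℕ → ℕ} (h : IsPattern m n k N) {t : ℕ}
    (ht : t ≤ m + n) (c : ℕ) : tabPat (patTab m n N 0 k) t c = N t c := by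
  unfold tabPat patTab
  rw [List.getD_eq_getElem?_getD, List.getElem?_map]
  by_cases hc : c < k
  · rw [List.getElem?_range' hc]
    simp [h.cum_patCol c ht]
  · rw [List.getElem?_eq_none (by simpa using hc), h.eq_zero ht (by omega)]
    simp [cum]

theorem tabPat_top_eq_zero {T : Filling m n} (hT : IsTableau T) {c : ℕ} :
    tabPat T (m + n) c = 0 ↔ T.length ≤ c := by
  unfold tabPat
  rw [cum_top _ le_rfl, List.length_eq_zero_iff, List.getD_eq_getElem?_getD]
  by_cases hc : c < T.length
  · rw [List.getElem?_eq_getElem hc]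
    simpa [hc.not_ge] using hT.ne_nil _ (List.getElem_mem hc)
  · simp [not_lt.1 hc]

theorem IsTableau.length_eq_of_tabPat {T T' : Filling m n} (hT : IsTableau T) (hT' : IsTableau T')
    (h : ∀ c, tabPat T (m + n) c = tabPat T' (m + n) c) : T.length = T'.length := by
  have h1 : ∀ c, T.length ≤ c ↔ T'.length ≤ c := fun c => by
    rw [← tabPat_top_eq_zero hT, ← tabPat_top_eq_zero hT', h]
  exact le_antisymm ((h1 _).2 le_rfl) ((h1 _).1 le_rfl)

theorem IsTableau.map_length_eq_of_tabPat {T T' : Filling m n} (hT : IsTableau T)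
    (hT' : IsTableau T') (h : ∀ c, tabPat T (m + n) c = tabPat T' (m + n) c) :
    T.map List.length = T'.map List.length := by
  have hl := hT.length_eq_of_tabPat hT' h
  refine List.ext_getElem (by simpa using hl) fun c hc hc' => ?_
  have h1 := h c
  simp only [List.length_map] at hc hc'
  unfold tabPat at h1
  rw [cum_top _ le_rfl, cum_top _ le_rfl] at h1
  simpa [List.getD_eq_getElem?_getD, hc, hc'] using h1

theorem IsTableau.eq_of_tabPat {T T' : Filling m n} (hT : IsTableau T) (hT' : IsTableau T')
    (h : ∀ t ≤ m + n, ∀ c, tabPat T t c = tabPat T' t c) : T = T' := by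
  rw [hT.eq_patTab, hT'.eq_patTab, hT.length_eq_of_tabPat hT' (h _ le_rfl), patTab_congr h]

/-- The partial sums of the weight are the row sums of the pattern, so weights can be compared
column by column. -/
theorem cum_reading (T : Filling m n) {K : ℕ} (hK : T.length ≤ K) (t : ℕ) :
    cum T.reading t = ∑ c ∈ Finset.range K, tabPat T t c := by
  induction T generalizing K with
  | nil => simp [Filling.reading, cum, tabPat]
  | cons C T ih =>
    obtain ⟨K, rfl⟩ : ∃ K', K = K' + 1 := ⟨K - 1, by simp at hK; omega⟩
    rw [reading_cons, cum_append, Finset.sum_range_succ', ih (by simpa using hK)]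
    rfl

theorem cum_eq_of_wordWt {w w' : List (Letter m n)} (h : wordWt m n w = wordWt m n w') {t : ℕ}
    (ht : t ≤ m + n) : cum w t = cum w' t := by
  induction t with
  | zero => rw [cum_zero, cum_zero]
  | succ t ih =>
    have h1 := congrFun h ⟨t, by omega⟩
    rw [wordWt_apply, wordWt_apply] at h1
    have h2 := cum_succ w ⟨t, by omega⟩
    have h3 := cum_succ w' ⟨t, by omega⟩
    dsimp only at h2 h3
    have := ih (by omega)
    omega

/-! ### Tableaux with the smallest entries and recovery of the shape -/

/-- The tableau of the shape of `T` with the smallest entries. -/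
def highTab (T : Filling m n) : Filling m n :=
  patTab m n (hookPat m (tabPat T (m + n))) 0 T.length

theorem IsTableau.hookPat_top {T : Filling m n} (hT : IsTableau T) (c : ℕ) :
    hookPat m (tabPat T (m + n)) (m + n) c = tabPat T (m + n) c := by
  have h1 := hT.isPattern.le_hook le_rfl (c := c)
  have h2 := hT.isPattern.le_level (t := m + n)
  unfold hookPat
  split_ifs with h h'
  · have := h2 h c; omega
  · rfl
  · have := h1 (by omega); omega

/-- No tableau of the shape has more small letters in any column than `highTab T`: barred letters
are distinct in a column, and `le_hook` bounds the later columns. -/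
theorem IsTableau.tabPat_le {T : Filling m n} (hT : IsTableau T) {t : ℕ} (ht : t ≤ m + n) (c : ℕ) :
    tabPat T t c ≤ hookPat m (tabPat T (m + n)) t c := by
  have h1 := hT.isPattern.mono ht le_rfl c
  unfold hookPat
  split_ifs with h h'
  · have := hT.isPattern.le_level h c; omega
  · exact h1
  · have := hT.isPattern.le_hook (s := t - m) (by omega) (c := c) (by omega)
    rw [show m + (t - m) = t by omega] at this
    omega

theorem IsTableau.isPattern_hookPat {T : Filling m n} (hT : IsTableau T) :
    IsPattern m n T.length (hookPat m (tabPat T (m + n))) := by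
  refine ⟨fun c => by simp [hookPat], fun t _ => isStrip_hookPat (hT.isPattern.anti le_rfl) t, ?_⟩
  intro c hc
  rw [hT.hookPat_top, hT.isPattern.supp c hc]

theorem IsTableau.isTableau_highTab {T : Filling m n} (hT : IsTableau T) :
    IsTableau (highTab T) := by
  refine hT.isPattern_hookPat.isTableau 0 fun c hc => ?_
  rw [hT.hookPat_top]
  intro h
  have := (tabPat_top_eq_zero hT).1 h
  omega

theorem IsTableau.tabPat_highTab {T : Filling m n} (hT : IsTableau T) {t : ℕ} (ht : t ≤ m + n)
    (c : ℕ) : tabPat (highTab T) t c = hookPat m (tabPat T (m + n)) t c :=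
  hT.isPattern_hookPat.tabPat_patTab ht c

theorem IsTableau.map_length_highTab {T : Filling m n} (hT : IsTableau T) :
    (highTab T).map List.length = T.map List.length :=
  hT.isTableau_highTab.map_length_eq_of_tabPat hT fun c => by
    rw [hT.tabPat_highTab le_rfl, hT.hookPat_top]

/-- Differences of consecutive sums are the multiplicities in the weight of the tableau with the
smallest entries. For a barred letter they count the columns of at least a given length; for an
unbarred one they give the part of a single column below row `m`. -/
theorem le_of_sum_hookPat_eq {l l' : ℕ → ℕ} (hl : ∀ c, l (c + 1) ≤ l c)
    (hl' : ∀ c, l' (c + 1) ≤ l' c) (hh : ∀ c, n ≤ c → l c ≤ m) {K : ℕ}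
    (hK : ∀ c, K ≤ c → l c = 0)
    (h : ∀ t ≤ m + n, ∑ c ∈ Finset.range K, hookPat m l t c =
      ∑ c ∈ Finset.range K, hookPat m l' t c) (c : ℕ) : l c ≤ l' c := by
  have ha : Antitone l := antitone_nat_of_succ_le hl
  have ha' : Antitone l' := antitone_nat_of_succ_le hl'
  by_contra! hc
  have hcK : c < K := by
    by_contra hcK
    have := hK c (by omega)
    omega
  have key : ∀ t, t + 1 ≤ m + n → (∀ d, hookPat m l' (t + 1) d + hookPat m l t d ≤
      hookPat m l (t + 1) d + hookPat m l' t d) → ¬ hookPat m l' (t + 1) c + hookPat m l t c <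
      hookPat m l (t + 1) c + hookPat m l' t c := by
    intro t ht h1 h2
    have h3 := Finset.sum_lt_sum (fun d _ => h1 d) ⟨c, Finset.mem_range.2 hcK, h2⟩
    rw [Finset.sum_add_distrib, Finset.sum_add_distrib, h t (by omega), h (t + 1) ht] at h3
    omega
  by_cases hm : l' c < m
  -- At this level the columns of `l'` that still grow lie left of `c`, and there `l` grows too; in
  -- addition `l` grows in column `c`.
  · refine key (l' c) (by omega) (fun d => ?_) ?_
    · unfold hookPat
      rw [if_pos (by omega), if_pos (by omega), if_pos (by omega), if_pos (by omega)]
      by_cases hd : c ≤ d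
      · have := ha' hd; omega
      · have := ha (by omega : d ≤ c); omega
    · unfold hookPat
      rw [if_pos (by omega), if_pos (by omega), if_pos (by omega), if_pos (by omega)]
      omega
  · have hcn : c < n := by
      by_contra hcn
      have := hh c (by omega)
      omega
    -- At this level only column `c` grows, from length `m` to its full length.
    refine key (m + c) (by omega) (fun d => ?_) ?_
    · unfold hookPat
      by_cases hd : d = c
      · subst hd; split_ifs <;> omega
      · split_ifs <;> omega
    · unfold hookPat
      split_ifs <;> omega

theorem wordOps_append (s s' : List (Bool × Idx m n)) (w : List (Letter m n)) :
    wordOps (s ++ s') w = (wordOps s w).bind (wordOps s') := by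
  induction s generalizing w with
  | nil => rfl
  | cons o s ih =>
    simp only [List.cons_append, wordOps, Option.bind_assoc]
    congr 1
    ext1 w'
    exact ih w'

theorem wordOp_not {o : Bool × Idx m n} {w w' : List (Letter m n)} (h : wordOp o w = some w') :
    wordOp (!o.1, o.2) w' = some w := by
  obtain ⟨b, i⟩ := o
  cases b
  · exact (wordF_iff_wordE i w' w).2 h
  · exact (wordF_iff_wordE i w w').1 h

theorem wordOps_reverse {s : List (Bool × Idx m n)} {w w' : List (Letter m n)}
    (h : wordOps s w = some w') : wordOps (s.reverse.map fun o => (!o.1, o.2)) w' = some w := by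
  induction s generalizing w with
  | nil => exact h.symm
  | cons o s ih =>
    obtain ⟨w₁, h1, h2⟩ := Option.bind_eq_some_iff.1 h
    rw [List.reverse_cons, List.map_append, wordOps_append, ih h2]
    simp [wordOps, wordOp_not h1]

theorem WordConn.exists_wordOps {w w' : List (Letter m n)} (h : WordConn w w') :
    ∃ s, wordOps s w = some w' := by
  induction h with
  | rel w w' h =>
    obtain ⟨i, h⟩ := h
    exact ⟨[(true, i)], by simp [wordOps, wordOp, h]⟩
  | refl w => exact ⟨[], rfl⟩
  | symm w w' _ ih =>
    obtain ⟨s, h⟩ := ih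
    exact ⟨_, wordOps_reverse h⟩
  | trans w w' w'' _ _ ih ih' =>
    obtain ⟨s, h⟩ := ih
    obtain ⟨s', h'⟩ := ih'
    exact ⟨s ++ s', by rw [wordOps_append, h]; exact h'⟩

theorem IsTableau.exists_wordOp {T : Filling m n} (hT : IsTableau T) {o : Bool × Idx m n}
    {w : List (Letter m n)} (h : wordOp o T.reading = some w) :
    ∃ T' : Filling m n, IsTableau T' ∧ T'.reading = w ∧
      T'.map List.length = T.map List.length := by
  obtain ⟨b, i⟩ := o
  cases b
  · obtain ⟨T', h1, h2, h3, -⟩ := hT.exists_wordE (i := i) h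
    exact ⟨T', h1, h2, h3⟩
  · obtain ⟨T', h1, h2, h3, -⟩ := hT.exists_wordF (i := i) h
    exact ⟨T', h1, h2, h3⟩

theorem IsTableau.exists_wordOps {T : Filling m n} (hT : IsTableau T) {s : List (Bool × Idx m n)}
    {w : List (Letter m n)} (h : wordOps s T.reading = some w) :
    ∃ T' : Filling m n, IsTableau T' ∧ T'.reading = w ∧
      T'.map List.length = T.map List.length := by
  induction s generalizing T with
  | nil => exact ⟨T, hT, Option.some.inj h, rfl⟩
  | cons o s ih =>
    obtain ⟨w₁, h1, h2⟩ := Option.bind_eq_some_iff.1 h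
    obtain ⟨T₁, h3, rfl, h4⟩ := hT.exists_wordOp h1
    obtain ⟨T', h5, h6, h7⟩ := ih h3 h2
    exact ⟨T', h5, h6, h7.trans h4⟩

/-- Operators leading from `T` to `highTab T` are defined on `T'` as well and produce a tableau of
the shape of `T'` with the same weight; its partial sums are bounded by the maximal ones for that
shape. -/
theorem IsTableau.sum_tabPat_le {T T' : Filling m n} (hT : IsTableau T) (hT' : IsTableau T')
    (h : CrystalEquiv T.reading T'.reading) {K : ℕ} (hK : T.length ≤ K) (hK' : T'.length ≤ K)
    {t : ℕ} (ht : t ≤ m + n) :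
    ∑ c ∈ Finset.range K, hookPat m (tabPat T (m + n)) t c ≤
      ∑ c ∈ Finset.range K, hookPat m (tabPat T' (m + n)) t c := by
  obtain ⟨s, hs⟩ := (hT.wordConn hT.isTableau_highTab hT.map_length_highTab.symm).exists_wordOps
  obtain ⟨w, hw, he⟩ := h.exists_ops hs
  obtain ⟨S, h1, rfl, h3⟩ := hT'.exists_wordOps hw
  have hlen : (highTab T).length = T.length := by
    simpa using congrArg List.length hT.map_length_highTab
  have hlen' : S.length = T'.length := by simpa using congrArg List.length h3
  have h4 := cum_eq_of_wordWt he.wt_eq ht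
  rw [cum_reading _ (K := K) (by omega), cum_reading _ (K := K) (by omega)] at h4
  rw [Finset.sum_congr rfl fun c _ => (hT.tabPat_highTab ht c).symm, h4]
  refine Finset.sum_le_sum fun c _ => ?_
  have := h1.tabPat_le ht c
  rwa [show tabPat S (m + n) = tabPat T' (m + n) from funext (tabPat_top h3)] at this

/-- By symmetry of `IsTableau.sum_tabPat_le` the shapes agree. The operators that take `T` to
`highTab T` then take `T'` to a tableau of the same shape and weight, which is `highTab T`; undoing
them gives equality. -/
theorem IsTableau.eq_of_crystalEquiv {T T' : Filling m n} (hT : IsTableau T) (hT' : IsTableau T')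
    (h : CrystalEquiv T.reading T'.reading) : T = T' := by
  set K := max T.length T'.length
  have hK : T.length ≤ K := le_max_left _ _
  have hK' : T'.length ≤ K := le_max_right _ _
  have hsum : ∀ t ≤ m + n, ∑ c ∈ Finset.range K, hookPat m (tabPat T (m + n)) t c =
      ∑ c ∈ Finset.range K, hookPat m (tabPat T' (m + n)) t c := fun t ht =>
    le_antisymm (hT.sum_tabPat_le hT' h hK hK' ht) (hT'.sum_tabPat_le hT h.symm hK' hK ht)
  have hp := hT.isPattern
  have hp' := hT'.isPattern
  have hle := le_of_sum_hookPat_eq (hp.anti le_rfl) (hp'.anti le_rfl)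
    (fun c hc => hp.le_hook le_rfl hc) (fun c hc => hp.supp c (by omega)) hsum
  have hge := le_of_sum_hookPat_eq (hp'.anti le_rfl) (hp.anti le_rfl)
    (fun c hc => hp'.le_hook le_rfl hc) (fun c hc => hp'.supp c (by omega))
    fun t ht => (hsum t ht).symm
  have hshape := fun c => le_antisymm (hle c) (hge c)
  have hl := hT.map_length_eq_of_tabPat hT' hshape
  obtain ⟨s, hs⟩ := (hT.wordConn hT.isTableau_highTab hT.map_length_highTab.symm).exists_wordOps
  obtain ⟨w, hw, he⟩ := h.exists_ops hs
  obtain ⟨S, h1, rfl, h3⟩ := hT'.exists_wordOps hw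
  have hlen : (highTab T).length = T.length := by
    simpa using congrArg List.length hT.map_length_highTab
  have hlen' : S.length = T'.length := by simpa using congrArg List.length h3
  have htop : tabPat S (m + n) = tabPat T (m + n) := by
    ext c
    rw [tabPat_top h3, hshape]
  have hSH : S = highTab T := by
    refine h1.eq_of_tabPat hT.isTableau_highTab fun t ht c => ?_
    rw [hT.tabPat_highTab ht, ← htop]
    rcases lt_or_ge c K with hc | hc
    · have h4 := cum_eq_of_wordWt he.wt_eq ht
      rw [cum_reading _ (K := K) (by omega), cum_reading _ (K := K) (by omega),
        Finset.sum_congr rfl fun c _ => hT.tabPat_highTab ht c, ← htop] at h4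
      -- The columnwise bounds have equal sums, so each of them is an equality.
      exact (Finset.sum_eq_sum_iff_of_le fun c _ => h1.tabPat_le ht c).1 h4.symm c
        (Finset.mem_range.2 hc)
    · have h5 := h1.isPattern.eq_zero ht (c := c) (by omega)
      have h6 := h1.isPattern.supp c (by omega)
      rw [h5]
      unfold hookPat
      split_ifs <;> omega
  rw [hSH] at hw
  have h7 := (wordOps_reverse hs).symm.trans (wordOps_reverse hw)
  exact reading_injective (Option.some.inj h7) hl

/-! ### Insertion and crystal operators -/

/-- Both words are equivalent to the readings of their insertion tableaux, and equivalent tableaux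
coincide. -/
theorem CrystalEquiv.insertionTableau_eq {w w' : List (Letter m n)} (h : CrystalEquiv w w') :
    insertionTableau m n w = insertionTableau m n w' :=
  (isTableau_insertionTableau w).eq_of_crystalEquiv (isTableau_insertionTableau w')
    ((crystalEquiv_insertionTableau w).symm.trans (h.trans (crystalEquiv_insertionTableau w')))

theorem wordOp_insertionTableau {w w' : List (Letter m n)} {o : Bool × Idx m n}
    (h : wordOp o w = some w') :
    wordOp o (insertionTableau m n w).reading = some (insertionTableau m n w').reading ∧
      (insertionTableau m n w').map List.length = (insertionTableau m n w).map List.length := by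
  obtain ⟨w₁, h1, h2⟩ := (crystalEquiv_insertionTableau w).exists_op h
  obtain ⟨T, h3, rfl, h4⟩ := (isTableau_insertionTableau w).exists_wordOp h1
  obtain rfl := h3.eq_of_crystalEquiv (isTableau_insertionTableau w')
    (h2.symm.trans (crystalEquiv_insertionTableau w'))
  exact ⟨h1, h4⟩

/-- f acts either inside the prefix, where insertion keeps the shape, or after it, where the prefix
is unchanged. The sequence of these shapes plays the part of the recording tableau. -/
theorem map_length_insertionTableau_take {w w' : List (Letter m n)} {i : Idx m n}
    (h : wordF m n i w = some w') (k : ℕ) :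
    (insertionTableau m n (w'.take k)).map List.length =
      (insertionTableau m n (w.take k)).map List.length := by
  rw [← List.take_append_drop k w, wordF_append] at h
  split_ifs at h with hs
  · obtain ⟨x, hx, rfl⟩ := Option.map_eq_some_iff.1 h
    have hl := wordF_length hx
    have h1 := (wordOp_insertionTableau (o := (true, i)) hx).2
    rw [← h1]
    congr 2
    rcases le_total k w.length with hk | hk
    · rw [List.take_append_of_le_length (by simp [hl, hk]), List.take_of_length_le (by simp [hl])]
    · rw [List.drop_eq_nil_of_le hk, List.append_nil, List.take_of_length_le]
      rw [hl]; simp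
  · obtain ⟨x, hx, rfl⟩ := Option.map_eq_some_iff.1 h
    rcases le_total k w.length with hk | hk
    · rw [List.take_append_of_le_length (by simp [hk]), List.take_take, min_self]
    · rw [List.drop_eq_nil_of_le hk] at hx
      simp [wordF] at hx

/-- A word is determined by its insertion tableau and the shapes of those of its prefixes. -/
theorem eq_of_insertionTableau_eq {w w' : List (Letter m n)} (hlen : w.length = w'.length)
    (hs : ∀ k, (insertionTableau m n (w'.take k)).map List.length =
      (insertionTableau m n (w.take k)).map List.length)
    (h : insertionTableau m n w = insertionTableau m n w') : w = w' := by
  induction w using List.reverseRecOn generalizing w' with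
  | nil => exact (List.length_eq_zero_iff.1 hlen.symm).symm
  | append_singleton w b ih =>
    rcases List.eq_nil_or_concat w' with rfl | ⟨w', b', rfl⟩
    · simp at hlen
    · rw [List.concat_eq_append] at *
      have hlen' : w.length = w'.length := by simpa using hlen
      have hs' : ∀ k ≤ w.length, (insertionTableau m n (w'.take k)).map List.length =
          (insertionTableau m n (w.take k)).map List.length := by
        intro k hk
        have := hs k
        rwa [List.take_append_of_le_length (by omega),
          List.take_append_of_le_length (by omega)] at this
      have hs'' : ∀ k, (insertionTableau m n (w'.take k)).map List.length =
          (insertionTableau m n (w.take k)).map List.length := by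
        intro k
        rcases le_total k w.length with hk | hk
        · exact hs' k hk
        · have := hs' w.length le_rfl
          rw [List.take_of_length_le (by omega), List.take_of_length_le le_rfl] at this
          rw [List.take_of_length_le (by omega), List.take_of_length_le hk, this]
      have h1 := hs' w.length le_rfl
      rw [List.take_of_length_le (by omega), List.take_of_length_le le_rfl] at h1
      unfold insertionTableau at h
      simp only [List.foldl_append, List.foldl_cons, List.foldl_nil] at h
      obtain ⟨h2, rfl⟩ := insertLetter_injective (isTableau_insertionTableau w).col
        (isTableau_insertionTableau w').col h1.symm h
      rw [ih hlen' hs'' h2]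

/-- The shapes of the prefixes are constant on a component, and with them insertion can be undone
letter by letter. -/
theorem WordConn.eq_of_insertionTableau_eq {w w' : List (Letter m n)} (h : WordConn w w')
    (hP : insertionTableau m n w = insertionTableau m n w') : w = w' := by
  have key : w.length = w'.length ∧ ∀ k, (insertionTableau m n (w'.take k)).map List.length =
      (insertionTableau m n (w.take k)).map List.length := by
    clear hP
    induction h with
    | rel w w' h =>
      obtain ⟨i, h⟩ := h
      exact ⟨(wordF_length h).symm, map_length_insertionTableau_take h⟩
    | refl w => exact ⟨rfl, fun _ => rfl⟩
    | symm w w' _ ih => exact ⟨ih.1.symm, fun k => (ih.2 k).symm⟩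
    | trans w w' w'' _ _ ih ih' => exact ⟨ih.1.trans ih'.1, fun k => (ih'.2 k).trans (ih.2 k)⟩
  exact HookCrystal.eq_of_insertionTableau_eq key.1 key.2 hP

end HookCrystal

namespace HookCrystal
variable {m n : ℕ}

/-! ### Two-by-two blocks -/

/-- The degrees of the two letters joined by an arrow of a given kind. -/
def Kind.degrees : Kind → ℕ × ℕ
  | .even => (0, 0)
  | .mixed => (0, 1)
  | .odd => (1, 1)

/-- A block of two rows of kind `k` and two columns of kind `k'` has its entries at most one where
the degrees differ. -/
def BlockAdm (k k' : Kind) (a b c d : ℕ) : Prop :=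
  (k.degrees.1 ≠ k'.degrees.1 → a ≤ 1) ∧ (k.degrees.1 ≠ k'.degrees.2 → b ≤ 1) ∧
    (k.degrees.2 ≠ k'.degrees.1 → c ≤ 1) ∧ (k.degrees.2 ≠ k'.degrees.2 → d ≤ 1)

/-- `f` acts on the first column of the block. -/
def BlockLeft (k k' : Kind) (a b c d : ℕ) : Prop :=
  SigF k (blockSig k k'.degrees.1 a c) (blockSig k k'.degrees.2 b d)

instance (k k' : Kind) (a b c d : ℕ) : Decidable (BlockLeft k k' a b c d) := by
  unfold BlockLeft; infer_instance

/-- The signature of a block. -/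
def pairSig (k k' : Kind) (a b c d : ℕ) : ℕ × ℕ :=
  sigMul k (blockSig k k'.degrees.1 a c) (blockSig k k'.degrees.2 b d)

/-- The block after `f`. -/
def blockF (k k' : Kind) (q : ℕ × ℕ × ℕ × ℕ) : ℕ × ℕ × ℕ × ℕ :=
  if BlockLeft k k' q.1 q.2.1 q.2.2.1 q.2.2.2 then (q.1 - 1, q.2.1, q.2.2.1 + 1, q.2.2.2)
  else (q.1, q.2.1 - 1, q.2.2.1, q.2.2.2 + 1)

/-- The transposed block. -/
def blockT (q : ℕ × ℕ × ℕ × ℕ) : ℕ × ℕ × ℕ × ℕ := (q.1, q.2.2.1, q.2.1, q.2.2.2)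

theorem blockSig_even_zero (a c : ℕ) : blockSig .even 0 a c = (c, a) := by
  simp [blockSig, powSig, sigMul]

theorem blockSig_even_one (a c : ℕ) : blockSig .even 1 a c = (c - a, a - c) := by
  simp [blockSig, powSig, sigMul]

theorem blockSig_odd_zero (a c : ℕ) : blockSig .odd 0 a c = (c - a, a - c) := by
  simp [blockSig, powSig, sigMul]

theorem blockSig_odd_one (a c : ℕ) : blockSig .odd 1 a c = (c, a) := by
  simp [blockSig, powSig, sigMul]

theorem blockSig_mixed_zero (a c : ℕ) : blockSig .mixed 0 a c = (min c 1, min a (1 - c)) := by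
  rw [blockSig, if_pos rfl]
  unfold powSig sigMul
  dsimp only
  split_ifs <;> refine Prod.ext ?_ ?_ <;> dsimp only at * <;> omega

theorem blockSig_mixed_one (a c : ℕ) : blockSig .mixed 1 a c = (min c (1 - a), min a 1) := by
  rw [blockSig, if_neg one_ne_zero]
  unfold powSig sigMul
  dsimp only
  split_ifs <;> refine Prod.ext ?_ ?_ <;> dsimp only at * <;> omega

theorem pairSig_pos {k k' : Kind} {a b c d : ℕ} : 0 < (pairSig k k' a b c d).2 ↔
    (BlockLeft k k' a b c d ∧ 0 < (blockSig k k'.degrees.1 a c).2) ∨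
      (¬ BlockLeft k k' a b c d ∧ 0 < (blockSig k k'.degrees.2 b d).2) := by
  have := sigMul_snd_eq_zero (k := k) (a := blockSig k k'.degrees.1 a c)
    (b := blockSig k k'.degrees.2 b d)
  unfold pairSig BlockLeft
  rw [pos_iff_ne_zero, Ne, this]
  split_ifs with h <;> simp [h, pos_iff_ne_zero]

/-- If both operators take a unit from the same entry, or put one into the same entry, the two
orders agree when the second moves either both keep their place or both change it. In the other two
cases neither operator affects the choice of the other. -/
theorem blockF_comm_of {k k' : Kind} {a b c d : ℕ}
    (h1 : BlockLeft k k' a b c d → BlockLeft k' k a c b d →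
      (BlockLeft k' k (a - 1) (c + 1) b d ↔ BlockLeft k k' (a - 1) (b + 1) c d))
    (h2 : BlockLeft k k' a b c d → ¬ BlockLeft k' k a c b d → 0 < a ∧ 0 < c ∧
      (BlockLeft k' k (a - 1) (c + 1) b d ↔ False) ∧ (BlockLeft k k' a b (c - 1) (d + 1) ↔ True))
    (h3 : ¬ BlockLeft k k' a b c d → BlockLeft k' k a c b d → 0 < a ∧ 0 < b ∧
      (BlockLeft k' k a c (b - 1) (d + 1) ↔ True) ∧ (BlockLeft k k' (a - 1) (b + 1) c d ↔ False))
    (h4 : ¬ BlockLeft k k' a b c d → ¬ BlockLeft k' k a c b d → 0 < b ∧ 0 < c ∧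
      (BlockLeft k' k a c (b - 1) (d + 1) ↔ BlockLeft k k' a b (c - 1) (d + 1))) :
    blockT (blockF k' k (blockT (blockF k k' (a, b, c, d)))) =
      blockF k k' (blockT (blockF k' k (blockT (a, b, c, d)))) := by
  unfold blockF blockT
  dsimp only
  by_cases hl : BlockLeft k k' a b c d <;> by_cases hr : BlockLeft k' k a c b d
  · have h := h1 hl hr
    simp only [hl, hr, if_true, h]
    split_ifs <;> simp
  · obtain ⟨g1, g2, h, h'⟩ := h2 hl hr
    simp only [hl, hr, if_true, if_false, h, h', Prod.mk.injEq, true_and,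
      and_true]
    omega
  · obtain ⟨g1, g2, h, h'⟩ := h3 hl hr
    simp only [hl, hr, if_true, if_false, h, h', Prod.mk.injEq, true_and,
      and_true]
    omega
  · obtain ⟨g1, g2, h⟩ := h4 hl hr
    simp only [hl, hr, if_false, h]
    split_ifs <;> simp only [Prod.mk.injEq, true_and, and_true]
    omega

theorem blockF_comm {k k' : Kind} {a b c d : ℕ} (h : BlockAdm k k' a b c d)
    (hp : 0 < (pairSig k k' a b c d).2) (hp' : 0 < (pairSig k' k a c b d).2) :
    blockT (blockF k' k (blockT (blockF k k' (a, b, c, d)))) =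
      blockF k k' (blockT (blockF k' k (blockT (a, b, c, d)))) := by
  unfold BlockAdm at h
  rw [pairSig_pos] at hp hp'
  apply blockF_comm_of <;> intro hl hr <;>
    simp only [hl, hr, true_and, false_and, not_true_eq_false, or_false, false_or,
      not_false_eq_true] at hp hp' <;>
    unfold BlockLeft at hl hr ⊢ <;> cases k <;> cases k' <;>
    simp only [Kind.degrees, blockSig_even_zero, blockSig_odd_zero, blockSig_mixed_zero,
      blockSig_even_one, blockSig_odd_one, blockSig_mixed_one, SigF, ne_eq, not_true_eq_false,
      false_imp_iff, true_and, and_true, zero_ne_one, one_ne_zero, not_false_eq_true,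
      true_imp_iff, iff_false, iff_true] at h hp hp' hl hr ⊢ <;>
    omega

/-- An operator along the rows may change the signatures of both columns of the block, but not their
product; hence ε and φ of the operator along the columns are unchanged. -/
theorem pairSig_move {k k' : Kind} {a b c d : ℕ} (h : BlockAdm k k' a b c d)
    (hp : 0 < (pairSig k' k a c b d).2) :
    (BlockLeft k' k a c b d → pairSig k k' (a - 1) (b + 1) c d = pairSig k k' a b c d) ∧
    (¬ BlockLeft k' k a c b d → pairSig k k' a b (c - 1) (d + 1) = pairSig k k' a b c d) := by
  unfold BlockAdm at h
  rw [pairSig_pos] at hp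
  constructor <;> intro hl <;>
    simp only [hl, true_and, false_and, not_true_eq_false, or_false, false_or,
      not_false_eq_true] at hp <;>
    unfold BlockLeft at hl <;> unfold pairSig <;> cases k <;> cases k' <;>
    simp only [Kind.degrees, blockSig_even_zero, blockSig_odd_zero, blockSig_mixed_zero,
      blockSig_even_one, blockSig_odd_one, blockSig_mixed_one, SigF, ne_eq, not_true_eq_false,
      false_imp_iff, true_and, and_true, zero_ne_one, one_ne_zero, not_false_eq_true,
      true_imp_iff, sigMul] at h hp hl ⊢ <;>
    first
      | (refine Prod.ext ?_ ?_ <;> dsimp only <;> omega)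
      | (split_ifs <;> refine Prod.ext ?_ ?_ <;> dsimp only <;> omega)

end HookCrystal

namespace HookCrystal
variable {m n : ℕ}

/-! ### The place where `f` acts -/

section Pick

variable {ι : Type*} {k : Kind} {s s' : ι → ℕ × ℕ}

/-- The signature of a tensor product of elements with the signatures `s`. -/
def listSig (k : Kind) (s : ι → ℕ × ℕ) : List ι → ℕ × ℕ
  | [] => (0, 0)
  | c :: l => sigMul k (s c) (listSig k s l)

/-- The factor of a tensor product on which `f` acts. -/
def pick (k : Kind) (s : ι → ℕ × ℕ) : List ι → Option ι
  | [] => none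
  | c :: l => if SigF k (s c) (listSig k s l) then some c else pick k s l

theorem listSig_append (l l' : List ι) :
    listSig k s (l ++ l') = sigMul k (listSig k s l) (listSig k s l') := by
  induction l with
  | nil => simp [listSig]
  | cons c l ih => rw [List.cons_append, listSig, ih, listSig, sigMul_assoc]

theorem pick_append {l l' : List ι} (h : 0 < (listSig k s (l ++ l')).2) :
    pick k s (l ++ l') =
      if SigF k (listSig k s l) (listSig k s l') then pick k s l else pick k s l' := by
  induction l with
  | nil =>
    rw [if_neg]
    · rfl
    · intro hs
      have := (sigMul_snd_eq_zero (k := k) (a := (0, 0)) (b := listSig k s l')).2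
      rw [listSig] at hs
      rw [if_pos hs, sigMul_zero_left] at this
      rw [List.nil_append, this rfl] at h
      exact lt_irrefl _ h
  | cons c l ih =>
    rw [List.cons_append, listSig, pos_iff_ne_zero, Ne, sigMul_snd_eq_zero] at h
    rw [List.cons_append, pick, pick, listSig]
    split_ifs at h with hs
    · rw [if_pos hs]
      rw [listSig_append] at hs
      rw [if_pos hs.of_mul_right.1, if_pos hs.of_mul_right.2]
    · rw [if_neg hs, ih (pos_iff_ne_zero.2 h)]
      rw [listSig_append] at hs
      simp only [sigF_mul_left_iff hs]
      split_ifs with h1 h2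
      · exact absurd h2 (not_sigF_of_not_mul_right hs h1)
      · rfl
      · rfl

theorem listSig_congr {l : List ι} (h : ∀ c ∈ l, s c = s' c) : listSig k s l = listSig k s' l := by
  induction l with
  | nil => rfl
  | cons c l ih =>
    rw [listSig, listSig, h c (by simp), ih fun d hd => h d (by simp [hd])]

theorem pick_congr {l : List ι} (h : ∀ c ∈ l, s c = s' c) : pick k s l = pick k s' l := by
  induction l with
  | nil => rfl
  | cons c l ih =>
    rw [pick, pick, h c (by simp), ih fun d hd => h d (by simp [hd]),
      listSig_congr fun d hd => h d (by simp [hd])]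

theorem exists_pick {l : List ι} (h : 0 < (listSig k s l).2) :
    ∃ c ∈ l, pick k s l = some c ∧ 0 < (s c).2 := by
  induction l with
  | nil => simp [listSig] at h
  | cons c l ih =>
    rw [listSig, pos_iff_ne_zero, Ne, sigMul_snd_eq_zero] at h
    rw [pick]
    split_ifs at h with hs
    · exact ⟨c, by simp, by rw [if_pos hs], pos_iff_ne_zero.2 h⟩
    · obtain ⟨d, h1, h2, h3⟩ := ih (pos_iff_ne_zero.2 h)
      exact ⟨d, by simp [h1], by rw [if_neg hs, h2], h3⟩

theorem listSig_congr_pair {l₁ l₂ : List ι} {p q : ι} (h₁ : ∀ c ∈ l₁, s c = s' c)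
    (h₂ : ∀ c ∈ l₂, s c = s' c) (hpq : sigMul k (s p) (s q) = sigMul k (s' p) (s' q)) :
    listSig k s (l₁ ++ p :: q :: l₂) = listSig k s' (l₁ ++ p :: q :: l₂) := by
  simp only [listSig_append, listSig]
  rw [← sigMul_assoc k (s p), ← sigMul_assoc k (s' p), hpq, listSig_congr h₁, listSig_congr h₂]

theorem pick_pair {p q : ι} (h : 0 < (sigMul k (s p) (s q)).2) :
    pick k s [p, q] = some (if SigF k (s p) (s q) then p else q) := by
  rw [pos_iff_ne_zero, Ne, sigMul_snd_eq_zero] at h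
  have e : listSig k s [q] = s q := sigMul_zero_right k (s q)
  rw [pick, pick, e]
  split_ifs at h with h1
  · rw [if_pos h1, if_pos h1]
  · rw [if_neg h1, if_neg h1, if_pos]
    cases k <;> simp only [SigF, listSig] <;> omega

/-- If the product of two adjacent signatures does not change, then `f` acts at the same place, or
it acts on this pair before and after the change. -/
theorem pick_congr_pair {l₁ l₂ : List ι} {p q : ι} (h₁ : ∀ c ∈ l₁, s c = s' c)
    (h₂ : ∀ c ∈ l₂, s c = s' c) (hpq : sigMul k (s p) (s q) = sigMul k (s' p) (s' q))
    (h : 0 < (listSig k s (l₁ ++ p :: q :: l₂)).2) :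
    (∃ c, (c ∈ l₁ ∨ c ∈ l₂) ∧ pick k s (l₁ ++ p :: q :: l₂) = some c ∧
      pick k s' (l₁ ++ p :: q :: l₂) = some c) ∨
    (pick k s (l₁ ++ p :: q :: l₂) = some (if SigF k (s p) (s q) then p else q) ∧
      pick k s' (l₁ ++ p :: q :: l₂) = some (if SigF k (s' p) (s' q) then p else q) ∧
      0 < (sigMul k (s p) (s q)).2) := by
  have h' := h
  rw [listSig_congr_pair h₁ h₂ hpq] at h'
  have e : listSig k s' (p :: q :: l₂) = listSig k s (p :: q :: l₂) :=
    (listSig_congr_pair (l₁ := []) (by simp) h₂ hpq).symm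
  have e' : ∀ t : ι → ℕ × ℕ, listSig k t [p, q] = sigMul k (t p) (t q) := by
    intro t; simp [listSig]
  rw [pick_append h, pick_append h', e, ← listSig_congr h₁, ← pick_congr h₁]
  rw [listSig_append, pos_iff_ne_zero, Ne, sigMul_snd_eq_zero] at h
  split_ifs at h with hs
  · rw [if_pos hs, if_pos hs]
    obtain ⟨c, hc, hp, -⟩ := exists_pick (pos_iff_ne_zero.2 h)
    exact Or.inl ⟨c, Or.inl hc, hp, hp⟩
  · rw [if_neg hs, if_neg hs]
    have hpos := pos_iff_ne_zero.2 h
    have hpos' := hpos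
    rw [← e] at hpos'
    rw [show p :: q :: l₂ = [p, q] ++ l₂ from rfl] at h hpos hpos' ⊢
    rw [pick_append hpos, pick_append hpos', e', e', ← hpq, ← listSig_congr h₂, ← pick_congr h₂]
    rw [listSig_append, sigMul_snd_eq_zero, e'] at h
    split_ifs at h with hs
    · rw [if_pos hs, if_pos hs, pick_pair (pos_iff_ne_zero.2 h),
        pick_pair (hpq ▸ pos_iff_ne_zero.2 h)]
      exact Or.inr ⟨rfl, rfl, pos_iff_ne_zero.2 h⟩
    · rw [if_neg hs, if_neg hs]
      obtain ⟨c, hc, hp, -⟩ := exists_pick (pos_iff_ne_zero.2 h)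
      exact Or.inl ⟨c, Or.inr hc, hp, hp⟩

end Pick

/-! ### Products of sorted words -/

variable {u v : ℕ}

/-- The product of the sorted words with the multiplicities `z c`, for `c` in a list. -/
def colsWord (z : Letter u v → Letter m n → ℕ) (l : List (Letter u v)) : List (Letter m n) :=
  l.flatMap fun c => sortedWord (degree u v c) (z c)

/-- The signature of a factor of `colsWord`. -/
def colSig (i : Idx m n) (z : Letter u v → Letter m n → ℕ) (c : Letter u v) : ℕ × ℕ :=
  blockSig (kind i) (degree u v c) (z c (src i)) (z c (tgt i))

theorem colsWord_cons (z : Letter u v → Letter m n → ℕ) (c : Letter u v) (l : List (Letter u v)) :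
    colsWord z (c :: l) = sortedWord (degree u v c) (z c) ++ colsWord z l := rfl

theorem colsWord_congr {z z' : Letter u v → Letter m n → ℕ} {l : List (Letter u v)}
    (h : ∀ c ∈ l, z c = z' c) : colsWord z l = colsWord z' l := by
  induction l with
  | nil => rfl
  | cons c l ih =>
    rw [colsWord_cons, colsWord_cons, h c (by simp), ih fun d hd => h d (by simp [hd])]

theorem wordSig_colsWord (i : Idx m n) (z : Letter u v → Letter m n → ℕ) (l : List (Letter u v)) :
    wordSig i (colsWord z l) = listSig (kind i) (colSig i z) l := by
  induction l with
  | nil => rfl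
  | cons c l ih => rw [colsWord_cons, wordSig_append, ih, wordSig_sortedWord]; rfl

theorem degree_le (c : Letter u v) : degree u v c ≤ 1 := by
  unfold degree; split_ifs <;> omega

/-- f acts inside a single sorted factor and leaves it sorted, so its effect on a product is to
lower one list of multiplicities. -/
theorem wordF_colsWord {i : Idx m n} {z : Letter u v → Letter m n → ℕ} {l : List (Letter u v)}
    (hl : l.Nodup) (hz : ∀ c, Admissible (degree u v c) (z c)) {w : List (Letter m n)}
    (h : wordF m n i (colsWord z l) = some w) :
    ∃ c ∈ l, pick (kind i) (colSig i z) l = some c ∧ 0 < z c (src i) ∧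
      Admissible (degree u v c) (lower i (z c)) ∧
      w = colsWord (Function.update z c (lower i (z c))) l := by
  induction l generalizing w with
  | nil => simp [colsWord, wordF] at h
  | cons d l ih =>
    obtain ⟨hd, hl⟩ := List.nodup_cons.1 hl
    rw [colsWord_cons, wordF_append, wordSig_sortedWord, wordSig_colsWord] at h
    rw [pick]
    split_ifs at h with hs
    · obtain ⟨w', h1, rfl⟩ := Option.map_eq_some_iff.1 h
      have hpos : 0 < (blockSig (kind i) (degree u v d) (z d (src i)) (z d (tgt i))).2 := by
        rw [← wordSig_sortedWord, wordSig_snd, pos_iff_ne_zero, Ne, ← wordF_eq_none, h1]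
        simp
      obtain ⟨h2, h3, h4⟩ := wordF_sortedWord (degree_le d) (hz d) hpos
      refine ⟨d, by simp, if_pos hs, h3, h4, ?_⟩
      rw [colsWord_cons, Function.update_self, Option.some.inj (h1.symm.trans h2)]
      congr 1
      refine colsWord_congr fun c hc => ?_
      rw [Function.update_of_ne (by rintro rfl; exact hd hc)]
    · obtain ⟨w', h1, rfl⟩ := Option.map_eq_some_iff.1 h
      obtain ⟨c, h2, h3, h4, h5, rfl⟩ := ih hl h1
      refine ⟨c, by simp [h2], (if_neg hs).trans h3, h4, h5, ?_⟩
      rw [colsWord_cons, Function.update_of_ne (by rintro rfl; exact hd h2)]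

theorem wordE_colsWord {i : Idx m n} {z : Letter u v → Letter m n → ℕ} {l : List (Letter u v)}
    (hl : l.Nodup) (hz : ∀ c, Admissible (degree u v c) (z c)) {w : List (Letter m n)}
    (h : wordE m n i (colsWord z l) = some w) :
    ∃ c ∈ l, 0 < z c (tgt i) ∧ Admissible (degree u v c) (raise i (z c)) ∧
      w = colsWord (Function.update z c (raise i (z c))) l := by
  induction l generalizing w with
  | nil => simp [colsWord, wordE] at h
  | cons d l ih =>
    obtain ⟨hd, hl⟩ := List.nodup_cons.1 hl
    rw [colsWord_cons, wordE_append] at h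
    split_ifs at h with hs
    · obtain ⟨w', h1, rfl⟩ := Option.map_eq_some_iff.1 h
      have hpos : 0 < (blockSig (kind i) (degree u v d) (z d (src i)) (z d (tgt i))).1 := by
        rw [← wordSig_sortedWord, wordSig_fst, pos_iff_ne_zero, Ne, ← wordE_eq_none, h1]
        simp
      obtain ⟨h2, h3, h4⟩ := wordE_sortedWord (degree_le d) (hz d) hpos
      refine ⟨d, by simp, h3, h4, ?_⟩
      rw [colsWord_cons, Function.update_self, Option.some.inj (h1.symm.trans h2)]
      congr 1
      refine colsWord_congr fun c hc => ?_
      rw [Function.update_of_ne (by rintro rfl; exact hd hc)]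
    · obtain ⟨w', h1, rfl⟩ := Option.map_eq_some_iff.1 h
      obtain ⟨c, h2, h4, h5, rfl⟩ := ih hl h1
      refine ⟨c, by simp [h2], h4, h5, ?_⟩
      rw [colsWord_cons, Function.update_of_ne (by rintro rfl; exact hd h2)]

theorem sum_lower {i : Idx m n} {z : Letter m n → ℕ} (h : 0 < z (src i)) :
    ∑ b, lower i z b = ∑ b, z b := by
  have hne := src_ne_tgt i
  have h1 : ∀ b, lower i z b + Pi.single (M := fun _ => ℕ) (src i) 1 b =
      z b + Pi.single (M := fun _ => ℕ) (tgt i) 1 b := by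
    intro b
    unfold lower
    simp only [Pi.single_apply]
    split_ifs with h1 h2 <;> subst_vars <;> first | omega | exact absurd ‹_› hne
  have h2 := Finset.sum_congr (rfl : (Finset.univ : Finset (Letter m n)) = _) fun b _ => h1 b
  rw [Finset.sum_add_distrib, Finset.sum_add_distrib, Finset.sum_pi_single',
    Finset.sum_pi_single'] at h2
  simpa using h2

theorem sum_raise {i : Idx m n} {z : Letter m n → ℕ} (h : 0 < z (tgt i)) :
    ∑ b, raise i z b = ∑ b, z b := by
  have hne := src_ne_tgt i
  rw [← sum_lower (i := i) (z := raise i z) (by simp [raise])]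
  refine Finset.sum_congr rfl fun b _ => ?_
  unfold lower raise
  split_ifs with h1 h2 <;> subst_vars <;> omega

/-! ### The crystal of matrices -/

/-- One Kashiwara operator, `f_i` for `(true, i)` and `e_i` for `(false, i)`. -/
def CrystalData.op {X : Type*} (D : CrystalData m n X) (o : Bool × Idx m n) (x : X) : Option X :=
  if o.1 then D.f o.2 x else D.e o.2 x

/-- The columns of a matrix. -/
def cols (A : Matrix (Letter m n) (Letter u v) ℕ) : Letter u v → Letter m n → ℕ := fun c b => A b c

/-- The matrix `A` with another column `c`. -/
def setCol (A : Matrix (Letter m n) (Letter u v) ℕ) (c : Letter u v) (z : Letter m n → ℕ) :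
    Matrix (Letter m n) (Letter u v) ℕ := Matrix.of fun b d => if d = c then z b else A b d

theorem cols_setCol (A : Matrix (Letter m n) (Letter u v) ℕ) (c : Letter u v)
    (z : Letter m n → ℕ) : cols (setCol A c z) = Function.update (cols A) c z := by
  ext d b
  by_cases h : d = c
  · subst h; simp [cols, setCol]
  · simp [cols, setCol, h]

theorem wordI_eq (A : Matrix (Letter m n) (Letter u v) ℕ) :
    wordI A = colsWord (cols A) (List.finRange (u + v)) := by
  simp only [wordI, biword, colsWord, sortedWord, List.map_flatMap, List.map_replicate]
  rfl

/-- The second word depends only on the column sums, which the operators within columns preserve. -/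
theorem wordJ_eq (A : Matrix (Letter m n) (Letter u v) ℕ) :
    wordJ A = (List.finRange (u + v)).flatMap fun c => List.replicate (∑ b, A b c) c := by
  have key : ∀ (c : Letter u v) (l : List (Letter m n)),
      (l.flatMap fun b => List.replicate (A b c) c) =
        List.replicate (l.flatMap fun b => List.replicate (A b c) b).length c := by
    intro c l
    rw [List.eq_replicate_iff]
    refine ⟨by simp [List.length_flatMap], fun d hd => ?_⟩
    obtain ⟨b, -, hb⟩ := List.mem_flatMap.1 hd
    exact List.eq_of_mem_replicate hb
  simp only [wordJ, biword, List.map_flatMap, List.map_replicate]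
  congr 1
  ext1 c
  rw [key]
  congr 1
  exact length_sortedWord (degree u v c) fun b => A b c

theorem biword_eq_zip (A : Matrix (Letter m n) (Letter u v) ℕ) :
    biword A = (wordI A).zip (wordJ A) :=
  List.zip_of_prod rfl rfl

theorem mem_matrices_iff {A : Matrix (Letter m n) (Letter u v) ℕ} :
    A ∈ matrices m n u v ↔ ∀ c, Admissible (degree u v c) (cols A c) :=
  ⟨fun h c b => h b c, fun h b c => h c b⟩

theorem transpose_mem_matrices {A : Matrix (Letter m n) (Letter u v) ℕ} :
    A.transpose ∈ matrices u v m n ↔ A ∈ matrices m n u v :=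
  ⟨fun h b c hd => h c b hd.symm, fun h c b hd => h b c hd.symm⟩

/-- The matrix `A` with `f_i` applied to its column `c`. -/
def moveCol (i : Idx m n) (c : Letter u v) (A : Matrix (Letter m n) (Letter u v) ℕ) :
    Matrix (Letter m n) (Letter u v) ℕ :=
  setCol A c (lower i (cols A c))

theorem moveCol_apply (i : Idx m n) (c : Letter u v) (A : Matrix (Letter m n) (Letter u v) ℕ)
    (b : Letter m n) (d : Letter u v) : moveCol i c A b d =
      if d = c then (if b = src i then A b d - 1 else if b = tgt i then A b d + 1 else A b d)
      else A b d := by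
  by_cases h : d = c
  · subst h; simp [moveCol, setCol, lower, cols]
  · simp [moveCol, setCol, h]

theorem setCol_mem_matrices {A : Matrix (Letter m n) (Letter u v) ℕ} (hA : A ∈ matrices m n u v)
    {c : Letter u v} {z : Letter m n → ℕ} (hz : Admissible (degree u v c) z) :
    setCol A c z ∈ matrices m n u v := by
  rw [mem_matrices_iff] at hA ⊢
  intro d
  rw [cols_setCol]
  by_cases h : d = c
  · subst h; rwa [Function.update_self]
  · rw [Function.update_of_ne h]; exact hA d

theorem wordJ_setCol (A : Matrix (Letter m n) (Letter u v) ℕ) {c : Letter u v}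
    {z : Letter m n → ℕ} (hz : ∑ b, z b = ∑ b, A b c) : wordJ (setCol A c z) = wordJ A := by
  rw [wordJ_eq, wordJ_eq]
  congr 1
  ext1 d
  congr 1
  by_cases h : d = c
  · subst h; simpa [setCol] using hz
  · simp [setCol, h]

theorem toMatrix_zip_wordJ {A B : Matrix (Letter m n) (Letter u v) ℕ} (h : wordJ B = wordJ A) :
    toMatrix ((wordI B).zip (wordJ A)) = B := by
  rw [← h, ← biword_eq_zip, toMatrix_biword]

theorem exists_wordI_of_wordOp {A : Matrix (Letter m n) (Letter u v) ℕ}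
    (hA : A ∈ matrices m n u v) {o : Bool × Idx m n} {w : List (Letter m n)}
    (h : wordOp o (wordI A) = some w) :
    ∃ B ∈ matrices m n u v, wordI B = w ∧ wordJ B = wordJ A := by
  obtain ⟨b, i⟩ := o
  have hz := mem_matrices_iff.1 hA
  rw [wordI_eq] at h
  cases b
  · obtain ⟨c, -, h1, h2, rfl⟩ := wordE_colsWord (List.nodup_finRange _) hz h
    refine ⟨_, setCol_mem_matrices hA h2, ?_, wordJ_setCol A (sum_raise h1)⟩
    rw [wordI_eq, cols_setCol]
  · obtain ⟨c, -, -, h1, h2, rfl⟩ := wordF_colsWord (List.nodup_finRange _) hz h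
    refine ⟨_, setCol_mem_matrices hA h2, ?_, wordJ_setCol A (sum_lower h1)⟩
    rw [wordI_eq, cols_setCol]

theorem left_op_eq (A : Matrix (Letter m n) (Letter u v) ℕ) (o : Bool × Idx m n) :
    (matrixData m n u v).left.op o A =
      (wordOp o (wordI A)).map fun w => toMatrix (w.zip (wordJ A)) := by
  obtain ⟨b, i⟩ := o
  cases b <;> rfl

/-- A matrix is determined by its two words, and the new word is again the sorted first word of a
matrix with the same second word. The condition becomes symmetric in `A` and `B` when the operator
is inverted. -/
theorem left_op_iff {A B : Matrix (Letter m n) (Letter u v) ℕ} (hA : A ∈ matrices m n u v)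
    {o : Bool × Idx m n} : (matrixData m n u v).left.op o A = some B ↔
      B ∈ matrices m n u v ∧ wordOp o (wordI A) = some (wordI B) ∧ wordJ B = wordJ A := by
  rw [left_op_eq]
  constructor
  · intro h
    obtain ⟨w, hw, rfl⟩ := Option.map_eq_some_iff.1 h
    obtain ⟨B, h1, rfl, h3⟩ := exists_wordI_of_wordOp hA hw
    rw [toMatrix_zip_wordJ h3]
    exact ⟨h1, hw, h3⟩
  · rintro ⟨-, h2, h3⟩
    rw [h2, Option.map_some, toMatrix_zip_wordJ h3]

theorem left_f_eq {A : Matrix (Letter m n) (Letter u v) ℕ} (hA : A ∈ matrices m n u v) {i : Idx m n}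
    (h : 0 < (wordSig i (wordI A)).2) : ∃ c, 0 < A (src i) c ∧
      pick (kind i) (colSig i (cols A)) (List.finRange (u + v)) = some c ∧
      (matrixData m n u v).left.op (true, i) A = some (moveCol i c A) := by
  obtain ⟨w, hw⟩ : ∃ w, wordF m n i (wordI A) = some w := by
    rw [← Option.ne_none_iff_exists', Ne, wordF_eq_none, ← wordSig_snd]
    exact h.ne'
  have hw' := hw
  rw [wordI_eq] at hw'
  obtain ⟨c, -, h1, h2, h3, rfl⟩ :=
    wordF_colsWord (List.nodup_finRange _) (mem_matrices_iff.1 hA) hw'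
  refine ⟨c, h2, h1, (left_op_iff hA).2 ⟨setCol_mem_matrices hA h3, ?_, ?_⟩⟩
  · rw [wordI_eq (moveCol i c A), moveCol, cols_setCol]; exact hw
  · exact wordJ_setCol A (sum_lower h2)

theorem wordL_eq (A : Matrix (Letter m n) (Letter u v) ℕ) : wordL A = wordI A.transpose := by
  simp [wordL, cobiword, wordI]

theorem wordK_eq (A : Matrix (Letter m n) (Letter u v) ℕ) : wordK A = wordJ A.transpose := by
  simp [wordK, cobiword, wordJ]

/-- All statements about the second structure follow from the first one by transposition. -/
theorem right_op_eq (A : Matrix (Letter m n) (Letter u v) ℕ) (o : Bool × Idx u v) :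
    (matrixData m n u v).right.op o A =
      ((matrixData u v m n).left.op o A.transpose).map Matrix.transpose := by
  have key : ∀ (x : List (Letter m n)) (y : List (Letter u v)),
      toMatrix (x.zip y) = (toMatrix (y.zip x)).transpose := by
    intro x y
    ext b c
    simp only [toMatrix, Matrix.of_apply, Matrix.transpose_apply]
    rw [← List.zip_swap, show (b, c) = Prod.swap (c, b) from rfl,
      List.count_map_of_injective _ _ Prod.swap_injective]
  rw [left_op_eq, Option.map_map]
  obtain ⟨b, j⟩ := o
  cases b <;>
  · simp only [CrystalData.op, matrixData, wordOp, wordL_eq, wordK_eq, key]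
    rfl

end HookCrystal

namespace HookCrystal
variable {m n u v : ℕ}

/-! ### The two crystal structures on matrices commute -/

theorem degrees_kind (i : Idx m n) :
    (kind i).degrees = (degree m n (src i), degree m n (tgt i)) := by
  rcases degree_src_tgt i with ⟨h, h1, h2⟩ | ⟨h, h1, h2⟩ | ⟨h, h1, h2⟩ <;>
    rw [h, h1, h2] <;> rfl

/-- The signature of the block of the letters of the colours `i` and `j`. -/
def matPair (i : Idx m n) (j : Idx u v) (A : Matrix (Letter m n) (Letter u v) ℕ) : ℕ × ℕ :=
  pairSig (kind i) (kind j) (A (src i) (src j)) (A (src i) (tgt j)) (A (tgt i) (src j))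
    (A (tgt i) (tgt j))

/-- The column of the block of the letters of the colours `i` and `j` on which `f_i` acts. -/
def matPick (i : Idx m n) (j : Idx u v) (A : Matrix (Letter m n) (Letter u v) ℕ) : Letter u v :=
  if BlockLeft (kind i) (kind j) (A (src i) (src j)) (A (src i) (tgt j)) (A (tgt i) (src j))
    (A (tgt i) (tgt j)) then src j else tgt j

/-- The column on which `f_i` acts. -/
def colPick (i : Idx m n) (A : Matrix (Letter m n) (Letter u v) ℕ) : Option (Letter u v) :=
  pick (kind i) (colSig i (cols A)) (List.finRange (u + v))

theorem wordSig_wordI (i : Idx m n) (A : Matrix (Letter m n) (Letter u v) ℕ) :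
    wordSig i (wordI A) = listSig (kind i) (colSig i (cols A)) (List.finRange (u + v)) := by
  rw [wordI_eq, wordSig_colsWord]

theorem sigMul_colSig (i : Idx m n) (j : Idx u v) (A : Matrix (Letter m n) (Letter u v) ℕ) :
    sigMul (kind i) (colSig i (cols A) (src j)) (colSig i (cols A) (tgt j)) = matPair i j A := by
  simp only [matPair, pairSig, degrees_kind]
  rfl

theorem ite_sigF_colSig (i : Idx m n) (j : Idx u v) (A : Matrix (Letter m n) (Letter u v) ℕ) :
    (if SigF (kind i) (colSig i (cols A) (src j)) (colSig i (cols A) (tgt j)) then src j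
      else tgt j) = matPick i j A := by
  simp only [matPick, BlockLeft, degrees_kind]
  rfl

/-- The columns `src j` and `tgt j` are adjacent in the reading, so only the product of their
signatures enters. -/
theorem wordSig_eq_of_matPair {i : Idx m n} {j : Idx u v}
    {A A' : Matrix (Letter m n) (Letter u v) ℕ}
    (h : ∀ d, d ≠ src j → d ≠ tgt j → colSig i (cols A) d = colSig i (cols A') d)
    (hp : matPair i j A = matPair i j A') : wordSig i (wordI A) = wordSig i (wordI A') := by
  obtain ⟨L, R, hLR, h1, h2, h3, h4⟩ := exists_finRange_eq j
  rw [wordSig_wordI, wordSig_wordI, hLR]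
  refine listSig_congr_pair (fun c hc => h c ?_ ?_) (fun c hc => h c ?_ ?_) ?_
  · rintro rfl; exact h1 hc
  · rintro rfl; exact h2 hc
  · rintro rfl; exact h3 hc
  · rintro rfl; exact h4 hc
  · rw [sigMul_colSig, sigMul_colSig, hp]

theorem colPick_of_matPair {i : Idx m n} {j : Idx u v}
    {A A' : Matrix (Letter m n) (Letter u v) ℕ}
    (h : ∀ d, d ≠ src j → d ≠ tgt j → colSig i (cols A) d = colSig i (cols A') d)
    (hp : matPair i j A = matPair i j A') (hpos : 0 < (wordSig i (wordI A)).2) :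
    (∃ c, c ≠ src j ∧ c ≠ tgt j ∧ colPick i A = some c ∧ colPick i A' = some c) ∨
      (colPick i A = some (matPick i j A) ∧ colPick i A' = some (matPick i j A') ∧
        0 < (matPair i j A).2) := by
  obtain ⟨L, R, hLR, h1, h2, h3, h4⟩ := exists_finRange_eq j
  rw [wordSig_wordI, hLR] at hpos
  unfold colPick
  rw [hLR]
  have key := pick_congr_pair (k := kind i) (s := colSig i (cols A)) (s' := colSig i (cols A'))
    (l₁ := L) (l₂ := R) (p := src j) (q := tgt j)
    (fun c hc => h c (by rintro rfl; exact h1 hc) (by rintro rfl; exact h2 hc))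
    (fun c hc => h c (by rintro rfl; exact h3 hc) (by rintro rfl; exact h4 hc))
    (by rw [sigMul_colSig, sigMul_colSig, hp]) hpos
  rw [ite_sigF_colSig, ite_sigF_colSig, sigMul_colSig] at key
  rcases key with ⟨c, hc, k1, k2⟩ | key
  · refine Or.inl ⟨c, ?_, ?_, k1, k2⟩
    · rintro rfl; exact hc.elim h1 h3
    · rintro rfl; exact hc.elim h2 h4
  · exact Or.inr key

theorem colPick_cases {i : Idx m n} (j : Idx u v) {A : Matrix (Letter m n) (Letter u v) ℕ}
    (hpos : 0 < (wordSig i (wordI A)).2) {c : Letter u v} (hc : colPick i A = some c) :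
    (c ≠ src j ∧ c ≠ tgt j) ∨ (c = matPick i j A ∧ 0 < (matPair i j A).2) := by
  rcases colPick_of_matPair (j := j) (fun _ _ _ => rfl) rfl hpos with
    ⟨d, h1, h2, h3, -⟩ | ⟨h1, -, h2⟩
  · obtain rfl := Option.some.inj (hc.symm.trans h3)
    exact Or.inl ⟨h1, h2⟩
  · exact Or.inr ⟨Option.some.inj (hc.symm.trans h1), h2⟩

theorem blockAdm {A : Matrix (Letter m n) (Letter u v) ℕ} (hA : A ∈ matrices m n u v) (i : Idx m n)
    (j : Idx u v) : BlockAdm (kind i) (kind j) (A (src i) (src j)) (A (src i) (tgt j))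
      (A (tgt i) (src j)) (A (tgt i) (tgt j)) := by
  unfold BlockAdm
  rw [degrees_kind, degrees_kind]
  exact ⟨hA _ _, hA _ _, hA _ _, hA _ _⟩

/-- The matrix `A` with `f_j` applied to its row `r`. -/
def moveRow (j : Idx u v) (r : Letter m n) (A : Matrix (Letter m n) (Letter u v) ℕ) :
    Matrix (Letter m n) (Letter u v) ℕ := (moveCol j r A.transpose).transpose

theorem moveRow_apply (j : Idx u v) (r : Letter m n) (A : Matrix (Letter m n) (Letter u v) ℕ)
    (b : Letter m n) (d : Letter u v) : moveRow j r A b d =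
      if b = r then (if d = src j then A b d - 1 else if d = tgt j then A b d + 1 else A b d)
      else A b d := moveCol_apply j r A.transpose d b

theorem colSig_moveRow (i : Idx m n) (j : Idx u v) (r : Letter m n)
    (A : Matrix (Letter m n) (Letter u v) ℕ) {d : Letter u v} (h : d ≠ src j) (h' : d ≠ tgt j) :
    colSig i (cols (moveRow j r A)) d = colSig i (cols A) d := by
  simp [colSig, cols, moveRow_apply, h, h']

/-- Either the changed row lies outside the two rows of the colour `i`, and the block is untouched,
or the change is the block operation of `pairSig_move`. -/
theorem matPair_moveRow {A : Matrix (Letter m n) (Letter u v) ℕ} (hA : A ∈ matrices m n u v)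
    (i : Idx m n) {j : Idx u v} (hpos : 0 < (wordSig j (wordI A.transpose)).2) {r : Letter m n}
    (hr : colPick j A.transpose = some r) : matPair i j (moveRow j r A) = matPair i j A := by
  have h1 := src_ne_tgt i
  have h2 := src_ne_tgt j
  rcases colPick_cases i hpos hr with ⟨h3, h4⟩ | ⟨rfl, h3⟩
  · simp [matPair, moveRow_apply, h3.symm, h4.symm]
  · obtain ⟨k1, k2⟩ := pairSig_move (blockAdm hA i j) h3
    unfold matPick
    split_ifs with hb
    · simpa [matPair, moveRow_apply, h1.symm, h2.symm] using k1 hb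
    · simpa [matPair, moveRow_apply, h1, h2.symm] using k2 hb

theorem wordSig_moveRow {A : Matrix (Letter m n) (Letter u v) ℕ} (hA : A ∈ matrices m n u v)
    (i : Idx m n) {j : Idx u v} (hpos : 0 < (wordSig j (wordI A.transpose)).2) {r : Letter m n}
    (hr : colPick j A.transpose = some r) :
    wordSig i (wordI (moveRow j r A)) = wordSig i (wordI A) :=
  wordSig_eq_of_matPair (fun _ h h' => colSig_moveRow i j r A h h') (matPair_moveRow hA i hpos hr)

theorem transpose_moveCol (i : Idx m n) (c : Letter u v) (A : Matrix (Letter m n) (Letter u v) ℕ) :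
    (moveCol i c A).transpose = moveRow i c A.transpose := rfl

theorem moveRow_moveCol_of_ne {i : Idx m n} {j : Idx u v} {r : Letter m n} {c : Letter u v}
    (A : Matrix (Letter m n) (Letter u v) ℕ)
    (h : (r ≠ src i ∧ r ≠ tgt i) ∨ (c ≠ src j ∧ c ≠ tgt j)) :
    moveRow j r (moveCol i c A) = moveCol i c (moveRow j r A) := by
  ext b d
  simp only [moveRow_apply, moveCol_apply]
  rcases h with ⟨h1, h2⟩ | ⟨h1, h2⟩
  · by_cases hb : b = r
    · subst hb; simp [h1, h2]
    · simp [hb]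
  · by_cases hd : d = c
    · subst hd; simp [h1, h2]
    · simp [hd]

/-- The case in which both operators work inside the block; there `blockF_comm` applies, and no
entry outside the block changes. -/
theorem moveRow_moveCol_matPick {A : Matrix (Letter m n) (Letter u v) ℕ}
    (hA : A ∈ matrices m n u v) {i : Idx m n} {j : Idx u v} (h : 0 < (matPair i j A).2)
    (h' : 0 < (matPair j i A.transpose).2) :
    moveRow j (matPick j i (moveCol i (matPick i j A) A).transpose) (moveCol i (matPick i j A) A) =
      moveCol i (matPick i j (moveRow j (matPick j i A.transpose) A))
        (moveRow j (matPick j i A.transpose) A) := by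
  have h1 := src_ne_tgt i
  have h2 := src_ne_tgt j
  let quad (B : Matrix (Letter m n) (Letter u v) ℕ) : ℕ × ℕ × ℕ × ℕ :=
    (B (src i) (src j), B (src i) (tgt j), B (tgt i) (src j), B (tgt i) (tgt j))
  have e1 : ∀ B, quad (moveCol i (matPick i j B) B) = blockF (kind i) (kind j) (quad B) := by
    intro B
    simp only [quad, blockF, matPick]
    split_ifs with hb
    · simp [moveCol_apply, h1.symm, h2.symm]
    · simp [moveCol_apply, h1.symm, h2]
  have e2 : ∀ B, quad (moveRow j (matPick j i B.transpose) B) =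
      blockT (blockF (kind j) (kind i) (blockT (quad B))) := by
    intro B
    by_cases hb : BlockLeft (kind j) (kind i) (B (src i) (src j)) (B (tgt i) (src j))
        (B (src i) (tgt j)) (B (tgt i) (tgt j))
    · rw [show matPick j i B.transpose = src i from if_pos hb,
        show blockF (kind j) (kind i) (blockT (quad B)) = _ from if_pos hb]
      simp [quad, blockT, moveRow_apply, h1.symm, h2.symm]
    · rw [show matPick j i B.transpose = tgt i from if_neg hb,
        show blockF (kind j) (kind i) (blockT (quad B)) = _ from if_neg hb]
      simp [quad, blockT, moveRow_apply, h1, h2.symm]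
  have key := blockF_comm (blockAdm hA i j) h h'
  change blockT (blockF _ _ (blockT (blockF _ _ (quad A)))) =
    blockF _ _ (blockT (blockF _ _ (blockT (quad A)))) at key
  rw [← e1, ← e2, ← e2, ← e1] at key
  simp only [quad, Prod.mk.injEq] at key
  have hrow : ∀ B : Matrix (Letter u v) (Letter m n) ℕ, matPick j i B = src i ∨
      matPick j i B = tgt i := by
    intro B; unfold matPick; split_ifs <;> simp
  have hcol : ∀ B : Matrix (Letter m n) (Letter u v) ℕ, matPick i j B = src j ∨
      matPick i j B = tgt j := by
    intro B; unfold matPick; split_ifs <;> simp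
  have out : ∀ (r r' : Letter m n) (c c' : Letter u v), (r = src i ∨ r = tgt i) →
      (r' = src i ∨ r' = tgt i) → (c = src j ∨ c = tgt j) → (c' = src j ∨ c' = tgt j) → ∀ b d,
      ((b ≠ src i ∧ b ≠ tgt i) ∨ (d ≠ src j ∧ d ≠ tgt j)) →
      moveRow j r' (moveCol i c A) b d = A b d ∧ moveCol i c' (moveRow j r A) b d = A b d := by
    intro r r' c c' hr hr' hc hc' b d hbd
    simp only [moveRow_apply, moveCol_apply]
    rcases hbd with ⟨g1, g2⟩ | ⟨g1, g2⟩
    · have hbr : b ≠ r := by rcases hr with rfl | rfl <;> assumption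
      have hbr' : b ≠ r' := by rcases hr' with rfl | rfl <;> assumption
      simp [g1, g2, hbr, hbr']
    · have hdc : d ≠ c := by rcases hc with rfl | rfl <;> assumption
      have hdc' : d ≠ c' := by rcases hc' with rfl | rfl <;> assumption
      simp [g1, g2, hdc, hdc']
  ext b d
  by_cases hbd : (b ≠ src i ∧ b ≠ tgt i) ∨ (d ≠ src j ∧ d ≠ tgt j)
  · obtain ⟨g1, g2⟩ := out _ _ _ _ (hrow A.transpose) (hrow _) (hcol A) (hcol _) b d hbd
    exact g1.trans g2.symm
  · have hb : b = src i ∨ b = tgt i := by tauto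
    have hd : d = src j ∨ d = tgt j := by tauto
    rcases hb with rfl | rfl <;> rcases hd with rfl | rfl
    · exact key.1
    · exact key.2.1
    · exact key.2.2.1
    · exact key.2.2.2

/-- Each operator either acts away from the block, at a place that the other does not influence, or
selects a row or column of the block. If at least one acts away, the block data deciding the place
of the other are unchanged and the moves commute; otherwise the computation is inside the block. -/
theorem moveRow_moveCol {A : Matrix (Letter m n) (Letter u v) ℕ} (hA : A ∈ matrices m n u v)
    {i : Idx m n} {j : Idx u v} (hpos : 0 < (wordSig i (wordI A)).2)
    (hpos' : 0 < (wordSig j (wordI A.transpose)).2) {c c' : Letter u v} {r r' : Letter m n}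
    (hc : colPick i A = some c) (hr : colPick j A.transpose = some r)
    (hc' : colPick i (moveRow j r A) = some c')
    (hr' : colPick j (moveCol i c A).transpose = some r') :
    moveRow j r' (moveCol i c A) = moveCol i c' (moveRow j r A) := by
  have hA' := transpose_mem_matrices.2 hA
  have kc := colPick_of_matPair (fun _ h h' => (colSig_moveRow i j r A h h').symm)
    (matPair_moveRow hA i hpos' hr).symm hpos
  have kr := colPick_of_matPair (fun _ h h' => (colSig_moveRow j i c A.transpose h h').symm)
    (matPair_moveRow hA' j hpos hc).symm hpos'
  rw [hc, hc'] at kc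
  rw [← transpose_moveCol, hr, hr'] at kr
  rcases kc with ⟨d, h1, h2, h3, h4⟩ | ⟨h1, h2, h3⟩
  · obtain rfl := Option.some.inj h3
    obtain rfl := Option.some.inj h4
    have : r' = r := by
      rcases kr with ⟨_, -, -, h5, h6⟩ | ⟨h5, h6, -⟩
      · exact Option.some.inj (h6.trans h5.symm)
      · rw [Option.some.inj h5, Option.some.inj h6]
        exact if_congr (by simp [moveCol_apply, h1.symm, h2.symm]) rfl rfl
    rw [this]
    exact moveRow_moveCol_of_ne A (Or.inr ⟨h1, h2⟩)
  · rcases kr with ⟨_, g1, g2, g3, g4⟩ | ⟨g1, g2, g3⟩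
    · obtain rfl := Option.some.inj g3
      obtain rfl := Option.some.inj g4
      have : c' = c := by
        rw [Option.some.inj h1, Option.some.inj h2]
        exact if_congr (by simp [moveRow_apply, g1.symm, g2.symm]) rfl rfl
      rw [this]
      exact moveRow_moveCol_of_ne A (Or.inl ⟨g1, g2⟩)
    · have := moveRow_moveCol_matPick hA h3 g3
      rw [Option.some.inj h1] at g2 ⊢
      rw [Option.some.inj g1] at h2 ⊢
      rw [Option.some.inj h2, Option.some.inj g2]
      exact this

end HookCrystal

namespace HookCrystal
variable {m n u v : ℕ}

/-! ### Crystals and bicrystals -/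

/-- The axioms are pulled back from words along `ρ`. The datum `κ`, which every operator preserves,
is the shape for tableaux and the second word for matrices. -/
theorem isCrystal_of_word {X K : Type*} {D : CrystalData m n X} {S : Set X}
    (ρ : X → List (Letter m n)) (κ : X → K) (hwt : ∀ x, D.wt x = wordWt m n (ρ x))
    (heps : ∀ i x, D.eps i x = wordEps m n i (ρ x)) (hphi : ∀ i x, D.phi i x = wordPhi m n i (ρ x))
    (hop : ∀ x ∈ S, ∀ o y, D.op o x = some y ↔
      y ∈ S ∧ wordOp o (ρ x) = some (ρ y) ∧ κ y = κ x) : IsCrystal D S := by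
  have hf : ∀ x ∈ S, ∀ i y, D.f i x = some y ↔
      y ∈ S ∧ wordF m n i (ρ x) = some (ρ y) ∧ κ y = κ x := fun x hx i y => hop x hx (true, i) y
  have he : ∀ x ∈ S, ∀ i y, D.e i x = some y ↔
      y ∈ S ∧ wordE m n i (ρ x) = some (ρ y) ∧ κ y = κ x := fun x hx i y => hop x hx (false, i) y
  have hfe : ∀ i, ∀ x ∈ S, ∀ y ∈ S, D.f i x = some y ↔ D.e i y = some x := by
    intro i x hx y hy
    rw [hf x hx, he y hy, wordF_iff_wordE, eq_comm (a := κ y)]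
    tauto
  have hspec : ∀ i, ∀ x ∈ S, ∀ y, D.f i x = some y →
      D.eps i y = D.eps i x + 1 ∧ (D.phi i y : ℤ) = D.phi i x - 1 ∧
        D.wt y = D.wt x - root m n i := by
    intro i x hx y h
    obtain ⟨-, h1, -⟩ := (hf x hx i y).1 h
    obtain ⟨h2, h3⟩ := wordF_shift h1
    simp only [wordSig_fst, wordSig_snd] at h2 h3
    rw [heps, heps, hphi, hphi, hwt, hwt, h2, h3]
    refine ⟨rfl, by push_cast; ring, wordF_wt h1⟩
  refine ⟨fun i x hx y h => ((he x hx i y).1 h).1, fun i x hx y h => ((hf x hx i y).1 h).1,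
    ?_, ?_, ?_, ?_, hspec, hfe⟩
  · intro i hi x _
    rw [heps, hphi, hwt]
    exact (wordSig_spec i (ρ x)).1 hi
  · intro i hi x _
    rw [hwt]
    exact ((wordSig_spec i (ρ x)).2 hi).1
  · intro i hi x _
    rw [heps, hphi, hwt]
    exact ((wordSig_spec i (ρ x)).2 hi).2
  · intro i x hx y h
    obtain ⟨h1, h2, h3⟩ := hspec i y ((he x hx i y).1 h).1 x
      ((hfe i y ((he x hx i y).1 h).1 x hx).2 h)
    refine ⟨by omega, by omega, by rw [h3]; abel⟩

theorem IsCrystal.mono {X : Type*} {D : CrystalData m n X} {S C : Set X} (h : IsCrystal D S)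
    (hC : C ⊆ S) (he : ∀ i, ∀ b ∈ C, ∀ b', D.e i b = some b' → b' ∈ C)
    (hf : ∀ i, ∀ b ∈ C, ∀ b', D.f i b = some b' → b' ∈ C) : IsCrystal D C where
  e_mem := he
  f_mem := hf
  phi_sub_eps i hi b hb := h.phi_sub_eps i hi b (hC hb)
  coroot_zero_nonneg i hi b hb := h.coroot_zero_nonneg i hi b (hC hb)
  phi_add_eps i hi b hb := h.phi_add_eps i hi b (hC hb)
  e_spec i b hb := h.e_spec i b (hC hb)
  f_spec i b hb := h.f_spec i b (hC hb)
  f_iff_e i b hb b' hb' := h.f_iff_e i b (hC hb) b' (hC hb')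

theorem isBicrystal_prod {X Y : Type*} {D : CrystalData m n X} {E : CrystalData u v Y} {S : Set X}
    {T : Set Y} (hD : IsCrystal D S) (hE : IsCrystal E T) :
    IsBicrystal (prodData D E) (S ×ˢ T) := by
  have comm : ∀ (x : X → Option X) (y : Y → Option Y) (p : X × Y),
      CommuteAt (fun p : X × Y => (x p.1).map fun z => (z, p.2))
        (fun p : X × Y => (y p.2).map fun z => (p.1, z)) p := by
    intro x y p
    unfold CommuteAt
    cases hx : x p.1 <;> cases hy : y p.2 <;> simp [hx, hy]
  have hl : ∀ (x : X → Option X), (∀ b ∈ S, ∀ b', x b = some b' → b' ∈ S) →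
      ∀ p ∈ S ×ˢ T, ∀ q, ((x p.1).map fun z => (z, p.2)) = some q → q ∈ S ×ˢ T := by
    rintro x hx ⟨a, b⟩ ⟨ha, hb⟩ q hq
    obtain ⟨z, hz, rfl⟩ := Option.map_eq_some_iff.1 hq
    exact ⟨hx _ ha _ hz, hb⟩
  have hr : ∀ (y : Y → Option Y), (∀ b ∈ T, ∀ b', y b = some b' → b' ∈ T) →
      ∀ p ∈ S ×ˢ T, ∀ q, ((y p.2).map fun z => (p.1, z)) = some q → q ∈ S ×ˢ T := by
    rintro y hy ⟨a, b⟩ ⟨ha, hb⟩ q hq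
    obtain ⟨z, hz, rfl⟩ := Option.map_eq_some_iff.1 hq
    exact ⟨ha, hy _ hb _ hz⟩
  refine ⟨⟨fun i => hl _ (hD.e_mem i), fun i => hl _ (hD.f_mem i),
      fun i hi p hp => hD.phi_sub_eps i hi p.1 hp.1,
      fun i hi p hp => hD.coroot_zero_nonneg i hi p.1 hp.1,
      fun i hi p hp => hD.phi_add_eps i hi p.1 hp.1, ?_, ?_, ?_⟩,
    ⟨fun i => hr _ (hE.e_mem i), fun i => hr _ (hE.f_mem i),
      fun i hi p hp => hE.phi_sub_eps i hi p.2 hp.2,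
      fun i hi p hp => hE.coroot_zero_nonneg i hi p.2 hp.2,
      fun i hi p hp => hE.phi_add_eps i hi p.2 hp.2, ?_, ?_, ?_⟩,
    fun i j p _ => comm _ _ p, fun i j p _ => comm _ _ p, fun i j p _ => comm _ _ p,
    fun i j p _ => comm _ _ p⟩
  · intro i p hp q hq
    obtain ⟨z, hz, rfl⟩ := Option.map_eq_some_iff.1 hq
    exact hD.e_spec i p.1 hp.1 z hz
  · intro i p hp q hq
    obtain ⟨z, hz, rfl⟩ := Option.map_eq_some_iff.1 hq
    exact hD.f_spec i p.1 hp.1 z hz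
  · rintro i ⟨a, b⟩ ⟨ha, hb⟩ ⟨a', b'⟩ ⟨ha', hb'⟩
    have := hD.f_iff_e i a ha a' ha'
    simp only [prodData, Option.map_eq_some_iff, Prod.mk.injEq]
    constructor
    · rintro ⟨z, hz, rfl, rfl⟩; exact ⟨a, this.1 hz, rfl, rfl⟩
    · rintro ⟨z, hz, rfl, rfl⟩; exact ⟨a', this.2 hz, rfl, rfl⟩
  · intro i p hp q hq
    obtain ⟨z, hz, rfl⟩ := Option.map_eq_some_iff.1 hq
    exact hE.e_spec i p.2 hp.2 z hz
  · intro i p hp q hq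
    obtain ⟨z, hz, rfl⟩ := Option.map_eq_some_iff.1 hq
    exact hE.f_spec i p.2 hp.2 z hz
  · rintro i ⟨a, b⟩ ⟨ha, hb⟩ ⟨a', b'⟩ ⟨ha', hb'⟩
    have := hE.f_iff_e i b hb b' hb'
    simp only [prodData, Option.map_eq_some_iff, Prod.mk.injEq]
    constructor
    · rintro ⟨z, hz, rfl, rfl⟩; exact ⟨b, this.1 hz, rfl, rfl⟩
    · rintro ⟨z, hz, rfl, rfl⟩; exact ⟨b', this.2 hz, rfl, rfl⟩

theorem tableauData_op_eq (T : Filling m n) (o : Bool × Idx m n) :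
    (tableauData m n).op o T = (wordOp o T.reading).map T.refill := by
  obtain ⟨b, i⟩ := o
  cases b <;> rfl

theorem IsTableau.op_iff {T T' : Filling m n} (hT : IsTableau T) {o : Bool × Idx m n} :
    (tableauData m n).op o T = some T' ↔ IsTableau T' ∧ wordOp o T.reading = some T'.reading ∧
      T'.map List.length = T.map List.length := by
  rw [tableauData_op_eq]
  constructor
  · intro h
    obtain ⟨w, hw, rfl⟩ := Option.map_eq_some_iff.1 h
    obtain ⟨S, h1, rfl, h3⟩ := hT.exists_wordOp hw
    rw [refill_eq rfl h3]
    exact ⟨h1, hw, h3⟩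
  · rintro ⟨-, h2, h3⟩
    rw [h2, Option.map_some, refill_eq rfl h3]

theorem isCrystal_tableaux (m n : ℕ) (μ : YoungDiagram) :
    IsCrystal (tableauData m n) (tableaux m n μ) := by
  refine isCrystal_of_word Filling.reading (List.map List.length) (fun _ => rfl) (fun _ _ => rfl)
    (fun _ _ => rfl) fun T hT o T' => ?_
  rw [mem_tableaux_iff] at hT
  rw [hT.1.op_iff, mem_tableaux_iff, hT.2]
  tauto

theorem isCrystal_left (m n u v : ℕ) :
    IsCrystal (matrixData m n u v).left (matrices m n u v) :=
  isCrystal_of_word wordI wordJ (fun _ => rfl) (fun _ _ => rfl) (fun _ _ => rfl)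
    fun _ hA _ _ => left_op_iff hA

theorem right_op_iff_left_op {A B : Matrix (Letter m n) (Letter u v) ℕ} {o : Bool × Idx u v} :
    (matrixData m n u v).right.op o A = some B ↔
      (matrixData u v m n).left.op o A.transpose = some B.transpose := by
  rw [right_op_eq, Option.map_eq_some_iff]
  constructor
  · rintro ⟨B, h, rfl⟩; exact h
  · intro h; exact ⟨_, h, rfl⟩

theorem left_op_iff_right_op {A B : Matrix (Letter m n) (Letter u v) ℕ} {o : Bool × Idx m n} :
    (matrixData m n u v).left.op o A = some B ↔
      (matrixData u v m n).right.op o A.transpose = some B.transpose := by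
  rw [right_op_iff_left_op]
  rfl

theorem right_op_iff {A B : Matrix (Letter m n) (Letter u v) ℕ} (hA : A ∈ matrices m n u v)
    {o : Bool × Idx u v} : (matrixData m n u v).right.op o A = some B ↔
      B ∈ matrices m n u v ∧ wordOp o (wordI A.transpose) = some (wordI B.transpose) ∧
        wordJ B.transpose = wordJ A.transpose := by
  rw [right_op_iff_left_op, left_op_iff (transpose_mem_matrices.2 hA), transpose_mem_matrices]

theorem isCrystal_right (m n u v : ℕ) :
    IsCrystal (matrixData m n u v).right (matrices m n u v) :=
  isCrystal_of_word (fun A => wordI A.transpose) (fun A => wordJ A.transpose)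
    (fun A => by rw [← wordL_eq]; rfl) (fun _ A => by rw [← wordL_eq]; rfl)
    (fun _ A => by rw [← wordL_eq]; rfl) fun _ hA _ _ => right_op_iff hA

/-! ### Commutation -/

theorem left_op_not {A B : Matrix (Letter m n) (Letter u v) ℕ} (hA : A ∈ matrices m n u v)
    {o : Bool × Idx m n} (h : (matrixData m n u v).left.op o A = some B) :
    (matrixData m n u v).left.op (!o.1, o.2) B = some A := by
  obtain ⟨h1, h2, h3⟩ := (left_op_iff hA).1 h
  exact (left_op_iff h1).2 ⟨hA, wordOp_not h2, h3.symm⟩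

theorem right_op_not {A B : Matrix (Letter m n) (Letter u v) ℕ} (hA : A ∈ matrices m n u v)
    {o : Bool × Idx u v} (h : (matrixData m n u v).right.op o A = some B) :
    (matrixData m n u v).right.op (!o.1, o.2) B = some A :=
  right_op_iff_left_op.2 (left_op_not (transpose_mem_matrices.2 hA) (right_op_iff_left_op.1 h))

theorem right_f_eq {A B : Matrix (Letter m n) (Letter u v) ℕ} (hA : A ∈ matrices m n u v)
    {j : Idx u v} (h : (matrixData m n u v).right.op (true, j) A = some B) :
    0 < (wordSig j (wordI A.transpose)).2 ∧ ∃ r, colPick j A.transpose = some r ∧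
      B = moveRow j r A := by
  have hA' := transpose_mem_matrices.2 hA
  have hpos : 0 < (wordSig j (wordI A.transpose)).2 := by
    obtain ⟨-, h2, -⟩ := (right_op_iff hA).1 h
    rw [wordSig_snd, pos_iff_ne_zero, Ne, ← wordF_eq_none]
    intro h3
    exact Option.some_ne_none _ (h2.symm.trans h3)
  obtain ⟨r, -, h1, h2⟩ := left_f_eq hA' hpos
  refine ⟨hpos, r, h1, ?_⟩
  rw [right_op_iff_left_op, h2] at h
  exact congrArg Matrix.transpose (Option.some.inj h).symm

/-- Only f^* needs the block computation; for e^* the statement is read backwards along the inverse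
operator. -/
theorem wordSig_right_op {A B : Matrix (Letter m n) (Letter u v) ℕ} (hA : A ∈ matrices m n u v)
    {o : Bool × Idx u v} (h : (matrixData m n u v).right.op o A = some B) (i : Idx m n) :
    wordSig i (wordI B) = wordSig i (wordI A) := by
  have key : ∀ {A B : Matrix (Letter m n) (Letter u v) ℕ} {j}, A ∈ matrices m n u v →
      (matrixData m n u v).right.op (true, j) A = some B →
      wordSig i (wordI B) = wordSig i (wordI A) := by
    intro A B j hA h
    obtain ⟨hpos, r, hr, rfl⟩ := right_f_eq hA h
    exact wordSig_moveRow hA i hpos hr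
  obtain ⟨b, j⟩ := o
  cases b
  · exact (key ((right_op_iff hA).1 h).1 (right_op_not hA h)).symm
  · exact key hA h

theorem wordSig_left_op {A B : Matrix (Letter m n) (Letter u v) ℕ} (hA : A ∈ matrices m n u v)
    {o : Bool × Idx m n} (h : (matrixData m n u v).left.op o A = some B) (j : Idx u v) :
    wordSig j (wordI B.transpose) = wordSig j (wordI A.transpose) :=
  wordSig_right_op (transpose_mem_matrices.2 hA) (left_op_iff_right_op.1 h) j

theorem wordOp_eq_none_congr {w w' : List (Letter m n)} {o : Bool × Idx m n}
    (h : wordSig o.2 w = wordSig o.2 w') : wordOp o w = none ↔ wordOp o w' = none := by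
  obtain ⟨b, i⟩ := o
  cases b
  · change wordE m n i w = none ↔ wordE m n i w' = none
    rw [wordE_eq_none, wordE_eq_none, ← wordSig_fst, ← wordSig_fst, h]
  · change wordF m n i w = none ↔ wordF m n i w' = none
    rw [wordF_eq_none, wordF_eq_none, ← wordSig_snd, ← wordSig_snd, h]

theorem left_op_eq_none_congr {A B : Matrix (Letter m n) (Letter u v) ℕ} {o : Bool × Idx m n}
    (h : wordSig o.2 (wordI A) = wordSig o.2 (wordI B)) :
    (matrixData m n u v).left.op o A = none ↔ (matrixData m n u v).left.op o B = none := by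
  rw [left_op_eq, left_op_eq, Option.map_eq_none_iff, Option.map_eq_none_iff,
    wordOp_eq_none_congr h]

theorem right_op_eq_none_congr {A B : Matrix (Letter m n) (Letter u v) ℕ} {o : Bool × Idx u v}
    (h : wordSig o.2 (wordI A.transpose) = wordSig o.2 (wordI B.transpose)) :
    (matrixData m n u v).right.op o A = none ↔ (matrixData m n u v).right.op o B = none := by
  rw [right_op_eq, right_op_eq, Option.map_eq_none_iff, Option.map_eq_none_iff,
    left_op_eq_none_congr h]

theorem left_f_eq_moveCol {A B : Matrix (Letter m n) (Letter u v) ℕ} (hA : A ∈ matrices m n u v)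
    {i : Idx m n} (h : (matrixData m n u v).left.op (true, i) A = some B) :
    0 < (wordSig i (wordI A)).2 ∧ ∃ c, colPick i A = some c ∧ B = moveCol i c A := by
  obtain ⟨h1, c, h2, h3⟩ := right_f_eq (transpose_mem_matrices.2 hA) (left_op_iff_right_op.1 h)
  exact ⟨h1, c, h2, congrArg Matrix.transpose h3⟩

/-- Neither operator changes ε or φ of the other, so the two composites are defined together; where
they are, `moveRow_moveCol` identifies them. -/
theorem commuteAt_f_f {A : Matrix (Letter m n) (Letter u v) ℕ} (hA : A ∈ matrices m n u v)
    (i : Idx m n) (j : Idx u v) : CommuteAt ((matrixData m n u v).left.op (true, i))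
      ((matrixData m n u v).right.op (true, j)) A := by
  unfold CommuteAt
  cases hl : (matrixData m n u v).left.op (true, i) A with
  | none =>
    cases hr : (matrixData m n u v).right.op (true, j) A with
    | none => rfl
    | some D => exact (left_op_eq_none_congr (wordSig_right_op hA hr i)).2 hl
  | some B =>
    cases hr : (matrixData m n u v).right.op (true, j) A with
    | none => exact ((right_op_eq_none_congr (wordSig_left_op hA hl j)).2 hr).symm
    | some D =>
      simp only [Option.bind_some]
      obtain ⟨B', hB'⟩ : ∃ B', (matrixData m n u v).left.op (true, i) D = some B' := by
        rw [← Option.ne_none_iff_exists', Ne,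
          left_op_eq_none_congr (o := (true, i)) (wordSig_right_op hA hr i), hl]
        simp
      obtain ⟨D', hD'⟩ : ∃ D', (matrixData m n u v).right.op (true, j) B = some D' := by
        rw [← Option.ne_none_iff_exists', Ne,
          right_op_eq_none_congr (o := (true, j)) (wordSig_left_op hA hl j), hr]
        simp
      have hB := ((left_op_iff hA).1 hl).1
      have hD := ((right_op_iff hA).1 hr).1
      obtain ⟨h1, c, hc, rfl⟩ := left_f_eq_moveCol hA hl
      obtain ⟨h2, r, hrow, rfl⟩ := right_f_eq hA hr
      obtain ⟨-, c', hc', rfl⟩ := left_f_eq_moveCol hD hB'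
      obtain ⟨-, r', hr', rfl⟩ := right_f_eq hB hD'
      rw [hB', hD', moveRow_moveCol hA h1 h2 hc hrow hc' hr']

theorem CommuteAt.symm {X : Type*} {x y : X → Option X} {b : X} (h : CommuteAt x y b) :
    CommuteAt y x b := Eq.symm h

/-- An operator that commutes with a partial bijection commutes with its inverse. -/
theorem CommuteAt.of_inverse {X : Type*} {S : Set X} {f e g : X → Option X}
    (he : ∀ x ∈ S, ∀ y, e x = some y → y ∈ S) (hf : ∀ x ∈ S, ∀ y, f x = some y → e y = some x)
    (he' : ∀ x ∈ S, ∀ y, e x = some y → f y = some x)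
    (hgS : ∀ x ∈ S, ∀ y, g x = some y → y ∈ S) (hfg : ∀ x ∈ S, CommuteAt f g x)
    (hg : ∀ x ∈ S, ∀ y, g x = some y → (e y = none ↔ e x = none) ∧ (f y = none ↔ f x = none))
    {x : X} (hx : x ∈ S) : CommuteAt e g x := by
  unfold CommuteAt
  cases hex : e x with
  | none =>
    cases hgx : g x with
    | none => rfl
    | some y => exact (hg x hx y hgx).1.2 hex
  | some x₀ =>
    have hx₀ := he x hx x₀ hex
    have h1 : (g x₀).bind f = (f x₀).bind g := hfg x₀ hx₀
    rw [he' x hx x₀ hex] at h1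
    cases hgx : g x₀ with
    | none =>
      rw [hgx] at h1
      simp only [Option.bind_some, Option.bind_none] at h1 ⊢
      rw [← h1, hgx]
      rfl
    | some y₀ =>
      rw [hgx] at h1
      simp only [Option.bind_some] at h1 ⊢
      cases hfy : f y₀ with
      | none =>
        have := (hg x₀ hx₀ y₀ hgx).2.1 hfy
        rw [he' x hx x₀ hex] at this
        exact absurd this (Option.some_ne_none _)
      | some y =>
        rw [← h1, hfy, hgx]
        exact hf y₀ (hgS x₀ hx₀ y₀ hgx) y hfy

theorem commuteAt_op {A : Matrix (Letter m n) (Letter u v) ℕ} (hA : A ∈ matrices m n u v)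
    (o : Bool × Idx m n) (o' : Bool × Idx u v) : CommuteAt ((matrixData m n u v).left.op o)
      ((matrixData m n u v).right.op o') A := by
  have hl : ∀ A ∈ matrices m n u v, ∀ o B, (matrixData m n u v).left.op o A = some B →
      B ∈ matrices m n u v := fun A hA o B h => ((left_op_iff hA).1 h).1
  have hr : ∀ A ∈ matrices m n u v, ∀ o B, (matrixData m n u v).right.op o A = some B →
      B ∈ matrices m n u v := fun A hA o B h => ((right_op_iff hA).1 h).1
  obtain ⟨b, i⟩ := o
  obtain ⟨b', j⟩ := o'
  -- From f and f^* the claim passes to e^* and then to e by inverting one operator at a time.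
  have key : ∀ A ∈ matrices m n u v, CommuteAt ((matrixData m n u v).left.op (true, i))
      ((matrixData m n u v).right.op (b', j)) A := by
    intro A hA
    cases b'
    · exact (CommuteAt.of_inverse (S := matrices m n u v)
        (f := (matrixData m n u v).right.op (true, j)) (fun A hA => hr A hA _)
        (fun A hA _ h => right_op_not hA h) (fun A hA _ h => right_op_not hA h)
        (fun A hA => hl A hA _) (fun A hA => (commuteAt_f_f hA i j).symm)
        (fun A hA B h => ⟨right_op_eq_none_congr (wordSig_left_op hA h j),
          right_op_eq_none_congr (wordSig_left_op hA h j)⟩) hA).symm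
    · exact commuteAt_f_f hA i j
  cases b
  · exact CommuteAt.of_inverse (S := matrices m n u v)
      (f := (matrixData m n u v).left.op (true, i)) (fun A hA => hl A hA _)
      (fun A hA _ h => left_op_not hA h) (fun A hA _ h => left_op_not hA h)
      (fun A hA => hr A hA _) key
      (fun A hA B h => ⟨left_op_eq_none_congr (wordSig_right_op hA h i),
        left_op_eq_none_congr (wordSig_right_op hA h i)⟩) hA
  · exact key A hA

theorem isBicrystal_of_closed {C : Set (Matrix (Letter m n) (Letter u v) ℕ)}
    (hC : C ⊆ matrices m n u v)
    (hl : ∀ A ∈ C, ∀ o B, (matrixData m n u v).left.op o A = some B → B ∈ C)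
    (hr : ∀ A ∈ C, ∀ o B, (matrixData m n u v).right.op o A = some B → B ∈ C) :
    IsBicrystal (matrixData m n u v) C where
  left := (isCrystal_left m n u v).mono hC (fun i A hA => hl A hA (false, i))
    fun i A hA => hl A hA (true, i)
  right := (isCrystal_right m n u v).mono hC (fun i A hA => hr A hA (false, i))
    fun i A hA => hr A hA (true, i)
  e_e i j _ hA := commuteAt_op (hC hA) (false, i) (false, j)
  e_f i j _ hA := commuteAt_op (hC hA) (false, i) (true, j)
  f_e i j _ hA := commuteAt_op (hC hA) (true, i) (false, j)
  f_f i j _ hA := commuteAt_op (hC hA) (true, i) (true, j)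

end HookCrystal

namespace HookCrystal
variable {m n u v : ℕ}

/-! ### The components of the bicrystal of matrices -/

/-- Both sides are row sums; since x_j^* preserves the word k, it preserves the weight of i. -/
theorem wordWt_wordI (A : Matrix (Letter m n) (Letter u v) ℕ) (b : Letter m n) :
    wordWt m n (wordI A) b = (wordJ A.transpose).count b := by
  rw [wordWt_apply, wordI_eq, colsWord, wordJ_eq, List.count_flatMap, List.count_flatMap,
    ← List.ofFn_eq_map, ← List.ofFn_eq_map, List.sum_ofFn, List.sum_ofFn]
  simp only [Function.comp_apply, count_sortedWord, List.count_replicate, beq_iff_eq,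
    Finset.sum_ite_eq', Finset.mem_univ, if_true]
  rfl

/-- Because a starred operator commutes with the unstarred ones and keeps weights, ε and φ, the
pairs of first words that it relates form a bisimulation. -/
theorem crystalEquiv_right_op {A B : Matrix (Letter m n) (Letter u v) ℕ}
    (hA : A ∈ matrices m n u v) {o : Bool × Idx u v}
    (h : (matrixData m n u v).right.op o A = some B) : CrystalEquiv (wordI A) (wordI B) := by
  refine CrystalEquiv.of_rel (R := fun w w' => ∃ A ∈ matrices m n u v, ∃ B,
    (matrixData m n u v).right.op o A = some B ∧ w = wordI A ∧ w' = wordI B) ?_ ?_ ?_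
    ⟨A, hA, B, h, rfl, rfl⟩
  · rintro _ _ ⟨A, hA, B, h, rfl, rfl⟩
    ext b
    rw [wordWt_wordI, wordWt_wordI, ((right_op_iff hA).1 h).2.2]
  · rintro _ _ ⟨A, hA, B, h, rfl, rfl⟩ i
    exact (wordSig_right_op hA h i).symm
  · rintro _ _ ⟨A, hA, B, h, rfl, rfl⟩ o' w hw
    obtain ⟨A', h1, rfl, h2⟩ := exists_wordI_of_wordOp hA hw
    have hl := (left_op_iff hA).2 ⟨h1, hw, h2⟩
    have hc : (_ : Option _).bind _ = (_ : Option _).bind _ := commuteAt_op hA o' o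
    rw [h, hl] at hc
    simp only [Option.bind_some] at hc
    have hne : (matrixData m n u v).right.op o A' ≠ none := by
      rw [Ne, right_op_eq_none_congr (wordSig_left_op hA hl o.2), h]
      simp
    obtain ⟨B', hB'⟩ := Option.ne_none_iff_exists'.1 hne
    rw [hB'] at hc
    exact ⟨wordI B', ((left_op_iff ((right_op_iff hA).1 h).1).1 hc).2.1, A', h1, B', hB', rfl, rfl⟩

/-- One step in the crystal of matrices for `gl_{m|n}`. -/
def LeftStep (A B : Matrix (Letter m n) (Letter u v) ℕ) : Prop :=
  A ∈ matrices m n u v ∧ ∃ o, (matrixData m n u v).left.op o A = some B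

/-- One step in the crystal of matrices for `gl_{u|v}`. -/
def RightStep (A B : Matrix (Letter m n) (Letter u v) ℕ) : Prop :=
  A ∈ matrices m n u v ∧ ∃ o, (matrixData m n u v).right.op o A = some B

theorem leftStep_iff {A B : Matrix (Letter m n) (Letter u v) ℕ} :
    LeftStep A B ↔ RightStep A.transpose B.transpose := by
  unfold LeftStep RightStep
  rw [transpose_mem_matrices]
  simp only [left_op_iff_right_op]

theorem rightStep_iff {A B : Matrix (Letter m n) (Letter u v) ℕ} :
    RightStep A B ↔ LeftStep A.transpose B.transpose := by
  rw [leftStep_iff]; rfl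

theorem LeftStep.mem {A B : Matrix (Letter m n) (Letter u v) ℕ} (h : LeftStep A B) :
    B ∈ matrices m n u v := by
  obtain ⟨hA, o, h⟩ := h
  exact ((left_op_iff hA).1 h).1

theorem RightStep.mem {A B : Matrix (Letter m n) (Letter u v) ℕ} (h : RightStep A B) :
    B ∈ matrices m n u v :=
  transpose_mem_matrices.1 (rightStep_iff.1 h).mem

theorem LeftStep.symm {A B : Matrix (Letter m n) (Letter u v) ℕ} (h : LeftStep A B) :
    LeftStep B A := by
  refine ⟨h.mem, ?_⟩
  obtain ⟨hA, o, h⟩ := h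
  exact ⟨_, left_op_not hA h⟩

theorem RightStep.symm {A B : Matrix (Letter m n) (Letter u v) ℕ} (h : RightStep A B) :
    RightStep B A :=
  rightStep_iff.2 (rightStep_iff.1 h).symm

theorem RightStep.swap {A B D : Matrix (Letter m n) (Letter u v) ℕ} (h : RightStep A B)
    (h' : LeftStep B D) : ∃ B', LeftStep A B' ∧ RightStep B' D := by
  obtain ⟨hA, o, h⟩ := h
  obtain ⟨-, o', h'⟩ := h'
  have hc : (_ : Option _).bind _ = (_ : Option _).bind _ := commuteAt_op hA o' o
  rw [h, Option.bind_some, h'] at hc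
  obtain ⟨B', h1, h2⟩ := Option.bind_eq_some_iff.1 hc.symm
  have hs : LeftStep A B' := ⟨hA, o', h1⟩
  exact ⟨B', hs, hs.mem, o, h2⟩

/-- Commutation moves every unstarred step in front of all starred ones. -/
theorem exists_left_right {A D : Matrix (Letter m n) (Letter u v) ℕ}
    (h : Relation.ReflTransGen (fun A B => LeftStep A B ∨ RightStep A B) A D) :
    ∃ B, Relation.ReflTransGen LeftStep A B ∧ Relation.ReflTransGen RightStep B D := by
  have swap : ∀ {A B D : Matrix (Letter m n) (Letter u v) ℕ}, Relation.ReflTransGen RightStep A B →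
      LeftStep B D → ∃ B', LeftStep A B' ∧ Relation.ReflTransGen RightStep B' D := by
    intro A B D h
    induction h generalizing D with
    | refl => exact fun h' => ⟨D, h', .refl⟩
    | tail _ h1 ih =>
      intro h'
      obtain ⟨B', h2, h3⟩ := h1.swap h'
      obtain ⟨B'', h4, h5⟩ := ih h2
      exact ⟨B'', h4, h5.tail h3⟩
  induction h with
  | refl => exact ⟨A, .refl, .refl⟩
  | tail _ h1 ih =>
    obtain ⟨B, h2, h3⟩ := ih
    rcases h1 with h1 | h1
    · obtain ⟨B', h4, h5⟩ := swap h3 h1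
      exact ⟨B', h2.tail h4, h5⟩
    · exact ⟨B, h2, h3.tail h1⟩

theorem RightStep.insertionTableau_eq {A B : Matrix (Letter m n) (Letter u v) ℕ}
    (h : RightStep A B) : insertionTableau m n (wordI A) = insertionTableau m n (wordI B) := by
  obtain ⟨hA, o, h⟩ := h
  exact (crystalEquiv_right_op hA h).insertionTableau_eq

theorem LeftStep.insertionTableau_eq {A B : Matrix (Letter m n) (Letter u v) ℕ}
    (h : LeftStep A B) : insertionTableau u v (wordL A) = insertionTableau u v (wordL B) := by
  rw [wordL_eq, wordL_eq]
  exact (leftStep_iff.1 h).insertionTableau_eq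

theorem LeftStep.map_length_eq {A B : Matrix (Letter m n) (Letter u v) ℕ} (h : LeftStep A B) :
    (insertionTableau m n (wordI B)).map List.length =
      (insertionTableau m n (wordI A)).map List.length := by
  obtain ⟨hA, o, h⟩ := h
  exact (wordOp_insertionTableau ((left_op_iff hA).1 h).2.1).2

theorem LeftStep.wordConn {A B : Matrix (Letter m n) (Letter u v) ℕ} (h : LeftStep A B) :
    WordConn (wordI A) (wordI B) ∧ wordJ A = wordJ B := by
  obtain ⟨hA, ⟨b, i⟩, h⟩ := h
  obtain ⟨-, h1, h2⟩ := (left_op_iff hA).1 h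
  refine ⟨?_, h2.symm⟩
  cases b
  · exact .symm _ _ (.rel _ _ ⟨i, wordOp_not h1⟩)
  · exact .rel _ _ ⟨i, h1⟩

/-- Unstarred steps fix the word j and keep i in its component of the crystal of words, where P is
injective; the two words determine the matrix. -/
theorem left_conn_eq {A B : Matrix (Letter m n) (Letter u v) ℕ}
    (h : Relation.ReflTransGen LeftStep A B)
    (hP : insertionTableau m n (wordI A) = insertionTableau m n (wordI B)) : A = B := by
  have key : WordConn (wordI A) (wordI B) ∧ wordJ A = wordJ B := by
    clear hP
    induction h with
    | refl => exact ⟨.refl _, rfl⟩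
    | tail _ h1 ih =>
      obtain ⟨h2, h3⟩ := h1.wordConn
      exact ⟨.trans _ _ _ ih.1 h2, ih.2.trans h3⟩
  rw [← toMatrix_zip_wordJ (A := B) key.2, key.1.eq_of_insertionTableau_eq hP,
    ← biword_eq_zip, toMatrix_biword]

theorem right_conn_eq {A B : Matrix (Letter m n) (Letter u v) ℕ}
    (h : Relation.ReflTransGen RightStep A B)
    (hP : insertionTableau u v (wordL A) = insertionTableau u v (wordL B)) : A = B := by
  rw [wordL_eq, wordL_eq] at hP
  have h' := h.lift (p := LeftStep) Matrix.transpose fun _ _ h => rightStep_iff.1 h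
  exact Matrix.transpose_injective (left_conn_eq h' hP)

theorem right_conn_insertionTableau_eq {A B : Matrix (Letter m n) (Letter u v) ℕ}
    (h : Relation.ReflTransGen RightStep A B) :
    insertionTableau m n (wordI A) = insertionTableau m n (wordI B) := by
  induction h with
  | refl => rfl
  | tail _ h1 ih => rw [ih, h1.insertionTableau_eq]

theorem left_conn_insertionTableau_eq {A B : Matrix (Letter m n) (Letter u v) ℕ}
    (h : Relation.ReflTransGen LeftStep A B) :
    insertionTableau u v (wordL A) = insertionTableau u v (wordL B) := by
  induction h with
  | refl => rfl
  | tail _ h1 ih => rw [ih, h1.insertionTableau_eq]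

/-- At the turning point `B` of the rearranged path the first tableau is already that of `D`, hence
that of `A`. So the unstarred half of the path returns to `A`, and then the starred half does too.
-/
theorem piMap_injective {A D : Matrix (Letter m n) (Letter u v) ℕ}
    (h : Relation.ReflTransGen (fun A B => LeftStep A B ∨ RightStep A B) A D)
    (hP : piMap m n u v A = piMap m n u v D) : A = D := by
  obtain ⟨B, h1, h2⟩ := exists_left_right h
  have hP1 : insertionTableau m n (wordI A) = insertionTableau m n (wordI D) :=
    congrArg Prod.fst hP
  have hP2 : insertionTableau u v (wordL A) = insertionTableau u v (wordL D) :=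
    congrArg Prod.snd hP
  obtain rfl := left_conn_eq h1 (hP1.trans (right_conn_insertionTableau_eq h2).symm)
  exact right_conn_eq h2 hP2

/-- The path from P(i) to `T` in the connected crystal of tableaux is followed by the same operators
on matrices. -/
theorem exists_left_conn {A : Matrix (Letter m n) (Letter u v) ℕ} (hA : A ∈ matrices m n u v)
    {T : Filling m n} (hT : IsTableau T)
    (hl : T.map List.length = (insertionTableau m n (wordI A)).map List.length) :
    ∃ B ∈ matrices m n u v, Relation.ReflTransGen LeftStep A B ∧
      insertionTableau m n (wordI B) = T := by
  have follow : ∀ (s : List (Bool × Idx m n)) {A : Matrix (Letter m n) (Letter u v) ℕ},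
      A ∈ matrices m n u v → ∀ {w}, wordOps s (wordI A) = some w →
        ∃ B ∈ matrices m n u v, Relation.ReflTransGen LeftStep A B ∧ wordI B = w := by
    intro s
    induction s with
    | nil => exact fun {A} hA w h => ⟨A, hA, .refl, Option.some.inj h⟩
    | cons o s ih =>
      intro A hA w h
      obtain ⟨w₁, h1, h2⟩ := Option.bind_eq_some_iff.1 h
      obtain ⟨A', h3, rfl, h4⟩ := exists_wordI_of_wordOp hA h1
      obtain ⟨B, h5, h6, h7⟩ := ih h3 h2
      exact ⟨B, h5, .head ⟨hA, o, (left_op_iff hA).2 ⟨h3, h1, h4⟩⟩ h6, h7⟩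
  have hP := isTableau_insertionTableau (wordI A)
  obtain ⟨s, hs⟩ := (hP.wordConn hT hl.symm).exists_wordOps
  -- The word i of `A` is equivalent to the reading of its tableau, so the same operators are
  -- defined on it and end at a word equivalent to `T`.
  obtain ⟨w, hw, he⟩ := (crystalEquiv_insertionTableau (wordI A)).symm.exists_ops hs
  obtain ⟨B, h1, h2, rfl⟩ := follow s hA hw
  exact ⟨B, h1, h2, (isTableau_insertionTableau _).eq_of_crystalEquiv hT
    ((crystalEquiv_insertionTableau _).symm.trans he.symm)⟩

theorem exists_right_conn {A : Matrix (Letter m n) (Letter u v) ℕ} (hA : A ∈ matrices m n u v)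
    {T : Filling u v} (hT : IsTableau T)
    (hl : T.map List.length = (insertionTableau u v (wordL A)).map List.length) :
    ∃ B ∈ matrices m n u v, Relation.ReflTransGen RightStep A B ∧
      insertionTableau u v (wordL B) = T := by
  rw [wordL_eq] at hl
  obtain ⟨B, h1, h2, h3⟩ := exists_left_conn (transpose_mem_matrices.2 hA) hT hl
  refine ⟨B.transpose, transpose_mem_matrices.2 h1, ?_, by rw [wordL_eq]; exact h3⟩
  exact h2.lift (p := RightStep) Matrix.transpose fun _ _ h => leftStep_iff.1 h

/-- Steps by e are inverse arrows, so the steps are already symmetric and directed paths suffice. -/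
theorem eqvGen_arrow_iff {A B : Matrix (Letter m n) (Letter u v) ℕ} :
    Relation.EqvGen (Arrow (matrixData m n u v) (matrices m n u v)) A B ↔
      Relation.ReflTransGen (fun A B => LeftStep A B ∨ RightStep A B) A B := by
  have hsymm : ∀ {A B : Matrix (Letter m n) (Letter u v) ℕ},
      Relation.ReflTransGen (fun A B => LeftStep A B ∨ RightStep A B) A B →
      Relation.ReflTransGen (fun A B => LeftStep A B ∨ RightStep A B) B A := by
    intro A B h
    induction h with
    | refl => exact .refl
    | tail _ h1 ih => exact .head (h1.imp LeftStep.symm RightStep.symm) ih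
  constructor
  · intro h
    induction h with
    | rel A B h =>
      obtain ⟨hA, -, ⟨i, h⟩ | ⟨j, h⟩⟩ := h
      · exact .single (Or.inl ⟨hA, (true, i), h⟩)
      · exact .single (Or.inr ⟨hA, (true, j), h⟩)
    | refl A => exact .refl
    | symm A B _ ih => exact hsymm ih
    | trans A B D _ _ ih ih' => exact ih.trans ih'
  · intro h
    induction h with
    | refl => exact .refl _
    | tail _ h1 ih =>
      refine .trans _ _ _ ih ?_
      rcases h1 with h1 | h1
      · have h2 := h1.mem
        obtain ⟨hA, ⟨b, i⟩, h⟩ := h1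
        cases b
        · exact .symm _ _ (.rel _ _ ⟨h2, hA, Or.inl ⟨i, left_op_not hA h⟩⟩)
        · exact .rel _ _ ⟨hA, h2, Or.inl ⟨i, h⟩⟩
      · have h2 := h1.mem
        obtain ⟨hA, ⟨b, j⟩, h⟩ := h1
        cases b
        · exact .symm _ _ (.rel _ _ ⟨h2, hA, Or.inr ⟨j, right_op_not hA h⟩⟩)
        · exact .rel _ _ ⟨hA, h2, Or.inr ⟨j, h⟩⟩

/-! ### Compatibility of π with the crystal structures -/

theorem tableauData_op_insertionTableau {w w' : List (Letter m n)} {o : Bool × Idx m n}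
    (h : wordOp o w = some w') :
    (tableauData m n).op o (insertionTableau m n w) = some (insertionTableau m n w') :=
  (isTableau_insertionTableau w).op_iff.2 ⟨isTableau_insertionTableau w',
    wordOp_insertionTableau h⟩

theorem preservesCrystal_left {C : Set (Matrix (Letter m n) (Letter u v) ℕ)}
    {S : Set (Filling m n × Filling u v)} (hC : C ⊆ matrices m n u v)
    (hl : ∀ A ∈ C, ∀ o B, (matrixData m n u v).left.op o A = some B → B ∈ C)
    (hbij : Set.BijOn (piMap m n u v) C S) :
    PreservesCrystal (matrixData m n u v).left C
      (prodData (tableauData m n) (tableauData u v)).left S (piMap m n u v) := by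
  have hfwd : ∀ i, ∀ A ∈ C, ∀ B, (matrixData m n u v).left.f i A = some B →
      (prodData (tableauData m n) (tableauData u v)).left.f i (piMap m n u v A) =
        some (piMap m n u v B) := by
    intro i A hA B h
    have hs : LeftStep A B := ⟨hC hA, (true, i), h⟩
    have h1 := tableauData_op_insertionTableau
      ((left_op_iff (hC hA) (o := (true, i))).1 h).2.1
    refine Option.map_eq_some_iff.2 ⟨_, h1, ?_⟩
    change (_, insertionTableau u v (wordL A)) = _
    rw [hs.insertionTableau_eq]
    rfl
  have hequiv := fun A : Matrix (Letter m n) (Letter u v) ℕ =>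
    (crystalEquiv_insertionTableau (wordI A)).symm
  refine ⟨hbij, ?_, fun A _ => (hequiv A).wt_eq,
    fun i A _ => congrArg Prod.fst ((hequiv A).sig_eq i),
    fun i A _ => congrArg Prod.snd ((hequiv A).sig_eq i)⟩
  intro i A hA B hB
  refine ⟨hfwd i A hA B, fun h => ?_⟩
  -- Conversely, f_i is undefined on `A` exactly when it is on the tableau, since φ agrees; if it is
  -- defined, injectivity of π identifies the target.
  cases hf : (matrixData m n u v).left.f i A with
  | none =>
    have h1 : wordOp (true, i) (wordI A) = none := by
      have h2 : (matrixData m n u v).left.op (true, i) A = none := hf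
      rwa [left_op_eq, Option.map_eq_none_iff] at h2
    rw [← wordOp_eq_none_congr ((hequiv A).sig_eq i)] at h1
    obtain ⟨T, h2, -⟩ := Option.map_eq_some_iff.1 h
    have h3 : (tableauData m n).op (true, i) (insertionTableau m n (wordI A)) = some T := h2
    rw [tableauData_op_eq, h1] at h3
    cases h3
  | some B' =>
    rw [hfwd i A hA B' hf] at h
    rw [hbij.injOn (hl A hA (true, i) B' hf) hB (Option.some.inj h)]

theorem preservesCrystal_right {C : Set (Matrix (Letter m n) (Letter u v) ℕ)}
    {S : Set (Filling m n × Filling u v)} (hC : C ⊆ matrices m n u v)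
    (hr : ∀ A ∈ C, ∀ o B, (matrixData m n u v).right.op o A = some B → B ∈ C)
    (hbij : Set.BijOn (piMap m n u v) C S) :
    PreservesCrystal (matrixData m n u v).right C
      (prodData (tableauData m n) (tableauData u v)).right S (piMap m n u v) := by
  have hfwd : ∀ i, ∀ A ∈ C, ∀ B, (matrixData m n u v).right.f i A = some B →
      (prodData (tableauData m n) (tableauData u v)).right.f i (piMap m n u v A) =
        some (piMap m n u v B) := by
    intro i A hA B h
    have hs : RightStep A B := ⟨hC hA, (true, i), h⟩
    have h1 := tableauData_op_insertionTableau
      ((right_op_iff (hC hA) (o := (true, i))).1 h).2.1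
    rw [← wordL_eq, ← wordL_eq] at h1
    refine Option.map_eq_some_iff.2 ⟨_, h1, ?_⟩
    change (insertionTableau m n (wordI A), _) = _
    rw [hs.insertionTableau_eq]
    rfl
  have hequiv := fun A : Matrix (Letter m n) (Letter u v) ℕ =>
    (crystalEquiv_insertionTableau (wordL A)).symm
  refine ⟨hbij, ?_, fun A _ => (hequiv A).wt_eq,
    fun i A _ => congrArg Prod.fst ((hequiv A).sig_eq i),
    fun i A _ => congrArg Prod.snd ((hequiv A).sig_eq i)⟩
  intro i A hA B hB
  refine ⟨hfwd i A hA B, fun h => ?_⟩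
  cases hf : (matrixData m n u v).right.f i A with
  | none =>
    have h1 : wordOp (true, i) (wordL A) = none := Option.map_eq_none_iff.1 hf
    rw [← wordOp_eq_none_congr ((hequiv A).sig_eq i)] at h1
    obtain ⟨T, h2, -⟩ := Option.map_eq_some_iff.1 h
    have h3 : (tableauData u v).op (true, i) (insertionTableau u v (wordL A)) = some T := h2
    rw [tableauData_op_eq, h1] at h3
    cases h3
  | some B' =>
    rw [hfwd i A hA B' hf] at h
    rw [hbij.injOn (hr A hA (true, i) B' hf) hB (Option.some.inj h)]

theorem map_length_piMap {A B : Matrix (Letter m n) (Letter u v) ℕ}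
    (h : Relation.ReflTransGen (fun A B => LeftStep A B ∨ RightStep A B) A B) :
    (piMap m n u v B).1.map List.length = (piMap m n u v A).1.map List.length ∧
      (piMap m n u v B).2.map List.length = (piMap m n u v A).2.map List.length := by
  induction h with
  | refl => exact ⟨rfl, rfl⟩
  | tail _ h1 ih =>
    rw [← ih.1, ← ih.2]
    rcases h1 with h1 | h1
    · exact ⟨h1.map_length_eq, by unfold piMap; dsimp only; rw [h1.insertionTableau_eq]⟩
    · refine ⟨by unfold piMap; dsimp only; rw [h1.insertionTableau_eq], ?_⟩
      unfold piMap
      dsimp only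
      rw [wordL_eq, wordL_eq]
      exact (rightStep_iff.1 h1).map_length_eq

/-- On a component of the bicrystal of matrices, `π` is an isomorphism onto a product of two
crystals of tableaux. -/
theorem IsComponent.exists_isBicrystalIso {C : Set (Matrix (Letter m n) (Letter u v) ℕ)}
    (hC : IsComponent (matrixData m n u v) (matrices m n u v) C) :
    ∃ lam mu : YoungDiagram, IsHook m n lam ∧ IsHook u v mu ∧
      IsBicrystalIso (matrixData m n u v) C (prodData (tableauData m n) (tableauData u v))
        (tableaux m n lam ×ˢ tableaux u v mu) (piMap m n u v) := by
  obtain ⟨A₀, hA₀, rfl⟩ := hC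
  simp only [eqvGen_arrow_iff]
  obtain ⟨lam, hlam, hT⟩ := (isTableau_insertionTableau (wordI A₀)).exists_shape
  obtain ⟨mu, hmu, hU⟩ := (isTableau_insertionTableau (wordL A₀)).exists_shape
  refine ⟨lam, mu, hlam, hmu, ?_⟩
  rw [mem_tableaux_iff] at hT hU
  set C : Set (Matrix (Letter m n) (Letter u v) ℕ) := {B | B ∈ matrices m n u v ∧
    Relation.ReflTransGen (fun A B => LeftStep A B ∨ RightStep A B) A₀ B}
  have hC : C ⊆ matrices m n u v := fun B hB => hB.1
  have hl : ∀ A ∈ C, ∀ o B, (matrixData m n u v).left.op o A = some B → B ∈ C := by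
    intro A hA o B h
    have hs : LeftStep A B := ⟨hA.1, o, h⟩
    exact ⟨hs.mem, hA.2.tail (Or.inl hs)⟩
  have hr : ∀ A ∈ C, ∀ o B, (matrixData m n u v).right.op o A = some B → B ∈ C := by
    intro A hA o B h
    have hs : RightStep A B := ⟨hA.1, o, h⟩
    exact ⟨hs.mem, hA.2.tail (Or.inr hs)⟩
  have hbij : Set.BijOn (piMap m n u v) C (tableaux m n lam ×ˢ tableaux u v mu) := by
    refine ⟨fun A hA => ?_, fun A hA B hB hP => ?_, ?_⟩
    · obtain ⟨h1, h2⟩ := map_length_piMap hA.2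
      exact ⟨mem_tableaux_iff.2 ⟨isTableau_insertionTableau _, h1.trans hT.2⟩,
        mem_tableaux_iff.2 ⟨isTableau_insertionTableau _, h2.trans hU.2⟩⟩
    · refine piMap_injective ?_ hP
      rw [← eqvGen_arrow_iff]
      exact .trans _ _ _ (.symm _ _ (eqvGen_arrow_iff.2 hA.2)) (eqvGen_arrow_iff.2 hB.2)
    -- Unstarred steps lead to a matrix with first tableau `T`; starred steps from there reach the
    -- second tableau `U` without changing the first.
    · rintro ⟨T, U⟩ ⟨h1, h2⟩
      rw [mem_tableaux_iff] at h1 h2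
      obtain ⟨A, hA, h3, h4⟩ := exists_left_conn hA₀ h1.1 (h1.2.trans hT.2.symm)
      have h5 := left_conn_insertionTableau_eq h3
      obtain ⟨B, hB, h6, h7⟩ := exists_right_conn hA h2.1 (by rw [← h5]; exact h2.2.trans hU.2.symm)
      refine ⟨B, ⟨hB, ?_⟩, ?_⟩
      · exact Relation.ReflTransGen.trans
          (h3.lift (p := fun A B => LeftStep A B ∨ RightStep A B) id fun _ _ h => Or.inl h)
          (h6.lift (p := fun A B => LeftStep A B ∨ RightStep A B) id fun _ _ h => Or.inr h)
      · exact Prod.ext ((right_conn_insertionTableau_eq h6).symm.trans h4) h7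
  exact ⟨isBicrystal_of_closed hC hl hr,
    isBicrystal_prod (isCrystal_tableaux m n lam) (isCrystal_tableaux u v mu),
    preservesCrystal_left hC hl hbij, preservesCrystal_right hC hr hbij⟩

end HookCrystal

theorem proposition3p5 (m n u v : ℕ) (hmn : 0 < m + n) (huv : 0 < u + v)
    (C : Set (Matrix (HookCrystal.Letter m n) (HookCrystal.Letter u v) ℕ))
    (hC : HookCrystal.IsComponent (HookCrystal.matrixData m n u v)
      (HookCrystal.matrices m n u v) C) :
    ∃ lam mu : YoungDiagram, HookCrystal.IsHook m n lam ∧ HookCrystal.IsHook u v mu ∧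
      HookCrystal.IsBicrystalIso (HookCrystal.matrixData m n u v) C
        (HookCrystal.prodData (HookCrystal.tableauData m n) (HookCrystal.tableauData u v))
        (HookCrystal.tableaux m n lam ×ˢ HookCrystal.tableaux u v mu)
        (HookCrystal.piMap m n u v) := by
  exact hC.exists_isBicrystalIso
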